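/- Let $\mathbf{k}$ be a commutative ring and $\mathfrak{g}$ a $\mathbf{k}$-module. Put $\widehat{\mathfrak{g}} = \Sigma\mathfrak{g} \oplus \langle t\rangle$, where $\Sigma\mathfrak{g}$ is a copy of $\mathfrak{g}$ and $\langle t\rangle$ is free of rank one on $t$, both placed in degree $1$. The tensor algebra $T\widehat{\mathfrak{g}} = \bigoplus_{n\ge 0}\widehat{\mathfrak{g}}^{\otimes n}$ over $\mathbf{k}$ is an $\mathbb{S}$-module: $S_n$ acts on $\widehat{\mathfrak{g}}^{\otimes n}$ on the left by permuting the factors, the $i$-th factor being moved to position $\sigma(i)$. Juxtaposition denotes the usual (concatenation) product, and $\mathbf{k}[t]\subseteq T\widehat{\mathfrak{g}}$ is spanned by the powers of $t$. Write $$T\widehat{\mathfrak{g}}\otimes_{\mathbb{S}}T\widehat{\mathfrak{g}}=\bigoplus_{m,n}\mathrm{Ind}_{S_m\times S_n}^{S_{m+n}}\bigl(\widehat{\mathfrak{g}}^{\otimes m}\otimes\widehat{\mathfrak{g}}^{\otimes n}\bigr),$$ and let $T\widehat{\mathfrak{g}}\otimes_{\mathbb{S},\mathbf{k}[t]}T\widehat{\mathfrak{g}}$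 be its quotient by the $\mathbb{S}$-submodule generated by all $ut\otimes v-u\otimes tv$. The usual coproduct of $T\widehat{\mathfrak{g}}=\mathrm{Sym}_{\mathbb{S},\mathbf{k}[t]}(\Sigma\mathfrak{g}[t])$ over $\mathbf{k}[t]$ is the map $\Delta:T\widehat{\mathfrak{g}}\to T\widehat{\mathfrak{g}}\otimes_{\mathbb{S},\mathbf{k}[t]}T\widehat{\mathfrak{g}}$ given, for $v_i=x_i+c_it$ with $x_i\in\Sigma\mathfrak{g}$, $c_i\in\mathbf{k}$, by $$\Delta(v_1\cdots v_N)=\sum_{I\sqcup J=\{1,\dots,N\}}\sigma_{I,J}\Bigl(\prod_{i\in I}v_i\otimes\prod_{j\in J}x_j\Bigr),$$ where the products are in increasing order and $\sigma_{I,J}\in S_N$ is the shuffle sending the first $|I|$ positions increasingly onto $I$ and the remaining ones increasingly onto $J$; in particular $\Delta(x)=x\otimes1+1\otimes x$ for $x\in\Sigma\mathfrak{g}$ and $\Delta(t)=t\otimes 1=1\otimes t$. The counit $\varepsilon:T\widehat{\mathfrak{g}}\to\mathbf{k}[t]$ is the algebra map (for the usual product) with $\varepsilon(t)=t$ and $\varepsilon(\Sigma\mathfrak{g})=0$.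 Consider the $\mathbf{k}$-bilinear products (star products) $*$ on $T\widehat{\mathfrak{g}}$ such that 1. $*$ makes $T\widehat{\mathfrak{g}}$, with $\Delta$ and $\varepsilon$, a twisted bialgebra over $\mathbf{k}[t]$. That is: $*$ is associative with unit $1$; $\widehat{\mathfrak{g}}^{\otimes m}*\widehat{\mathfrak{g}}^{\otimes n}\subseteq\widehat{\mathfrak{g}}^{\otimes(m+n)}$, and $(\sigma x)*(\tau y)=(\sigma\times\tau)(x*y)$ for $x\in\widehat{\mathfrak{g}}^{\otimes m}$, $y\in\widehat{\mathfrak{g}}^{\otimes n}$, $\sigma\in S_m$, $\tau\in S_n$; $\varepsilon(x*y)=\varepsilon(x)\varepsilon(y)$; and $\Delta(x*y)=\Delta(x)\cdot\Delta(y)$, where $\cdot$ is induced by $(u\otimes v)\cdot(x\otimes y)=(23)^{|u|,|x|,|v|,|y|}\bigl((u*x)\otimes(v*y)\bigr)$, extended compatibly with the permutation actions, and $(23)^{a,c,b,d}$ moves consecutive blocks of lengths $a,c,b,d$ to the order $a,b,c,d$; 2. $*$ is a filtered product whose associated graded product is the usual one, for the filtration of $T\widehat{\mathfrak{g}}$ generated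 by $\langle t\rangle=F_0\widehat{\mathfrak{g}}\subseteq F_1\widehat{\mathfrak{g}}=\widehat{\mathfrak{g}}$; 3. $T^m(\Sigma\mathfrak{g})*T\widehat{\mathfrak{g}}\subseteq T^m(\Sigma\mathfrak{g})\cdot T\widehat{\mathfrak{g}}$ for all $m\ge 0$, where on the right the usual product is meant; 4. $f*t=ft$ and $t*f=tf$ for all $f\in T\widehat{\mathfrak{g}}$. Then there is a bijection between these products $*$ and the (right) pre-Lie structures on $\mathfrak{g}$, that is, the $\mathbf{k}$-bilinear operations $\circ:\mathfrak{g}\times\mathfrak{g}\to\mathfrak{g}$ with $$x\circ(y\circ z)-(x\circ y)\circ z=x\circ(z\circ y)-(x\circ z)\circ y\qquad(x,y,z\in\mathfrak{g}),$$ under which $*$ corresponds to the $\circ$ with $x*y=xy+(x\circ y)t$ for all $x,y\in\mathfrak{g}$. -/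

import Mathlib

open scoped TensorProduct DirectSum

namespace TwistedStar

noncomputable section

/-- A bilinear operation `∘` is a (right) pre-Lie product if
`x ∘ (y ∘ z) - (x ∘ y) ∘ z = x ∘ (z ∘ y) - (x ∘ z) ∘ y`. -/
def IsPreLie {k g : Type*} [CommRing k] [AddCommGroup g] [Module k g]
    (circ : g →ₗ[k] g →ₗ[k] g) : Prop :=
  ∀ x y z : g,
    circ x (circ y z) - circ (circ x y) z = circ x (circ z y) - circ (circ x z) y

section Blocks

/-- `σ × τ ∈ S_m × S_n ⊆ S_{m+n}`. -/
def blockPerm {m n : ℕ} (σ : Equiv.Perm (Fin m)) (τ : Equiv.Perm (Fin n)) :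
    Equiv.Perm (Fin (m + n)) :=
  finSumFinEquiv.permCongr (Equiv.sumCongr σ τ)

/-- The block permutation `(23)^{a,c,b,d}`: it sends the positions of four consecutive blocks of
lengths `a, c, b, d` to the positions of the same blocks put in the order `a, b, c, d`. -/
def swapMiddle (a b c d : ℕ) : Fin ((a + c) + (b + d)) ≃ Fin ((a + b) + (c + d)) :=
  finSumFinEquiv.symm.trans
    ((Equiv.sumCongr finSumFinEquiv.symm finSumFinEquiv.symm).trans
      ((Equiv.sumSumSumComm (Fin a) (Fin c) (Fin b) (Fin d)).trans
        ((Equiv.sumCongr finSumFinEquiv finSumFinEquiv).trans finSumFinEquiv)))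

/-- The product `(σ × τ) (23)^{a,c,b,d}`, as a permutation of `Fin ((a + c) + (b + d))`. -/
def mulPerm {a b c d : ℕ} (σ : Equiv.Perm (Fin (a + b))) (τ : Equiv.Perm (Fin (c + d))) :
    Equiv.Perm (Fin ((a + c) + (b + d))) :=
  (swapMiddle a b c d).trans
    ((blockPerm σ τ).trans (finCongr (by omega : (a + b) + (c + d) = (a + c) + (b + d))))

open Classical in
/-- The `(m,n)`-shuffles: permutations which are increasing on the first `m` and on the last `n`
positions. They correspond to decompositions `I ⊔ J = {1,…,m+n}` with `|I| = m`, `|J| = n`, by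
`I = σ {first m positions}`, `J = σ {last n positions}`. -/
def shuffles (m n : ℕ) : Finset (Equiv.Perm (Fin (m + n))) :=
  Finset.univ.filter fun σ =>
    StrictMono (fun i : Fin m => σ (Fin.castAdd n i)) ∧
      StrictMono (fun j : Fin n => σ (Fin.natAdd m j))

end Blocks

section Modules

variable (k g : Type*) [CommRing k] [AddCommGroup g] [Module k g]

/-- `ĝ = Σg ⊕ ⟨t⟩`, with `⟨t⟩` free of rank one. As an `𝕊`-module it sits in degree one. -/
abbrev Hat : Type _ := g × k

/-- The tensor algebra `T_k ĝ`. -/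
abbrev T : Type _ := TensorAlgebra k (Hat k g)

/-- The element `t` of `ĝ`. -/
def tHat : Hat k g := (0, 1)

/-- The element `t` of `T_k ĝ`. -/
def tT : T k g := TensorAlgebra.ι k (tHat k g)

/-- The inclusion of `g` (that is, of `Σg`) into `T_k ĝ`. -/
def incl : g →ₗ[k] T k g := TensorAlgebra.ι k ∘ₗ LinearMap.inl k g k

/-- `t` as an element of `ĝ^{⊗1}`. -/
def tPow : ⨂[k]^1 (Hat k g) := PiTensorProduct.tprod k fun _ => tHat k g

variable {k g}

/-- The left action of `S_n` on the degree `n` part `ĝ^{⊗n}` of the `𝕊`-module `T_k ĝ` by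
permutation of the components: the `i`-th component is moved to position `σ i`. -/
def act {n : ℕ} (σ : Equiv.Perm (Fin n)) : ⨂[k]^n (Hat k g) →ₗ[k] ⨂[k]^n (Hat k g) :=
  (PiTensorProduct.reindex k (fun _ : Fin n => Hat k g) σ).toLinearMap

/-- The inclusion of the degree `n` part into `T_k ĝ`. -/
def ofDeg (n : ℕ) : ⨂[k]^n (Hat k g) →ₗ[k] T k g := TensorPower.toTensorAlgebra

/-- The projection of `T_k ĝ` to its degree `n` part. -/
def toDeg (n : ℕ) : T k g →ₗ[k] ⨂[k]^n (Hat k g) :=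
  DirectSum.component k ℕ (fun n => ⨂[k]^n (Hat k g)) n ∘ₗ
    TensorAlgebra.equivDirectSum.toLinearMap

/-- Concatenation `ĝ^{⊗m} × ĝ^{⊗n} → ĝ^{⊗(m+n)}`. -/
def concat {m n : ℕ} (u : ⨂[k]^m (Hat k g)) (v : ⨂[k]^n (Hat k g)) :
    ⨂[k]^(m + n) (Hat k g) :=
  TensorPower.mulEquiv (u ⊗ₜ[k] v)

variable (k g)

/-- `k[S_{m+n}] ⊗ (ĝ^{⊗m} ⊗ ĝ^{⊗n})`, of which the induced module
`Ind_{S_m × S_n}^{S_{m+n}} (ĝ^{⊗m} ⊗ ĝ^{⊗n})` is a quotient. -/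
def PreInd (m n : ℕ) : Type _ :=
  (Equiv.Perm (Fin (m + n)) →₀ k) ⊗[k] (⨂[k]^m (Hat k g) ⊗[k] ⨂[k]^n (Hat k g))

instance (m n : ℕ) : AddCommGroup (PreInd k g m n) :=
  inferInstanceAs (AddCommGroup ((Equiv.Perm (Fin (m + n)) →₀ k) ⊗[k]
    (⨂[k]^m (Hat k g) ⊗[k] ⨂[k]^n (Hat k g))))

instance (m n : ℕ) : Module k (PreInd k g m n) :=
  inferInstanceAs (Module k ((Equiv.Perm (Fin (m + n)) →₀ k) ⊗[k]
    (⨂[k]^m (Hat k g) ⊗[k] ⨂[k]^n (Hat k g))))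

/-- The `k`-module `⨁_{m,n} k[S_{m+n}] ⊗ (ĝ^{⊗m} ⊗ ĝ^{⊗n})`, of which `T_k ĝ ⊗_{𝕊,k[t]} T_k ĝ` is
a quotient. -/
abbrev PreTensor : Type _ := ⨁ p : ℕ × ℕ, PreInd k g p.1 p.2

variable {k g}

/-- The element `σ ⊗ w` of `k[S_{m+n}] ⊗ (ĝ^{⊗m} ⊗ ĝ^{⊗n})`, linear in `w`. -/
def PreInd.mk {m n : ℕ} (σ : Equiv.Perm (Fin (m + n))) :
    (⨂[k]^m (Hat k g) ⊗[k] ⨂[k]^n (Hat k g)) →ₗ[k] PreInd k g m n :=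
  TensorProduct.mk k ((Equiv.Perm (Fin (m + n)) →₀ k))
    (⨂[k]^m (Hat k g) ⊗[k] ⨂[k]^n (Hat k g)) (Finsupp.single σ 1)

/-- The linear map `σ ⊗ w ↦ f σ w` on `k[S_{m+n}] ⊗ (ĝ^{⊗m} ⊗ ĝ^{⊗n})`. -/
def PreInd.lift {m n : ℕ} {M : Type*} [AddCommMonoid M] [Module k M]
    (f : Equiv.Perm (Fin (m + n)) → (⨂[k]^m (Hat k g) ⊗[k] ⨂[k]^n (Hat k g)) →ₗ[k] M) :
    PreInd k g m n →ₗ[k] M :=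
  TensorProduct.lift (Finsupp.linearCombination k f)

theorem PreInd.lift_mk {m n : ℕ} {M : Type*} [AddCommMonoid M] [Module k M]
    (f : Equiv.Perm (Fin (m + n)) → (⨂[k]^m (Hat k g) ⊗[k] ⨂[k]^n (Hat k g)) →ₗ[k] M)
    (σ : Equiv.Perm (Fin (m + n))) (w : ⨂[k]^m (Hat k g) ⊗[k] ⨂[k]^n (Hat k g)) :
    PreInd.lift f (PreInd.mk σ w) = f σ w :=
  (TensorProduct.lift.tmul (f' := Finsupp.linearCombination k f) (Finsupp.single σ 1) w).trans
    (by simp)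

/-- The element `σ ⊗ w` of the `(m,n)` summand of `PreTensor`, linear in `w`. -/
def gen {m n : ℕ} (σ : Equiv.Perm (Fin (m + n))) :
    (⨂[k]^m (Hat k g) ⊗[k] ⨂[k]^n (Hat k g)) →ₗ[k] PreTensor k g :=
  DirectSum.lof k (ℕ × ℕ) (fun p : ℕ × ℕ => PreInd k g p.1 p.2) (m, n) ∘ₗ PreInd.mk σ

variable (k g)

/-- The relations of `T_k ĝ ⊗_{𝕊,k[t]} T_k ĝ`. The first family makes the `(m,n)` summand the
induced module `Ind_{S_m × S_n}^{S_{m+n}} (ĝ^{⊗m} ⊗ ĝ^{⊗n})`, so that dividing by it alone gives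
`T_k ĝ ⊗_𝕊 T_k ĝ`; the second family makes the tensor product balanced over the
twisted-commutative algebra `k[t]`: it is the `𝕊`-submodule generated by all `ut ⊗ v - u ⊗ tv`. -/
def tensorRel : Submodule k (PreTensor k g) :=
  Submodule.span k
    ({z | ∃ (m n : ℕ) (σ : Equiv.Perm (Fin (m + n))) (α : Equiv.Perm (Fin m))
        (β : Equiv.Perm (Fin n)) (u : ⨂[k]^m (Hat k g)) (v : ⨂[k]^n (Hat k g)),
        z = gen (σ * blockPerm α β) (u ⊗ₜ[k] v) - gen σ (act α u ⊗ₜ[k] act β v)} ∪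
     {z | ∃ (m n : ℕ) (σ : Equiv.Perm (Fin ((m + 1) + n)))
        (u : ⨂[k]^m (Hat k g)) (v : ⨂[k]^n (Hat k g)),
        z = gen σ (concat u (tPow k g) ⊗ₜ[k] v) -
          gen ((finCongr (Nat.add_assoc m 1 n)).permCongr σ) (u ⊗ₜ[k] concat (tPow k g) v)})

/-- `T_k ĝ ⊗_{𝕊,k[t]} T_k ĝ`: the tensor product of `𝕊`-modules over `k[t]`. -/
abbrev TensorKt : Type _ := PreTensor k g ⧸ tensorRel k g

/-- The projection `ĝ → Σg ⊆ ĝ` killing `t`. -/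
def killT : Hat k g →ₗ[k] Hat k g := LinearMap.inl k g k ∘ₗ LinearMap.fst k g k

variable {k g}

/-- The component of the coproduct in `k[S_{m+n}] ⊗ (ĝ^{⊗m} ⊗ ĝ^{⊗n})`:
`x₁⋯x_{m+n} ↦ ∑_{I ⊔ J} σ_{I,J} ⊗ (∏_{i ∈ I} x_i ⊗ ∏_{j ∈ J} π x_j)`, the sum being over the
decompositions with `|I| = m`, `|J| = n`, where `π` kills `t` and is the identity on `Σg`. -/
def comulPiece (m n : ℕ) : ⨂[k]^(m + n) (Hat k g) →ₗ[k] PreTensor k g :=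
  ∑ σ ∈ shuffles m n,
    gen σ ∘ₗ
      TensorProduct.map LinearMap.id (PiTensorProduct.map fun _ : Fin n => killT k g) ∘ₗ
        (TensorPower.mulEquiv (R := k) (M := Hat k g) (n := m) (m := n)).symm.toLinearMap ∘ₗ
          act σ⁻¹

variable (k g)

/-- A lift of the coproduct to the module of representatives. -/
def preComul : T k g →ₗ[k] PreTensor k g :=
  (DirectSum.toModule k ℕ (PreTensor k g) fun N =>
      ∑ p ∈ Finset.HasAntidiagonal.antidiagonal N,
        comulPiece p.1 p.2 ∘ₗ
          DirectSum.component k ℕ (fun n => ⨂[k]^n (Hat k g)) (p.1 + p.2) ∘ₗ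
            DirectSum.lof k ℕ (fun n => ⨂[k]^n (Hat k g)) N) ∘ₗ
    TensorAlgebra.equivDirectSum.toLinearMap

/-- The usual coproduct `Δ : T_k ĝ → T_k ĝ ⊗_{𝕊,k[t]} T_k ĝ` of the twisted symmetric algebra
`T_k ĝ = Sym_{𝕊,k[t]} (Σg[t])` over `k[t]`. It is the `k[t]`-linear morphism of twisted algebras
(for the usual product) with `Δ x = x ⊗ 1 + 1 ⊗ x` for `x ∈ Σg`. Being `k[t]`-linear it has
`Δ t = t ⊗ 1 = 1 ⊗ t`, so every letter `v = x + c t` of `ĝ` has `Δ v = v ⊗ 1 + 1 ⊗ x`, which gives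
the explicit formula in `comulPiece`. -/
def comul : T k g →ₗ[k] TensorKt k g := (tensorRel k g).mkQ ∘ₗ preComul k g

/-- The counit `ε : T_k ĝ → k[t]`, the quotient by the ideal generated by `Σg`. -/
def counit : T k g →ₐ[k] Polynomial k :=
  TensorAlgebra.lift k
    ((LinearMap.toSpanSingleton k (Polynomial k) Polynomial.X) ∘ₗ LinearMap.snd k g k)

variable {k g}

/-- The component `ĝ^{⊗m} × ĝ^{⊗n} → ĝ^{⊗(m+n)}` of a bilinear operation on `T_k ĝ`. -/
def starDeg (star : T k g →ₗ[k] T k g →ₗ[k] T k g) (m n : ℕ) :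
    ⨂[k]^m (Hat k g) →ₗ[k] ⨂[k]^n (Hat k g) →ₗ[k] ⨂[k]^(m + n) (Hat k g) :=
  (star.compl₁₂ (ofDeg m) (ofDeg n)).compr₂ (toDeg (m + n))

/-- The product on representatives, defined from the product `u * v = star u v` by
`(σ ⊗ (u ⊗ v)) ⬝ (τ ⊗ (x ⊗ y)) = (σ × τ) (23)^{|u|,|x|,|v|,|y|} ⊗ ((u * x) ⊗ (v * y))`.
If `star` is a twisted associative product for which left and right multiplication by `t` are the
usual ones, this descends to the product of `T_k ĝ ⊗_{𝕊,k[t]} T_k ĝ`. -/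
def preMul (star : T k g →ₗ[k] T k g →ₗ[k] T k g) :
    PreTensor k g →ₗ[k] PreTensor k g →ₗ[k] PreTensor k g :=
  DirectSum.toModule k (ℕ × ℕ) _ fun p =>
    PreInd.lift fun σ =>
      LinearMap.flip
        (DirectSum.toModule k (ℕ × ℕ) _ fun q =>
          PreInd.lift fun τ =>
            LinearMap.flip
              ((TensorProduct.map₂ (starDeg star p.1 q.1) (starDeg star p.2 q.2)).compr₂
                (gen (mulPerm σ τ))))

/-- `star` makes the `𝕊`-module `T_k ĝ` a twisted associative algebra, with the usual unit. -/
structure IsTwistedAlgebra (star : T k g →ₗ[k] T k g →ₗ[k] T k g) : Prop where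
  assoc : ∀ x y z, star (star x y) z = star x (star y z)
  one_star : ∀ x, star 1 x = x
  star_one : ∀ x, star x 1 = x
  graded : ∀ (m n : ℕ) (x : ⨂[k]^m (Hat k g)) (y : ⨂[k]^n (Hat k g)),
    star (ofDeg m x) (ofDeg n y) = ofDeg (m + n) (starDeg star m n x y)
  equivariant : ∀ (m n : ℕ) (σ : Equiv.Perm (Fin m)) (τ : Equiv.Perm (Fin n))
    (x : ⨂[k]^m (Hat k g)) (y : ⨂[k]^n (Hat k g)),
    starDeg star m n (act σ x) (act τ y) = act (blockPerm σ τ) (starDeg star m n x y)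

/-- `star` makes `T_k ĝ`, with the usual coproduct and counit, a twisted bialgebra (over `k[t]`):
it is a twisted associative product, and `Δ` and `ε` are morphisms of algebras. -/
structure IsTwistedBialgebra (star : T k g →ₗ[k] T k g →ₗ[k] T k g) : Prop
    extends IsTwistedAlgebra star where
  comul_star : ∀ x y,
    comul k g (star x y) = (tensorRel k g).mkQ (preMul star (preComul k g x) (preComul k g y))
  counit_star : ∀ x y, counit k g (star x y) = counit k g x * counit k g y

variable (k g)

/-- The filtration `⟨t⟩ = F₀ ĝ ⊆ F₁ ĝ = F₂ ĝ = ⋯ = ĝ`. -/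
def filHat : ℕ → Submodule k (Hat k g)
  | 0 => Submodule.span k {tHat k g}
  | _ + 1 => ⊤

/-- The filtration of `T_k ĝ` generated by that of `ĝ`: `F_n` is spanned by the products
`v₁⋯v_r` with `v_i ∈ F_{d_i} ĝ` and `d₁ + ⋯ + d_r ≤ n`. In particular `F_n = 0` for `n < 0`. -/
def fil (n : ℤ) : Submodule k (T k g) :=
  Submodule.span k
    {y | ∃ l : List (ℕ × Hat k g), (∀ p ∈ l, p.2 ∈ filHat k g p.1) ∧
      (((l.map Prod.fst).sum : ℕ) : ℤ) ≤ n ∧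
      y = (l.map fun p => TensorAlgebra.ι k p.2).prod}

variable {k g}

/-- `star` is a filtered product whose associated graded product is the usual one. -/
def IsFilteredDeformation (star : T k g →ₗ[k] T k g →ₗ[k] T k g) : Prop :=
  ∀ (i j : ℤ), ∀ x ∈ fil k g i, ∀ y ∈ fil k g j,
    star x y ∈ fil k g (i + j) ∧ star x y - x * y ∈ fil k g (i + j - 1)

/-- `T^m(Σg) * T ĝ ⊆ T^m(Σg) · T ĝ` for all `m`. -/
def DegreeCondition (star : T k g →ₗ[k] T k g →ₗ[k] T k g) : Prop :=
  ∀ (m : ℕ), ∀ x ∈ LinearMap.range (incl k g) ^ m, ∀ y : T k g,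
    star x y ∈ LinearMap.range (incl k g) ^ m * (⊤ : Submodule k (T k g))

/-- The star products under consideration. -/
structure IsStarProduct (star : T k g →ₗ[k] T k g →ₗ[k] T k g) : Prop where
  bialgebra : IsTwistedBialgebra star
  filtered : IsFilteredDeformation star
  degree : DegreeCondition star
  star_t : ∀ f, star f (tT k g) = f * tT k g
  t_star : ∀ f, star (tT k g) f = tT k g * f

end Modules

end

end TwistedStar

open scoped TensorProduct DirectSum

namespace TwistedStar

noncomputable section

/-! Let `D_v` be the derivation of the tensor algebra for concatenation that extends `u ↦ u ∘ v` on
letters and kills `t`. The whole product is governed by the formula `a * v = a v + (D_v a) t` for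
right multiplication by a letter. Solving it for `b v = b * v - (D_v b) t` and imposing
associativity forces `a * (b v) = (a * b) v + D_v(a * b) t - (a * D_v b) t`, a recursion on the last
letter of the right factor that has exactly one solution, `starOf`.

Existence. For every bilinear `∘` this solution is associative, unital, graded, equivariant in the
left factor, filtered, and compatible with the counit and the degree condition; each is an induction
along the recursion. The pre-Lie identity enters only through equivariance in the right factor. It
says that `[D_w, D_v] = D_{v ∘ w} - D_{w ∘ v}` (`D_comm`), which makes the expansion of `a * (b v
w)` symmetric in `v` and `w` up to exchanging the last two positions (`starOf_swap`); adjacent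
transpositions generate the rest.

For the coproduct, the balanced tensor square is embedded in the tensor algebra of the hat of `g ×
g` by `Phi`, sending `σ ⊗ (u ⊗ v)` to the permuted concatenation of `u`, in the first copy of `g`,
and `v`, in the second. Under `Phi` the coproduct becomes the map induced by the diagonal of `g`,
and the product of the tensor square becomes the star product of the componentwise operation on `g ×
g`, because the two copies do not interact. Multiplicativity of the coproduct is then naturality of
`starOf` along the diagonal (`mapT_starOf`), once `Phi` is known to be injective (`mkQ_eq_iff`).

Uniqueness. The filtration, the grading and the degree condition for `m = 1` force `x * y - x y = z
t` with `z ∈ g`, which defines `circOf`. By strong induction on the degree of `a`, the product `a *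
x` agrees with that of `starOf` (`IsStarProduct.star_ι`): a letter `t` of `a` is moved to the front
and factored out, while for a word of length at least two in `Σg` the components of the coproduct of
`a * x` with both factors of positive degree are known by induction and already determine `a * x`,
since its first two letters lie in `Σg`. Associativity gives the recursion, so the product is
`starOf`. Finally, the coefficient of `t t` in `x * (y z)` and `x * (z y)`, compared through
equivariance, is the pre-Lie identity. -/

theorem toDirectSum_toTensorAlgebra {R M : Type*} [CommSemiring R] [AddCommMonoid M] [Module R M]
    (n : ℕ) (x : ⨂[R]^n M) :
    TensorAlgebra.toDirectSum (TensorPower.toTensorAlgebra x) =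
      DirectSum.of (fun n => ⨂[R]^n M) n x := by
  have h : TensorAlgebra.ofDirectSum (DirectSum.of (fun n => ⨂[R]^n M) n x) =
      TensorPower.toTensorAlgebra x :=
    DirectSum.toAddMonoid_of
      (fun _ => LinearMap.toAddMonoidHom (TensorPower.toTensorAlgebra (R := R) (M := M))) n x
  rw [← h, TensorAlgebra.toDirectSum_ofDirectSum]

/-! ### Words, the grading, and induction on the last letter -/

section Words

variable {k g : Type*} [CommRing k] [AddCommGroup g] [Module k g]

/-- The product `v₁⋯vₙ` of letters in `T_k ĝ`. -/
def word {n : ℕ} (f : Fin n → Hat k g) : T k g := (List.ofFn fun i => TensorAlgebra.ι k (f i)).prod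

theorem ofDeg_tprod {n : ℕ} (f : Fin n → Hat k g) :
    ofDeg n (PiTensorProduct.tprod k f) = word f := by
  rw [ofDeg, TensorPower.toTensorAlgebra_tprod, TensorAlgebra.tprod_apply, word]

theorem ofDeg_apply (n : ℕ) (x : ⨂[k]^n (Hat k g)) :
    ofDeg n x = TensorPower.toTensorAlgebra x := rfl

theorem toDirectSum_ofDeg (n : ℕ) (x : ⨂[k]^n (Hat k g)) :
    TensorAlgebra.toDirectSum (ofDeg n x : T k g) = DirectSum.of (fun n => ⨂[k]^n (Hat k g)) n x := by
  generalize h : ofDeg n x = a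
  rw [ofDeg_apply] at h
  subst h
  exact toDirectSum_toTensorAlgebra n x

theorem toDeg_ofDeg (n : ℕ) (x : ⨂[k]^n (Hat k g)) : toDeg n (ofDeg n x) = x :=
  (DFunLike.congr_fun (toDirectSum_ofDeg n x) n).trans (DirectSum.of_eq_same _ _)

theorem toDeg_ofDeg_of_ne {m n : ℕ} (h : m ≠ n) (x : ⨂[k]^n (Hat k g)) :
    toDeg m (ofDeg n x) = 0 :=
  (DFunLike.congr_fun (toDirectSum_ofDeg n x) m).trans (DirectSum.of_eq_of_ne _ _ _ h)

theorem ofDeg_injective (n : ℕ) :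
    Function.Injective (ofDeg n : ⨂[k]^n (Hat k g) →ₗ[k] T k g) :=
  Function.LeftInverse.injective (toDeg_ofDeg n)

theorem word_append {m n : ℕ} (f : Fin m → Hat k g) (f' : Fin n → Hat k g) :
    word (Fin.append f f') = word f * word f' := by
  rw [word, word, word, ← List.prod_append]
  have h : (fun i => TensorAlgebra.ι k (Fin.append f f' i)) =
      Fin.append (fun i => TensorAlgebra.ι k (f i)) (fun i => TensorAlgebra.ι k (f' i)) := by
    funext i
    refine Fin.addCases (fun i => ?_) (fun i => ?_) i <;> simp
  rw [h, List.ofFn_fin_append]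

theorem word_zero (f : Fin 0 → Hat k g) : word f = 1 := by simp [word]

theorem word_one (f : Fin 1 → Hat k g) : word f = TensorAlgebra.ι k (f 0) := by simp [word]

theorem word_cons {n : ℕ} (v : Hat k g) (f : Fin n → Hat k g) :
    word (Fin.cons v f : Fin (n + 1) → Hat k g) = TensorAlgebra.ι k v * word f := by
  simp [word]

theorem word_snoc {n : ℕ} (f : Fin n → Hat k g) (v : Hat k g) :
    word (Fin.snoc f v : Fin (n + 1) → Hat k g) = word f * TensorAlgebra.ι k v := by
  rw [← Fin.append_right_eq_snoc f (fun _ => v), word_append, word_one]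

theorem ofDeg_concat {m n : ℕ} (u : ⨂[k]^m (Hat k g)) (v : ⨂[k]^n (Hat k g)) :
    ofDeg (m + n) (concat u v) = ofDeg m u * ofDeg n v :=
  TensorPower.toTensorAlgebra_gMul u v

/-- The degree `n` part of `T_k ĝ`. -/
def deg (k g : Type*) [CommRing k] [AddCommGroup g] [Module k g] (n : ℕ) : Submodule k (T k g) :=
  LinearMap.range (ofDeg n)

theorem ofDeg_mem (n : ℕ) (x : ⨂[k]^n (Hat k g)) : ofDeg n x ∈ deg k g n := ⟨x, rfl⟩

theorem word_mem {n : ℕ} (f : Fin n → Hat k g) : word f ∈ deg k g n :=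
  ⟨_, ofDeg_tprod f⟩

theorem ofDeg_toDeg {n : ℕ} {a : T k g} (ha : a ∈ deg k g n) : ofDeg n (toDeg n a) = a := by
  obtain ⟨x, rfl⟩ := ha
  rw [toDeg_ofDeg]

theorem toDeg_of_ne {m n : ℕ} (h : m ≠ n) {a : T k g} (ha : a ∈ deg k g n) : toDeg m a = 0 := by
  obtain ⟨x, rfl⟩ := ha
  exact toDeg_ofDeg_of_ne h x

theorem mul_mem_deg {m n : ℕ} {a b : T k g} (ha : a ∈ deg k g m) (hb : b ∈ deg k g n) :
    a * b ∈ deg k g (m + n) := by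
  obtain ⟨x, rfl⟩ := ha
  obtain ⟨y, rfl⟩ := hb
  exact ⟨_, ofDeg_concat x y⟩

theorem ι_mem_deg (v : Hat k g) : TensorAlgebra.ι k v ∈ deg k g 1 := by
  rw [← word_one fun _ => v]
  exact word_mem _

theorem one_mem_deg : (1 : T k g) ∈ deg k g 0 := by
  rw [← word_zero (Fin.elim0 : Fin 0 → Hat k g)]
  exact word_mem _

theorem deg_eq_span (n : ℕ) :
    deg k g n = Submodule.span k (Set.range (word : (Fin n → Hat k g) → T k g)) := by
  rw [deg, LinearMap.range_eq_map, ← PiTensorProduct.span_tprod_eq_top, Submodule.map_span,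
    ← Set.range_comp]
  congr 2
  funext f
  exact ofDeg_tprod f

/-- A property of the elements of degree `n` which is linear may be checked on words. -/
theorem deg_induction {n : ℕ} {P : T k g → Prop} (hw : ∀ f : Fin n → Hat k g, P (word f))
    (hadd : ∀ a b, P a → P b → P (a + b)) (hsmul : ∀ (r : k) a, P a → P (r • a))
    {a : T k g} (ha : a ∈ deg k g n) : P a := by
  rw [deg_eq_span] at ha
  induction ha using Submodule.span_induction with
  | mem x hx => obtain ⟨f, rfl⟩ := hx; exact hw f
  | zero => simpa using hsmul 0 _ (hw 0)
  | add x y _ _ hx hy => exact hadd _ _ hx hy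
  | smul r x _ hx => exact hsmul _ _ hx

theorem eqOn_deg {M : Type*} [AddCommMonoid M] [Module k M] {n : ℕ} {F G : T k g →ₗ[k] M}
    (h : ∀ f : Fin n → Hat k g, F (word f) = G (word f)) {a : T k g} (ha : a ∈ deg k g n) :
    F a = G a :=
  deg_induction (P := fun a => F a = G a) h (fun a b ha hb => by rw [map_add, map_add, ha, hb])
    (fun r a ha => by rw [map_smul, map_smul, ha]) ha

theorem exists_sum_deg {P : T k g → Prop} (h : ∀ n, ∀ a ∈ deg k g n, P a)
    (hadd : ∀ a b, P a → P b → P (a + b)) (a : T k g) : P a := by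
  have key : ∀ z : ⨁ n, ⨂[k]^n (Hat k g), ∀ a : T k g, TensorAlgebra.ofDirectSum z = a → P a := by
    intro z
    induction z using DirectSum.induction_on with
    | zero =>
      rintro a ha
      have h0 : a = 0 := ha.symm.trans (map_zero _)
      exact h0 ▸ h 0 0 (Submodule.zero_mem _)
    | of n x =>
      rintro a ha
      exact h n a ⟨x, (DirectSum.toAddMonoid_of (fun _ => LinearMap.toAddMonoidHom
        (TensorPower.toTensorAlgebra (R := k) (M := Hat k g))) n x).symm.trans ha⟩
    | add x y hx hy =>
      rintro a ha
      have h1 := ha.symm.trans (map_add _ _ _)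
      exact h1 ▸ hadd _ _ (hx _ rfl) (hy _ rfl)
  exact key _ a (TensorAlgebra.ofDirectSum_toDirectSum a)

theorem hom_ext_deg {M : Type*} [AddCommMonoid M] [Module k M] {F G : T k g →ₗ[k] M}
    (h : ∀ n, ∀ a ∈ deg k g n, F a = G a) : F = G :=
  LinearMap.ext (exists_sum_deg h fun a b ha hb => by rw [map_add, map_add, ha, hb])

theorem hom_ext_word {M : Type*} [AddCommMonoid M] [Module k M] {F G : T k g →ₗ[k] M}
    (h : ∀ n (f : Fin n → Hat k g), F (word f) = G (word f)) : F = G :=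
  hom_ext_deg fun n _ ha => eqOn_deg (h n) ha

theorem word_eq_init {n : ℕ} (f : Fin (n + 1) → Hat k g) :
    word f = word (Fin.init f : Fin n → Hat k g) * TensorAlgebra.ι k (f (Fin.last n)) := by
  conv_lhs => rw [← Fin.snoc_init_self f]
  exact word_snoc _ _

/-- Induction on the degree, splitting off the last letter. -/
theorem deg_right_induction {P : T k g → Prop} (hone : P 1)
    (hadd : ∀ a b, P a → P b → P (a + b)) (hsmul : ∀ (r : k) a, P a → P (r • a))
    (hstep : ∀ n, (∀ b ∈ deg k g n, P b) → ∀ b ∈ deg k g n, ∀ v, P (b * TensorAlgebra.ι k v))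
    (a : T k g) : P a := by
  refine exists_sum_deg (fun n => ?_) hadd a
  induction n with
  | zero => exact fun a ha => deg_induction (fun f => by rwa [word_zero]) hadd hsmul ha
  | succ n ih =>
    refine fun a ha => deg_induction (fun f => ?_) hadd hsmul ha
    rw [word_eq_init]
    exact hstep n ih _ (word_mem _) _

theorem deg_zero_induction {a : T k g} (ha : a ∈ deg k g 0) : ∃ c : k, a = c • 1 :=
  deg_induction (P := fun a => ∃ c : k, a = c • 1) (fun f => ⟨1, by rw [word_zero, one_smul]⟩)
    (by rintro _ _ ⟨c, rfl⟩ ⟨d, rfl⟩; exact ⟨c + d, (add_smul _ _ _).symm⟩)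
    (by rintro r _ ⟨c, rfl⟩; exact ⟨r * c, (mul_smul _ _ _).symm⟩) ha

theorem deg_one_induction {a : T k g} (ha : a ∈ deg k g 1) : ∃ v, a = TensorAlgebra.ι k v :=
  deg_induction (P := fun a => ∃ v, a = TensorAlgebra.ι k v) (fun f => ⟨f 0, word_one f⟩)
    (by rintro _ _ ⟨c, rfl⟩ ⟨d, rfl⟩; exact ⟨c + d, (map_add _ _ _).symm⟩)
    (by rintro r _ ⟨c, rfl⟩; exact ⟨r • c, (map_smul _ _ _).symm⟩) ha

end Words

/-! ### Bijections of positions acting on the tensor algebra -/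

section Perms

variable {k g : Type*} [CommRing k] [AddCommGroup g] [Module k g]

/-- The action of a bijection between positions on the words of the given length, the words of
other lengths being sent to `0`. -/
def perm {m n : ℕ} (e : Fin m ≃ Fin n) : T k g →ₗ[k] T k g :=
  ofDeg n ∘ₗ (PiTensorProduct.reindex k (fun _ => Hat k g) e).toLinearMap ∘ₗ toDeg m

theorem perm_ofDeg {n : ℕ} (σ : Equiv.Perm (Fin n)) (x : ⨂[k]^n (Hat k g)) :
    perm σ (ofDeg n x) = ofDeg n (act σ x) := by
  rw [perm, LinearMap.comp_apply, LinearMap.comp_apply, toDeg_ofDeg]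
  rfl

theorem perm_word {m n : ℕ} (e : Fin m ≃ Fin n) (f : Fin m → Hat k g) :
    perm e (word f) = word (f ∘ e.symm) := by
  rw [perm, LinearMap.comp_apply, LinearMap.comp_apply, ← ofDeg_tprod, toDeg_ofDeg,
    LinearEquiv.coe_coe, ← ofDeg_tprod]
  exact congrArg _ (PiTensorProduct.reindex_tprod e f)

theorem perm_mem {m n : ℕ} (e : Fin m ≃ Fin n) (a : T k g) : perm e a ∈ deg k g n :=
  ofDeg_mem _ _

/-- Allowing `m ≠ n` in the type of `e` lets casts such as `a + (b + c) = (a + b) + c` be treated as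
permutations. -/
theorem perm_perm {l m n : ℕ} (e : Fin l ≃ Fin m) (e' : Fin m ≃ Fin n) (a : T k g) :
    perm e' (perm e a) = perm (e.trans e') a := by
  simp only [perm, LinearMap.comp_apply, toDeg_ofDeg]
  congr 1
  exact PiTensorProduct.reindex_reindex e e' _

theorem perm_of_refl {n : ℕ} {a : T k g} (ha : a ∈ deg k g n) : perm (Equiv.refl (Fin n)) a = a := by
  refine eqOn_deg (G := LinearMap.id) (fun f => ?_) ha
  rw [perm_word]
  rfl

theorem perm_finCongr {m n : ℕ} (h : m = n) {a : T k g} (ha : a ∈ deg k g m) :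
    perm (finCongr h) a = a := by
  subst h
  exact perm_of_refl ha

theorem perm_of_ne {l m n : ℕ} (e : Fin m ≃ Fin n) (h : m ≠ l) {a : T k g} (ha : a ∈ deg k g l) :
    perm e a = 0 := by
  rw [perm, LinearMap.comp_apply, LinearMap.comp_apply, toDeg_of_ne h ha, map_zero, map_zero]

/-- `e ⊔ e'` as a bijection of positions. -/
def sumPerm {m m' n n' : ℕ} (e : Fin m ≃ Fin m') (e' : Fin n ≃ Fin n') :
    Fin (m + n) ≃ Fin (m' + n') :=
  finSumFinEquiv.symm.trans ((Equiv.sumCongr e e').trans finSumFinEquiv)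

theorem blockPerm_eq_sumPerm {m n : ℕ} (σ : Equiv.Perm (Fin m)) (τ : Equiv.Perm (Fin n)) :
    blockPerm σ τ = sumPerm σ τ := rfl

theorem perm_mul {m m' n n' : ℕ} (e : Fin m ≃ Fin m') (e' : Fin n ≃ Fin n') {a b : T k g}
    (ha : a ∈ deg k g m) (hb : b ∈ deg k g n) :
    perm e a * perm e' b = perm (sumPerm e e') (a * b) := by
  refine eqOn_deg (F := LinearMap.mulRight k (perm e' b) ∘ₗ perm e)
    (G := perm (sumPerm e e') ∘ₗ LinearMap.mulRight k b) (fun f => ?_) ha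
  refine eqOn_deg (F := LinearMap.mulLeft k (perm e (word f)) ∘ₗ perm e')
    (G := perm (sumPerm e e') ∘ₗ LinearMap.mulLeft k (word f)) (fun f' => ?_) hb
  simp only [LinearMap.comp_apply, LinearMap.mulLeft_apply]
  rw [perm_word, perm_word, ← word_append, ← word_append, perm_word]
  congr 1
  funext i
  refine Fin.addCases (fun i => ?_) (fun i => ?_) i <;> simp [sumPerm]

theorem perm_finAddFlip {m n : ℕ} {a b : T k g} (ha : a ∈ deg k g m) (hb : b ∈ deg k g n) :
    perm (finAddFlip : Fin (m + n) ≃ Fin (n + m)) (a * b) = b * a := by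
  refine eqOn_deg (F := perm finAddFlip ∘ₗ LinearMap.mulRight k b)
    (G := LinearMap.mulLeft k b) (fun f => ?_) ha
  refine eqOn_deg (F := perm finAddFlip ∘ₗ LinearMap.mulLeft k (word f))
    (G := LinearMap.mulRight k (word f)) (fun f' => ?_) hb
  simp only [LinearMap.comp_apply, LinearMap.mulLeft_apply, LinearMap.mulRight_apply]
  rw [← word_append, ← word_append, perm_word]
  congr 1
  funext i
  refine Fin.addCases (fun i => ?_) (fun i => ?_) i <;> simp [finAddFlip]

end Perms

/-! ### Derivations extending an endomorphism of the letters -/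

section DegreeWise

variable {k g : Type*} [CommRing k] [AddCommGroup g] [Module k g]

/-- The linear map on `T_k ĝ` with given restrictions to the tensor powers. -/
def degMap {M : Type*} [AddCommMonoid M] [Module k M]
    (F : ∀ n, ⨂[k]^n (Hat k g) →ₗ[k] M) : T k g →ₗ[k] M :=
  DirectSum.toModule k ℕ M F ∘ₗ TensorAlgebra.equivDirectSum.toLinearMap

theorem degMap_ofDeg {M : Type*} [AddCommMonoid M] [Module k M]
    (F : ∀ n, ⨂[k]^n (Hat k g) →ₗ[k] M) (n : ℕ) (x : ⨂[k]^n (Hat k g)) :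
    degMap F (ofDeg n x) = F n x :=
  (congrArg (DirectSum.toModule k ℕ M F) (toDirectSum_ofDeg n x)).trans
    (DirectSum.toModule_lof (M := fun n => ⨂[k]^n (Hat k g)) k n x)

theorem degMap_word {M : Type*} [AddCommMonoid M] [Module k M]
    (F : ∀ n, ⨂[k]^n (Hat k g) →ₗ[k] M) {n : ℕ} (f : Fin n → Hat k g) :
    degMap F (word f) = F n (PiTensorProduct.tprod k f) := by
  rw [← ofDeg_tprod, degMap_ofDeg]

theorem word_eq_tprod {n : ℕ} (f : Fin n → Hat k g) :
    word f = TensorAlgebra.tprod k (Hat k g) n f :=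
  (TensorAlgebra.tprod_apply _ _ f).symm

/-- The derivation of `T_k ĝ` (for the usual product) extending an endomorphism of `ĝ`. -/
def der (d : Hat k g →ₗ[k] Hat k g) : T k g →ₗ[k] T k g :=
  degMap fun n => ofDeg n ∘ₗ
    ∑ i, PiTensorProduct.map (Function.update (fun _ : Fin n => LinearMap.id) i d)

theorem der_word (d : Hat k g →ₗ[k] Hat k g) {n : ℕ} (f : Fin n → Hat k g) :
    der d (word f) = ∑ i, word (Function.update f i (d (f i))) := by
  rw [der, degMap_word, LinearMap.comp_apply, LinearMap.sum_apply, map_sum]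
  refine Finset.sum_congr rfl fun i _ => ?_
  rw [PiTensorProduct.map_tprod, ofDeg_tprod]
  congr 1
  funext j
  by_cases h : j = i
  · subst h; simp
  · simp [h]

theorem der_mem_deg (d : Hat k g →ₗ[k] Hat k g) {n : ℕ} {a : T k g} (ha : a ∈ deg k g n) :
    der d a ∈ deg k g n := by
  obtain ⟨x, rfl⟩ := ha
  rw [der, degMap_ofDeg]
  exact ofDeg_mem _ _

theorem der_mul (d : Hat k g →ₗ[k] Hat k g) (a b : T k g) :
    der d (a * b) = der d a * b + a * der d b := by
  have key : (LinearMap.mul k (T k g)).compr₂ (der d) =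
      LinearMap.mul k (T k g) ∘ₗ der d + (LinearMap.mul k (T k g)).compl₂ (der d) := by
    refine hom_ext_word fun m f => hom_ext_word fun n f' => ?_
    simp only [LinearMap.compr₂_apply, LinearMap.mul_apply', LinearMap.add_apply,
      LinearMap.comp_apply, LinearMap.compl₂_apply]
    rw [← word_append, der_word, der_word, der_word, Fin.sum_univ_add, Finset.sum_mul,
      Finset.mul_sum]
    congr 1 <;> refine Finset.sum_congr rfl fun i _ => ?_ <;> rw [← word_append] <;> congr 1 <;>
      funext j <;> refine Fin.addCases (fun j => ?_) (fun j => ?_) j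
    · by_cases h : j = i
      · subst h; simp
      · have : Fin.castAdd n j ≠ Fin.castAdd n i := fun h' => h (Fin.castAdd_injective _ _ h')
        simp [h, this]
    · have : Fin.natAdd m j ≠ Fin.castAdd n i := fun h' => by
        have := congrArg Fin.val h'
        simp at this
        omega
      simp [this]
    · have : Fin.castAdd n j ≠ Fin.natAdd m i := fun h' => by
        have := congrArg Fin.val h'
        simp at this
        omega
      simp [this]
    · by_cases h : j = i
      · subst h; simp
      · have : Fin.natAdd m j ≠ Fin.natAdd m i := fun h' => h (Fin.natAdd_injective _ _ h')
        simp [h, this]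
  exact LinearMap.congr_fun (LinearMap.congr_fun key a) b

theorem der_one (d : Hat k g →ₗ[k] Hat k g) : der d (1 : T k g) = 0 := by
  rw [← word_zero (Fin.elim0 : Fin 0 → Hat k g), der_word]
  simp

theorem der_ι (d : Hat k g →ₗ[k] Hat k g) (v : Hat k g) :
    der d (TensorAlgebra.ι k v) = TensorAlgebra.ι k (d v) := by
  rw [← word_one fun _ => v, der_word]
  simp [word_one]

/-- A derivation applies `d` at every position in turn, so reindexing the positions only reorders
the sum. -/
theorem der_perm (d : Hat k g →ₗ[k] Hat k g) {m n : ℕ} (e : Fin m ≃ Fin n) (a : T k g) :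
    der d (perm e a) = perm e (der d a) := by
  refine LinearMap.congr_fun (f := der d ∘ₗ perm e) (g := perm e ∘ₗ der d) ?_ a
  refine hom_ext_deg fun l a ha => ?_
  by_cases h : m = l
  · subst h
    refine eqOn_deg (fun f => ?_) ha
    simp only [LinearMap.comp_apply]
    rw [perm_word, der_word, der_word, map_sum, ← e.sum_comp]
    refine Finset.sum_congr rfl fun i _ => ?_
    rw [perm_word]
    congr 1
    funext j
    by_cases h : j = e i
    · subst h; simp
    · have : e.symm j ≠ i := fun h' => h (by rw [← h', Equiv.apply_symm_apply])
      simp [h, this]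
  · rw [LinearMap.comp_apply, LinearMap.comp_apply, perm_of_ne e h ha,
      perm_of_ne e h (der_mem_deg d ha), map_zero]

/-- `der` as a linear map. -/
def derHom (k g : Type*) [CommRing k] [AddCommGroup g] [Module k g] :
    (Hat k g →ₗ[k] Hat k g) →ₗ[k] (T k g →ₗ[k] T k g) where
  toFun := der
  map_add' d d' := hom_ext_word fun n f => by
    simp only [LinearMap.add_apply, der_word]
    simp only [word_eq_tprod, MultilinearMap.map_update_add, Finset.sum_add_distrib]
  map_smul' r d := hom_ext_word fun n f => by
    simp only [LinearMap.smul_apply, der_word, RingHom.id_apply]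
    simp only [word_eq_tprod, MultilinearMap.map_update_smul, Finset.smul_sum]

end DegreeWise

/-! ### The star product of a bilinear operation -/

section Star

variable {k g : Type*} [CommRing k] [AddCommGroup g] [Module k g]

/-- `v ↦ (u ↦ u ∘ v)` on `ĝ`, where `t ∘ v = u ∘ t = 0`. -/
def circHat (circ : g →ₗ[k] g →ₗ[k] g) : Hat k g →ₗ[k] Hat k g →ₗ[k] Hat k g :=
  (circ.flip.compl₁₂ (LinearMap.fst k g k) (LinearMap.fst k g k)).compr₂ (LinearMap.inl k g k)

theorem circHat_apply (circ : g →ₗ[k] g →ₗ[k] g) (v u : Hat k g) :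
    circHat circ v u = (circ u.1 v.1, 0) := rfl

/-- The derivation of `T_k ĝ` extending `u ↦ u ∘ v`. -/
def D (circ : g →ₗ[k] g →ₗ[k] g) : Hat k g →ₗ[k] T k g →ₗ[k] T k g :=
  derHom k g ∘ₗ circHat circ

variable (circ : g →ₗ[k] g →ₗ[k] g)

theorem D_apply (v : Hat k g) : D circ v = der (circHat circ v) := rfl

theorem D_mul (v : Hat k g) (a b : T k g) : D circ v (a * b) = D circ v a * b + a * D circ v b :=
  der_mul _ a b

theorem D_one (v : Hat k g) : D circ v (1 : T k g) = 0 := der_one _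

theorem D_ι (v u : Hat k g) :
    D circ v (TensorAlgebra.ι k u) = TensorAlgebra.ι k (circHat circ v u) := der_ι _ _

theorem D_perm (v : Hat k g) {m n : ℕ} (e : Fin m ≃ Fin n) (a : T k g) :
    D circ v (perm e a) = perm e (D circ v a) := der_perm _ _ _

theorem D_mem_deg (v : Hat k g) {n : ℕ} {a : T k g} (ha : a ∈ deg k g n) :
    D circ v a ∈ deg k g n := der_mem_deg _ ha

theorem D_tT (v : Hat k g) : D circ v (tT k g) = 0 := by
  rw [tT, D_ι, circHat_apply]
  simp [tHat]

theorem D_t : D circ (tHat k g) = 0 := by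
  rw [D, LinearMap.comp_apply]
  have : circHat circ (tHat k g) = 0 := LinearMap.ext fun u => by
    rw [circHat_apply]
    simp [tHat]
  rw [this, map_zero]

/-- The operation `a ↦ a v + (a ∘ v) t` of star multiplication by a letter on the right. -/
def starLetter : Hat k g →ₗ[k] T k g →ₗ[k] T k g :=
  (LinearMap.mul k (T k g)).flip ∘ₗ TensorAlgebra.ι k +
    (D circ).compr₂ (LinearMap.mulRight k (tT k g))

theorem starLetter_apply (v : Hat k g) (a : T k g) :
    starLetter circ v a = a * TensorAlgebra.ι k v + D circ v a * tT k g := rfl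

/-- Star multiplication by an element of `ĝ^{⊗n}` on the right. -/
def starPow : ∀ n, ⨂[k]^n (Hat k g) →ₗ[k] T k g →ₗ[k] T k g
  | 0 => LinearMap.toSpanSingleton k _ LinearMap.id ∘ₗ
      (PiTensorProduct.isEmptyEquiv (Fin 0)).toLinearMap
  | n + 1 =>
      TensorProduct.lift
        (LinearMap.mk₂ k
          -- The first term is to be `(a * b) * v`, the second `(a * D_v b) t`. Their difference is
          -- the only possible value of `a * (b v)`, as `b v = b * v - (D_v b) t`.
          (fun (b : ⨂[k]^n (Hat k g)) (v : Hat k g) =>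
            starLetter circ v ∘ₗ starPow n b -
              LinearMap.mulRight k (tT k g) ∘ₗ starPow n (toDeg n (D circ v (ofDeg n b))))
          (fun b b' v => by
            simp only [map_add, LinearMap.comp_add]
            abel)
          (fun r b v => by simp only [map_smul, LinearMap.comp_smul, smul_sub])
          (fun b v v' => by
            simp only [map_add, LinearMap.comp_add, LinearMap.add_comp, LinearMap.add_apply]
            abel)
          (fun r b v => by
            simp only [map_smul, LinearMap.comp_smul, LinearMap.smul_comp, LinearMap.smul_apply,
              smul_sub])) ∘ₗ
        TensorProduct.map LinearMap.id (PiTensorProduct.subsingletonEquiv (0 : Fin 1)).toLinearMap ∘ₗ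
          (TensorPower.mulEquiv (R := k) (M := Hat k g) (n := n) (m := 1)).symm.toLinearMap

/-- The star product defined by a bilinear operation `∘` on `g`. -/
def starOf : T k g →ₗ[k] T k g →ₗ[k] T k g := (degMap (starPow circ)).flip

theorem starOf_one (a : T k g) : starOf circ a 1 = a := by
  rw [starOf, LinearMap.flip_apply, ← word_zero (Fin.elim0 : Fin 0 → Hat k g), degMap_word, starPow]
  simp

/-- The defining recursion on the last letter. Together with `starOf_one` it is all that the later
arguments use about `starOf`. -/
theorem starOf_mul_ι (a b : T k g) (v : Hat k g) :
    starOf circ a (b * TensorAlgebra.ι k v) =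
      starOf circ a b * TensorAlgebra.ι k v + D circ v (starOf circ a b) * tT k g -
        starOf circ a (D circ v b) * tT k g := by
  refine LinearMap.congr_fun
    (f := starOf circ a ∘ₗ LinearMap.mulRight k (TensorAlgebra.ι k v))
    (g := LinearMap.mulRight k (TensorAlgebra.ι k v) ∘ₗ starOf circ a +
      LinearMap.mulRight k (tT k g) ∘ₗ D circ v ∘ₗ starOf circ a -
      LinearMap.mulRight k (tT k g) ∘ₗ starOf circ a ∘ₗ D circ v) ?_ b
  refine hom_ext_word fun n f => ?_
  have h1 : PiTensorProduct.tprod k (Fin.snoc f v : Fin (n + 1) → Hat k g) =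
      TensorPower.mulEquiv (PiTensorProduct.tprod k f ⊗ₜ[k]
        PiTensorProduct.tprod k (fun _ : Fin 1 => v)) := by
    rw [← Fin.append_right_eq_snoc f (fun _ => v), ← TensorPower.tprod_mul_tprod]
    rfl
  simp only [LinearMap.comp_apply, LinearMap.mulRight_apply, LinearMap.add_apply,
    LinearMap.sub_apply]
  obtain ⟨y, hy⟩ := D_mem_deg circ v (word_mem f)
  rw [← word_snoc, ← hy]
  simp only [starOf, LinearMap.flip_apply]
  rw [degMap_word, h1, degMap_word, degMap_ofDeg, starPow]
  simp only [LinearMap.comp_apply, LinearEquiv.coe_coe, LinearEquiv.symm_apply_apply,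
    TensorProduct.map_tmul, LinearMap.id_apply, TensorProduct.lift.tmul, LinearMap.mk₂_apply,
    PiTensorProduct.subsingletonEquiv_apply_tprod, LinearMap.sub_apply]
  rw [ofDeg_tprod, ← hy, toDeg_ofDeg, starLetter_apply, LinearMap.mulRight_apply]

end Star

/-! ### Associativity, unit, grading and equivariance -/

section StarAlgebra

variable {k g : Type*} [CommRing k] [AddCommGroup g] [Module k g] (circ : g →ₗ[k] g →ₗ[k] g)

theorem starOf_mul_tT (a b : T k g) : starOf circ a (b * tT k g) = starOf circ a b * tT k g := by
  have h := starOf_mul_ι circ a b (tHat k g)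
  rw [D_t, LinearMap.zero_apply, LinearMap.zero_apply, map_zero, zero_mul, add_zero, sub_zero] at h
  exact h

theorem starOf_ι (a : T k g) (v : Hat k g) :
    starOf circ a (TensorAlgebra.ι k v) = a * TensorAlgebra.ι k v + D circ v a * tT k g := by
  have h := starOf_mul_ι circ a 1 v
  rwa [one_mul, starOf_one, D_one, map_zero, zero_mul, sub_zero] at h

theorem starOf_tT (a : T k g) : starOf circ a (tT k g) = a * tT k g := by
  rw [tT, starOf_ι, D_t, LinearMap.zero_apply, zero_mul, add_zero]

theorem mul_ι_eq_starOf (b : T k g) (v : Hat k g) :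
    b * TensorAlgebra.ι k v = starOf circ b (TensorAlgebra.ι k v) - D circ v b * tT k g := by
  rw [starOf_ι, add_sub_cancel_right]

/-- The term subtracted in the recursion is exactly what is needed for associativity when the last
factor is a letter. -/
theorem starOf_starOf_ι (a b : T k g) (v : Hat k g) :
    starOf circ a (starOf circ b (TensorAlgebra.ι k v)) =
      starOf circ (starOf circ a b) (TensorAlgebra.ι k v) := by
  rw [starOf_ι, map_add, starOf_mul_ι, starOf_mul_tT, starOf_ι, sub_add_cancel]

/-- Star products satisfying the recursion in the last letter are determined by `∘`. -/
theorem eq_starOf {star : T k g →ₗ[k] T k g →ₗ[k] T k g} (h1 : ∀ a, star a 1 = a)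
    (h2 : ∀ a b v, star a (b * TensorAlgebra.ι k v) =
      star a b * TensorAlgebra.ι k v + D circ v (star a b) * tT k g -
        star a (D circ v b) * tT k g) : star = starOf circ := by
  refine LinearMap.ext fun a => LinearMap.ext fun b => ?_
  induction b using deg_right_induction with
  | hone => rw [h1, starOf_one]
  | hadd b b' h h' => rw [map_add, map_add, h, h']
  | hsmul r b h => rw [map_smul, map_smul, h]
  | hstep n ih b hb v => rw [h2, starOf_mul_ι, ih b hb, ih _ (D_mem_deg circ v hb)]

theorem starOf_assoc (a b c : T k g) :
    starOf circ (starOf circ a b) c = starOf circ a (starOf circ b c) := by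
  induction c using deg_right_induction with
  | hone => rw [starOf_one, starOf_one]
  | hadd c c' h h' => rw [map_add, map_add, map_add, h, h']
  | hsmul r c h => rw [map_smul, map_smul, map_smul, h]
  | hstep n ih c hc v =>
    -- Replacing `c v` by `c * v - (D_v c) t` reduces the claim to the letter case and to the
    -- induction hypothesis for `c` and for `D_v c`, which has the same degree as `c`.
    rw [mul_ι_eq_starOf circ, map_sub, map_sub, map_sub, starOf_mul_tT, starOf_mul_tT,
      starOf_mul_tT, ih _ (D_mem_deg circ v hc), starOf_starOf_ι, ih c hc,
      starOf_starOf_ι circ b c, starOf_starOf_ι]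

theorem one_starOf (b : T k g) : starOf circ 1 b = b := by
  induction b using deg_right_induction with
  | hone => rw [starOf_one]
  | hadd b b' h h' => rw [map_add, h, h']
  | hsmul r b h => rw [map_smul, h]
  | hstep n ih b hb v =>
    rw [starOf_mul_ι, ih b hb, ih _ (D_mem_deg circ v hb), add_sub_cancel_right]

/-- If `u ∘ v = 0` for all letters `u` of `a` and `v` of `b`, then `a * b = a b`. -/
theorem starOf_eq_mul (W : Submodule k (Hat k g)) (hW : ∀ v ∈ W, ∀ w ∈ W, circHat circ v w ∈ W)
    {a : T k g} (ha : ∀ v ∈ W, D circ v a = 0) {n : ℕ} (f : Fin n → Hat k g) (hf : ∀ i, f i ∈ W) :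
    starOf circ a (word f) = a * word f := by
  induction n with
  | zero => rw [word_zero, starOf_one, mul_one]
  | succ n ih =>
    -- Writing `b` for the word without its last letter `v`, one has `D_v (a b) = a D_v b`, and `D_v
    -- b` is a sum of words in `W`. The induction hypothesis applies to each of them, so the two
    -- correction terms cancel.
    rw [word_eq_init, starOf_mul_ι, ih (Fin.init f) fun i => hf _, D_mul, ha _ (hf _), zero_mul,
      zero_add, D_apply, der_word, map_sum, Finset.mul_sum, ← mul_assoc]
    rw [Finset.sum_congr rfl fun i _ => ih (Function.update (Fin.init f) i
      (circHat circ (f (Fin.last n)) (Fin.init f i))) fun j => ?_, add_sub_cancel_right]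
    by_cases h : j = i
    · subst h
      rw [Function.update_self]
      exact hW _ (hf _) _ (hf _)
    · rw [Function.update_of_ne h]
      exact hf _

theorem tT_starOf (b : T k g) : starOf circ (tT k g) b = tT k g * b := by
  refine LinearMap.congr_fun (f := starOf circ (tT k g)) (g := LinearMap.mulLeft k (tT k g))
    (hom_ext_word fun n f => ?_) b
  exact starOf_eq_mul circ ⊤ (fun _ _ _ _ => trivial) (fun v _ => D_tT circ v) f fun _ => trivial

theorem starOf_mem_deg {m n : ℕ} {a b : T k g} (ha : a ∈ deg k g m) (hb : b ∈ deg k g n) :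
    starOf circ a b ∈ deg k g (m + n) := by
  induction n generalizing b with
  | zero =>
    obtain ⟨c, rfl⟩ := deg_zero_induction hb
    rw [map_smul, starOf_one]
    exact Submodule.smul_mem _ _ ha
  | succ n ih =>
    refine deg_induction (P := fun b => starOf circ a b ∈ deg k g (m + (n + 1))) (fun f => ?_)
      (fun b b' h h' => ?_) (fun r b h => ?_) hb
    · rw [word_eq_init, starOf_mul_ι]
      have h1 := ih (word_mem (Fin.init f : Fin n → Hat k g))
      change _ ∈ deg k g (m + n + 1)
      exact Submodule.sub_mem _ (Submodule.add_mem _ (mul_mem_deg h1 (ι_mem_deg _))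
        (mul_mem_deg (D_mem_deg circ _ h1) (ι_mem_deg _)))
        (mul_mem_deg (ih (D_mem_deg circ _ (word_mem _))) (ι_mem_deg _))
    · rw [map_add]; exact Submodule.add_mem _ h h'
    · rw [map_smul]; exact Submodule.smul_mem _ _ h

theorem perm_mul_ι {m m' : ℕ} (e : Fin m ≃ Fin m') {a : T k g} (ha : a ∈ deg k g m)
    (v : Hat k g) :
    perm (sumPerm e (Equiv.refl (Fin 1))) (a * TensorAlgebra.ι k v) =
      perm e a * TensorAlgebra.ι k v := by
  rw [← perm_mul _ _ ha (ι_mem_deg v), perm_of_refl (ι_mem_deg v)]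

theorem sumPerm_castAdd {m m' n n' : ℕ} (e : Fin m ≃ Fin m') (e' : Fin n ≃ Fin n') (i : Fin m) :
    sumPerm e e' (Fin.castAdd n i) = Fin.castAdd n' (e i) := by
  simp [sumPerm]

theorem sumPerm_natAdd {m m' n n' : ℕ} (e : Fin m ≃ Fin m') (e' : Fin n ≃ Fin n') (i : Fin n) :
    sumPerm e e' (Fin.natAdd m i) = Fin.natAdd m' (e' i) := by
  simp [sumPerm]

theorem sumPerm_val {m m' n n' : ℕ} (e : Fin m ≃ Fin m') (e' : Fin n ≃ Fin n')
    (i : Fin (m + n)) : (sumPerm e e' i : ℕ) =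
      if h : (i : ℕ) < m then (e ⟨i, h⟩ : ℕ) else m' + e' ⟨i - m, by omega⟩ := by
  refine Fin.addCases (fun i => ?_) (fun i => ?_) i
  · rw [sumPerm_castAdd, dif_pos (by simp)]
    simp
  · rw [sumPerm_natAdd, dif_neg (by simp)]
    simp

theorem sumPerm_refl_refl (m n : ℕ) :
    sumPerm (Equiv.refl (Fin m)) (Equiv.refl (Fin n)) = Equiv.refl (Fin (m + n)) := by
  ext i
  simp [sumPerm]

theorem sumPerm_sumPerm_val {m m' n n' p p' : ℕ} (e : Fin m ≃ Fin m') (e' : Fin n ≃ Fin n')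
    (e'' : Fin p ≃ Fin p') (i : Fin (m + n + p)) :
    (sumPerm (sumPerm e e') e'' i : ℕ) =
      sumPerm e (sumPerm e' e'') (Fin.cast (Nat.add_assoc m n p) i) := by
  refine Fin.addCases (fun i => Fin.addCases (fun i => ?_) (fun i => ?_) i) (fun i => ?_) i
  · rw [sumPerm_natAdd]
    have h : Fin.cast (Nat.add_assoc m n p) (Fin.natAdd (m + n) i) =
      Fin.natAdd m (Fin.natAdd n i) := Fin.ext (by simp [add_assoc])
    rw [h, sumPerm_natAdd, sumPerm_natAdd]
    have hm : m = m' := by simpa using Fintype.card_congr e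
    have hn : n = n' := by simpa using Fintype.card_congr e'
    simp [add_assoc]
  · rw [sumPerm_castAdd, sumPerm_castAdd]
    have h : Fin.cast (Nat.add_assoc m n p) (Fin.castAdd p (Fin.castAdd n i)) =
      Fin.castAdd (n + p) i := rfl
    rw [h, sumPerm_castAdd]
    rfl
  · rw [sumPerm_castAdd, sumPerm_natAdd]
    have h : Fin.cast (Nat.add_assoc m n p) (Fin.castAdd p (Fin.natAdd m i)) =
      Fin.natAdd m (Fin.castAdd p i) := rfl
    rw [h, sumPerm_natAdd, sumPerm_castAdd]
    rfl

theorem sumPerm_assoc_one {m m' n n' : ℕ} (e : Fin m ≃ Fin m') (e' : Fin n ≃ Fin n')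
    (e'' : Fin 1 ≃ Fin 1) : sumPerm e (sumPerm e' e'') = sumPerm (sumPerm e e') e'' :=
  Equiv.ext fun i => Fin.ext (sumPerm_sumPerm_val e e' e'' i).symm

theorem sumPerm_assoc_two {m m' n n' : ℕ} (e : Fin m ≃ Fin m') (e' : Fin n ≃ Fin n')
    (e'' : Fin 2 ≃ Fin 2) : sumPerm e (sumPerm e' e'') = sumPerm (sumPerm e e') e'' :=
  Equiv.ext fun i => Fin.ext (sumPerm_sumPerm_val e e' e'' i).symm

theorem swap_castSucc_castSucc {n : ℕ} (i j : Fin n) :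
    Equiv.swap i.castSucc j.castSucc = sumPerm (Equiv.swap i j) (Equiv.refl (Fin 1)) := by
  ext l
  refine Fin.lastCases ?_ (fun l => ?_) l
  · have h : Fin.last n = Fin.natAdd n (0 : Fin 1) := rfl
    rw [Equiv.swap_apply_of_ne_of_ne (Fin.castSucc_lt_last i).ne' (Fin.castSucc_lt_last j).ne', h,
      sumPerm_natAdd]
    rfl
  · have h : l.castSucc = Fin.castAdd 1 l := rfl
    rw [(Fin.castSucc_injective n).swap_apply, h, sumPerm_castAdd]
    rfl

theorem swap_last (n : ℕ) :
    Equiv.swap (Fin.last n).castSucc (Fin.last n).succ =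
      sumPerm (Equiv.refl (Fin n)) (Equiv.swap (0 : Fin 2) 1) := by
  have h0 : (Fin.last n).castSucc = Fin.natAdd n (0 : Fin 2) := rfl
  have h1 : (Fin.last n).succ = Fin.natAdd n (1 : Fin 2) := rfl
  refine Equiv.ext fun l => Fin.addCases (m := n) (n := 2) (fun l => ?_) (fun l => ?_) l
  · rw [sumPerm_castAdd, h0, h1, Equiv.swap_apply_of_ne_of_ne]
    · rfl
    · exact fun h => by have := congrArg Fin.val h; simp at this; omega
    · exact fun h => by have := congrArg Fin.val h; simp at this; omega
  · rw [sumPerm_natAdd, h0, h1, (Fin.natAdd_injective 2 n).swap_apply]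

theorem sumPerm_zero {m m' : ℕ} (e : Fin m ≃ Fin m') : sumPerm e (Equiv.refl (Fin 0)) = e := by
  ext i
  have hi : (i : ℕ) < m := i.2
  rw [sumPerm_val, dif_pos hi]
  rfl

theorem sumPerm_succ {m m' : ℕ} (e : Fin m ≃ Fin m') (n : ℕ) :
    sumPerm e (Equiv.refl (Fin (n + 1))) =
      sumPerm (sumPerm e (Equiv.refl (Fin n))) (Equiv.refl (Fin 1)) := by
  have hm : m = m' := by simpa using Fintype.card_congr e
  refine Equiv.ext fun i => Fin.ext ?_
  rw [sumPerm_val, sumPerm_val]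
  by_cases h : (i : ℕ) < m
  · rw [dif_pos h, dif_pos (by omega), sumPerm_val, dif_pos h]
  · rw [dif_neg h]
    by_cases h2 : (i : ℕ) < m + n
    · rw [dif_pos h2, sumPerm_val, dif_neg h]
      rfl
    · rw [dif_neg h2]
      simp only [Equiv.refl_apply]
      omega

/-- The recursion only appends letters to the right of the positions of `a`, and each `D_v` commutes
with permutations. No condition on `∘` is needed. -/
theorem starOf_perm_left {m m' n : ℕ} (e : Fin m ≃ Fin m') {a b : T k g} (ha : a ∈ deg k g m)
    (hb : b ∈ deg k g n) :
    starOf circ (perm e a) b = perm (sumPerm e (Equiv.refl (Fin n))) (starOf circ a b) := by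
  induction n generalizing b with
  | zero =>
    obtain ⟨c, rfl⟩ := deg_zero_induction hb
    rw [map_smul, map_smul, starOf_one, starOf_one, map_smul]
    congr 2
    rw [sumPerm_zero]
  | succ n ih =>
    refine eqOn_deg (F := starOf circ (perm e a))
      (G := perm (sumPerm e (Equiv.refl (Fin (n + 1)))) ∘ₗ starOf circ a) (fun f => ?_) hb
    have hw : word (Fin.init f : Fin n → Hat k g) ∈ deg k g n := word_mem _
    have hs := starOf_mem_deg circ ha hw
    rw [LinearMap.comp_apply, word_eq_init, starOf_mul_ι, starOf_mul_ι, ih hw,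
      ih (D_mem_deg circ _ hw), D_perm, sumPerm_succ, map_sub, map_add, perm_mul_ι _ hs, tT,
      perm_mul_ι _ (D_mem_deg circ _ hs),
      perm_mul_ι _ (starOf_mem_deg circ ha (D_mem_deg circ _ hw))]

/-- Both sides are derivations in `a`, the left one as a commutator of derivations. On a letter `u`
the equality is the pre-Lie identity for `u, v, w`; note that `circHat circ w v` is `v ∘ w`. -/
theorem D_comm (hc : IsPreLie circ) (v w : Hat k g) (a : T k g) :
    D circ w (D circ v a) - D circ v (D circ w a) =
      D circ (circHat circ w v) a - D circ (circHat circ v w) a := by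
  induction a using deg_right_induction with
  | hone => simp [D_one]
  | hadd a b h h' =>
    simp only [map_add]
    rw [add_sub_add_comm, h, h', add_sub_add_comm]
  | hsmul r a h =>
    simp only [map_smul]
    rw [← smul_sub, h, smul_sub]
  | hstep n ih a ha u =>
    have h := ih a ha
    have h2 : circHat circ w (circHat circ v u) - circHat circ v (circHat circ w u) =
        circHat circ (circHat circ w v) u - circHat circ (circHat circ v w) u := by
      simp only [circHat_apply, Prod.mk_sub_mk, sub_zero]
      congr 1
      have := hc u.1 v.1 w.1
      rw [sub_eq_sub_iff_add_eq_add] at this ⊢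
      rw [add_comm, this, add_comm]
    have h3 := congrArg (fun x => a * TensorAlgebra.ι k x) h2
    simp only [map_sub, mul_sub] at h3
    have h4 := congrArg (fun x => x * TensorAlgebra.ι k u) h
    simp only [sub_mul] at h4
    simp only [D_mul, D_ι, map_add]
    have h5 := congrArg₂ (· + ·) h3 h4
    rw [← sub_eq_zero] at h5 ⊢
    rw [← h5]
    abel

/-- The terms ending in `(v ∘ w) t` cancel. What is left is sorted by its last two letters, so that
the effect of exchanging `v` and `w` can be read off. -/
theorem starOf_mul_ι_mul_ι (a b : T k g) (v w : Hat k g) :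
    starOf circ a (b * TensorAlgebra.ι k v * TensorAlgebra.ι k w) =
      starOf circ a b * (TensorAlgebra.ι k v * TensorAlgebra.ι k w) +
      (D circ v (starOf circ a b) - starOf circ a (D circ v b)) * (tT k g * TensorAlgebra.ι k w) +
      (D circ w (starOf circ a b) - starOf circ a (D circ w b)) * (TensorAlgebra.ι k v * tT k g) +
      (D circ w (D circ v (starOf circ a b)) - D circ (circHat circ w v) (starOf circ a b) +
        starOf circ a (D circ v (D circ w b) + D circ (circHat circ w v) b) -
        D circ w (starOf circ a (D circ v b)) - D circ v (starOf circ a (D circ w b))) *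
          (tT k g * tT k g) := by
  rw [starOf_mul_ι, starOf_mul_ι, D_mul circ w b, D_ι, map_add, starOf_mul_ι, starOf_mul_ι]
  simp only [map_add, map_sub, D_mul, D_ι, D_tT]
  noncomm_ring

theorem perm_mul_two {m n : ℕ} (τ : Equiv.Perm (Fin n)) {a b : T k g} (ha : a ∈ deg k g m)
    (hb : b ∈ deg k g n) :
    perm (sumPerm (Equiv.refl (Fin m)) τ) (a * b) = a * perm τ b := by
  rw [← perm_mul _ _ ha hb, perm_of_refl ha]

theorem perm_swap_two (v w : Hat k g) :
    perm (Equiv.swap (0 : Fin 2) 1) (TensorAlgebra.ι k v * TensorAlgebra.ι k w) =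
      TensorAlgebra.ι k w * TensorAlgebra.ι k v := by
  have h : ∀ v w : Hat k g, TensorAlgebra.ι k v * TensorAlgebra.ι k w = word ![v, w] :=
    fun v w => by simp [word]
  rw [h, h, perm_word]
  congr 1
  funext i
  fin_cases i <;> simp

/-- Exchanging `v` and `w` interchanges the two middle terms of the expansion along with their last
letters. The coefficient of `t t` is symmetric because, by `D_comm`, both `D_w D_v - D_{v ∘ w}` and
`D_v D_w + D_{v ∘ w}` are. -/
theorem starOf_swap (hc : IsPreLie circ) {m n : ℕ} {a b : T k g} (ha : a ∈ deg k g m)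
    (hb : b ∈ deg k g n) (v w : Hat k g) :
    starOf circ a (b * TensorAlgebra.ι k w * TensorAlgebra.ι k v) =
      perm (sumPerm (Equiv.refl (Fin (m + n))) (Equiv.swap (0 : Fin 2) 1))
        (starOf circ a (b * TensorAlgebra.ι k v * TensorAlgebra.ι k w)) := by
  have hX := starOf_mem_deg circ ha hb
  have hY : ∀ v, D circ v (starOf circ a b) - starOf circ a (D circ v b) ∈ deg k g (m + n) :=
    fun v => Submodule.sub_mem _ (D_mem_deg circ v hX) (starOf_mem_deg circ ha (D_mem_deg circ v hb))
  have hZ : (D circ w (D circ v (starOf circ a b)) - D circ (circHat circ w v) (starOf circ a b) +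
        starOf circ a (D circ v (D circ w b) + D circ (circHat circ w v) b) -
        D circ w (starOf circ a (D circ v b)) - D circ v (starOf circ a (D circ w b))) ∈
        deg k g (m + n) := by
    refine Submodule.sub_mem _ (Submodule.sub_mem _ (Submodule.add_mem _ (Submodule.sub_mem _
      (D_mem_deg circ _ (D_mem_deg circ _ hX)) (D_mem_deg circ _ hX)) (starOf_mem_deg circ ha
      (Submodule.add_mem _ (D_mem_deg circ _ (D_mem_deg circ _ hb)) (D_mem_deg circ _ hb))))
      (D_mem_deg circ _ (starOf_mem_deg circ ha (D_mem_deg circ _ hb))))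
      (D_mem_deg circ _ (starOf_mem_deg circ ha (D_mem_deg circ _ hb)))
  have h2 : ∀ v w : Hat k g, TensorAlgebra.ι k v * TensorAlgebra.ι k w ∈ deg k g 2 :=
    fun v w => mul_mem_deg (ι_mem_deg v) (ι_mem_deg w)
  rw [starOf_mul_ι_mul_ι, starOf_mul_ι_mul_ι, map_add (perm _), map_add (perm _),
    map_add (perm _), perm_mul_two _ hX (h2 _ _), tT, perm_mul_two _ (hY v) (h2 _ _),
    perm_mul_two _ (hY w) (h2 _ _),
    perm_mul_two _ hZ (h2 _ _), perm_swap_two, perm_swap_two, perm_swap_two, perm_swap_two]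
  have h3 := D_comm circ hc v w (starOf circ a b)
  have h4 := congrArg (starOf circ a) (D_comm circ hc v w b)
  simp only [map_sub] at h4
  rw [sub_eq_sub_iff_add_eq_add] at h3 h4
  have h5 : D circ w (D circ v (starOf circ a b)) - D circ (circHat circ w v) (starOf circ a b) +
        starOf circ a (D circ v (D circ w b) + D circ (circHat circ w v) b) =
      D circ v (D circ w (starOf circ a b)) - D circ (circHat circ v w) (starOf circ a b) +
        starOf circ a (D circ w (D circ v b) + D circ (circHat circ v w) b) := by
    rw [map_add, map_add, h4, add_comm (starOf circ a (D circ (circHat circ w v) b)), add_left_inj,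
      sub_eq_sub_iff_add_eq_add, h3, add_comm]
  rw [h5, sub_right_comm]
  abel

/-- Adjacent transpositions generate the symmetric group. One that fixes the last position passes
through the recursion by induction on the length; the one that moves it is `starOf_swap`. -/
theorem starOf_perm_right (hc : IsPreLie circ) {m n : ℕ} (τ : Equiv.Perm (Fin n)) {a b : T k g}
    (ha : a ∈ deg k g m) (hb : b ∈ deg k g n) :
    starOf circ a (perm τ b) = perm (sumPerm (Equiv.refl (Fin m)) τ) (starOf circ a b) := by
  induction n generalizing b with
  | zero =>
    rw [Subsingleton.elim τ (Equiv.refl _), perm_of_refl hb, sumPerm_refl_refl,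
      perm_of_refl (starOf_mem_deg circ ha hb)]
  | succ n ih =>
    have hτ : τ ∈ Submonoid.closure (Set.range fun i : Fin n => Equiv.swap i.castSucc i.succ) := by
      rw [Equiv.Perm.mclosure_swap_castSucc_succ]
      trivial
    induction hτ using Submonoid.closure_induction generalizing b with
    | one =>
      change starOf circ a (perm (Equiv.refl _) b) = perm (sumPerm _ (Equiv.refl _)) _
      rw [perm_of_refl hb, sumPerm_refl_refl, perm_of_refl (starOf_mem_deg circ ha hb)]
    | mul σ τ _ _ hσ hτ =>
      have h1 : perm (σ * τ) b = perm σ (perm τ b) := (perm_perm τ σ b).symm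
      have h2 : sumPerm (Equiv.refl (Fin m)) (σ * τ) =
          (sumPerm (Equiv.refl (Fin m)) τ).trans (sumPerm (Equiv.refl (Fin m)) σ) := by
        ext i
        refine Fin.addCases (fun i => ?_) (fun i => ?_) i <;> simp [sumPerm]
      rw [h1, hσ (perm_mem _ _), hτ hb, perm_perm, h2]
    | mem τ hτ =>
      obtain ⟨i, rfl⟩ := hτ
      cases n with
      | zero => exact i.elim0
      | succ n =>
        refine eqOn_deg (F := starOf circ a ∘ₗ perm (Equiv.swap i.castSucc i.succ))
          (G := perm (sumPerm (Equiv.refl (Fin m)) (Equiv.swap i.castSucc i.succ)) ∘ₗ starOf circ a)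
          (fun f => ?_) hb
        rw [LinearMap.comp_apply, LinearMap.comp_apply, word_eq_init]
        have hw : word (Fin.init f : Fin (n + 1) → Hat k g) ∈ deg k g (n + 1) := word_mem _
        refine Fin.lastCases ?_ (fun i => ?_) i
        · rw [word_eq_init (Fin.init f), swap_last, mul_assoc, perm_mul_two _ (word_mem _)
            (mul_mem_deg (ι_mem_deg _) (ι_mem_deg _)), perm_swap_two, ← mul_assoc, ← mul_assoc,
            starOf_swap circ hc ha (word_mem _), ← sumPerm_refl_refl, ← sumPerm_assoc_two]
        · have hs := starOf_mem_deg circ ha hw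
          rw [Fin.succ_castSucc, swap_castSucc_castSucc, perm_mul_ι _ hw, starOf_mul_ι,
            starOf_mul_ι, ih _ hw, D_perm, D_perm, ih _ (D_mem_deg circ _ hw), map_sub, map_add,
            sumPerm_assoc_one, perm_mul_ι _ hs, tT, perm_mul_ι _ (D_mem_deg circ _ hs),
            perm_mul_ι _ (starOf_mem_deg circ ha (D_mem_deg circ _ hw))]

end StarAlgebra

/-! ### Naturality of the star product in the module -/

section Functoriality

variable {k g h : Type*} [CommRing k] [AddCommGroup g] [Module k g] [AddCommGroup h] [Module k h]

/-- The algebra morphism `T_k ĝ → T_k ĥ` induced by a linear map `ĝ → ĥ`. -/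
def mapT (φ : Hat k g →ₗ[k] Hat k h) : T k g →ₐ[k] T k h :=
  TensorAlgebra.lift k (TensorAlgebra.ι k ∘ₗ φ)

variable (φ : Hat k g →ₗ[k] Hat k h)

theorem mapT_ι (v : Hat k g) : mapT φ (TensorAlgebra.ι k v) = TensorAlgebra.ι k (φ v) :=
  TensorAlgebra.lift_ι_apply (TensorAlgebra.ι k ∘ₗ φ) v

theorem mapT_word {n : ℕ} (f : Fin n → Hat k g) : mapT φ (word f) = word fun i => φ (f i) := by
  rw [word, map_list_prod, List.map_ofFn, word]
  congr 2
  funext i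
  exact mapT_ι φ _

theorem mapT_mem_deg {n : ℕ} {a : T k g} (ha : a ∈ deg k g n) : mapT φ a ∈ deg k h n :=
  deg_induction (P := fun a => mapT φ a ∈ deg k h n) (fun f => by rw [mapT_word]; exact word_mem _)
    (fun a b ha hb => by rw [map_add]; exact Submodule.add_mem _ ha hb)
    (fun r a ha => by rw [map_smul]; exact Submodule.smul_mem _ _ ha) ha

theorem mapT_perm {m n : ℕ} (e : Fin m ≃ Fin n) (a : T k g) :
    mapT φ (perm e a) = perm e (mapT φ a) := by
  refine LinearMap.congr_fun (f := (mapT φ).toLinearMap ∘ₗ perm e)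
    (g := perm e ∘ₗ (mapT φ).toLinearMap) (hom_ext_deg fun l a ha => ?_) a
  by_cases hl : m = l
  · subst hl
    refine eqOn_deg (fun f => ?_) ha
    simp only [LinearMap.comp_apply, AlgHom.toLinearMap_apply]
    rw [perm_word, mapT_word, mapT_word, perm_word]
    rfl
  · simp only [LinearMap.comp_apply, AlgHom.toLinearMap_apply]
    rw [perm_of_ne e hl ha, perm_of_ne e hl (mapT_mem_deg φ ha), map_zero]

theorem mapT_D {circ : g →ₗ[k] g →ₗ[k] g} {circ' : h →ₗ[k] h →ₗ[k] h} {v : Hat k g} {v' : Hat k h}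
    (hφ : ∀ u, φ (circHat circ v u) = circHat circ' v' (φ u)) (a : T k g) :
    mapT φ (D circ v a) = D circ' v' (mapT φ a) := by
  induction a using deg_right_induction with
  | hone => rw [D_one, map_one, D_one, map_zero]
  | hadd a b ha hb => simp only [map_add, ha, hb]
  | hsmul r a ha => simp only [map_smul, ha]
  | hstep n ih a ha u =>
    rw [D_mul, map_add, map_mul, map_mul, map_mul, ih a ha, D_ι, mapT_ι, mapT_ι, hφ, D_mul, D_ι]

theorem mapT_tT (ht : φ (tHat k g) = tHat k h) : mapT φ (tT k g) = tT k h := by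
  rw [tT, mapT_ι, ht, tT]

/-- A map of letters compatible with the operations and with `t` intertwines the derivations, hence
preserves the recursion. The coproduct is handled by applying this to the diagonal of `g`. -/
theorem mapT_starOf {circ : g →ₗ[k] g →ₗ[k] g} {circ' : h →ₗ[k] h →ₗ[k] h}
    (hφ : ∀ v u, φ (circHat circ v u) = circHat circ' (φ v) (φ u)) (ht : φ (tHat k g) = tHat k h)
    (a b : T k g) : mapT φ (starOf circ a b) = starOf circ' (mapT φ a) (mapT φ b) := by
  induction b using deg_right_induction with
  | hone => rw [starOf_one, map_one, starOf_one]
  | hadd b b' hb hb' => simp only [map_add, hb, hb']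
  | hsmul r b hb => simp only [map_smul, hb]
  | hstep n ih b hb v =>
    rw [starOf_mul_ι, map_sub, map_add, map_mul, map_mul, map_mul, map_mul, mapT_ι, mapT_tT φ ht,
      starOf_mul_ι, ih b hb, ih _ (D_mem_deg circ v hb), mapT_D φ (hφ v), mapT_D φ (hφ v), ih b hb]

end Functoriality

/-! ### Counit, degree condition, filtration and twisted algebra structure -/

section Conditions

variable {k g : Type*} [CommRing k] [AddCommGroup g] [Module k g] (circ : g →ₗ[k] g →ₗ[k] g)

theorem counit_ι (v : Hat k g) : counit k g (TensorAlgebra.ι k v) = v.2 • Polynomial.X :=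
  TensorAlgebra.lift_ι_apply _ v

theorem counit_D (v : Hat k g) (a : T k g) : counit k g (D circ v a) = 0 := by
  induction a using deg_right_induction with
  | hone => rw [D_one, map_zero]
  | hadd a b ha hb => rw [map_add, map_add, ha, hb, add_zero]
  | hsmul r a ha => rw [map_smul, map_smul, ha, smul_zero]
  | hstep n ih a ha u =>
    rw [D_mul, map_add, map_mul, map_mul, ih a ha, zero_mul, zero_add, D_ι, counit_ι,
      circHat_apply, zero_smul, mul_zero]

/-- Every term of `D_v a` contains a letter of `Σg`, so the counit does not see the correction
terms. -/
theorem counit_starOf (a b : T k g) :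
    counit k g (starOf circ a b) = counit k g a * counit k g b := by
  induction b using deg_right_induction with
  | hone => rw [starOf_one, map_one, mul_one]
  | hadd b b' hb hb' => rw [map_add, map_add, map_add, hb, hb', mul_add]
  | hsmul r b hb => rw [map_smul, map_smul, map_smul, hb, mul_smul_comm]
  | hstep n ih b hb v =>
    rw [starOf_mul_ι, map_sub, map_add, map_mul, map_mul, map_mul, map_mul, ih b hb,
      ih _ (D_mem_deg circ v hb), counit_D, counit_D, mul_zero, zero_mul, add_zero, sub_zero,
      mul_assoc]

theorem incl_apply (x : g) : incl k g x = TensorAlgebra.ι k ((x, 0) : Hat k g) := rfl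

theorem D_mem_incl_pow (v : Hat k g) (m : ℕ) {a : T k g}
    (ha : a ∈ LinearMap.range (incl k g) ^ m) : D circ v a ∈ LinearMap.range (incl k g) ^ m := by
  induction m generalizing a with
  | zero =>
    rw [pow_zero] at ha ⊢
    obtain ⟨c, rfl⟩ := Submodule.mem_one.1 ha
    rw [Algebra.algebraMap_eq_smul_one, map_smul, D_one, smul_zero]
    exact Submodule.zero_mem _
  | succ m ih =>
    rw [pow_succ] at ha ⊢
    induction ha using Submodule.mul_induction_on' with
    | mem_mul_mem b hb c hc =>
      rw [D_mul]
      refine Submodule.add_mem _ (Submodule.mul_mem_mul (ih hb) hc) (Submodule.mul_mem_mul hb ?_)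
      obtain ⟨x, rfl⟩ := hc
      rw [incl_apply, D_ι]
      exact ⟨_, rfl⟩
    | add x _ y _ hx hy =>
      rw [map_add]
      exact Submodule.add_mem _ hx hy

theorem D_mem_incl_pow_mul_top (v : Hat k g) (m : ℕ) {a : T k g}
    (ha : a ∈ LinearMap.range (incl k g) ^ m * (⊤ : Submodule k (T k g))) :
    D circ v a ∈ LinearMap.range (incl k g) ^ m * (⊤ : Submodule k (T k g)) := by
  induction ha using Submodule.mul_induction_on' with
  | mem_mul_mem b hb c hc =>
    rw [D_mul]
    exact Submodule.add_mem _ (Submodule.mul_mem_mul (D_mem_incl_pow circ v m hb) trivial)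
      (Submodule.mul_mem_mul hb trivial)
  | add x _ y _ hx hy =>
    rw [map_add]
    exact Submodule.add_mem _ hx hy

theorem mul_mem_mul_top {N : Submodule k (T k g)} {a : T k g}
    (ha : a ∈ N * (⊤ : Submodule k (T k g))) (b : T k g) :
    a * b ∈ N * (⊤ : Submodule k (T k g)) := by
  have h := Submodule.mul_mem_mul ha (Submodule.mem_top (x := b))
  rw [mul_assoc] at h
  exact mul_le_mul_right (le_top : (⊤ : Submodule k (T k g)) * ⊤ ≤ ⊤) N h

/-- The recursion builds `a * b` from `a` by right multiplications and by the derivations `D_v`, and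
both preserve this right ideal. -/
theorem starOf_mem_incl_pow_mul_top (m : ℕ) {a : T k g}
    (ha : a ∈ LinearMap.range (incl k g) ^ m * (⊤ : Submodule k (T k g))) (b : T k g) :
    starOf circ a b ∈ LinearMap.range (incl k g) ^ m * (⊤ : Submodule k (T k g)) := by
  induction b using deg_right_induction with
  | hone => rwa [starOf_one]
  | hadd b b' hb hb' => rw [map_add]; exact Submodule.add_mem _ hb hb'
  | hsmul r b hb => rw [map_smul]; exact Submodule.smul_mem _ _ hb
  | hstep n ih b hb v =>
    rw [starOf_mul_ι]
    exact Submodule.sub_mem _ (Submodule.add_mem _ (mul_mem_mul_top (ih b hb) _)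
      (mul_mem_mul_top (D_mem_incl_pow_mul_top circ v m (ih b hb)) _))
      (mul_mem_mul_top (ih _ (D_mem_deg circ v hb)) _)

theorem mem_mul_top {N : Submodule k (T k g)} {a : T k g} (ha : a ∈ N) :
    a ∈ N * (⊤ : Submodule k (T k g)) := by
  rw [← mul_one a]
  exact Submodule.mul_mem_mul ha trivial

theorem starOf_degreeCondition : DegreeCondition (starOf circ) := fun m _ hx y =>
  starOf_mem_incl_pow_mul_top circ m (mem_mul_top hx) y

/-- The span of the words of length `n` and of filtration degree at most `j`. -/
def filLength (k g : Type*) [CommRing k] [AddCommGroup g] [Module k g] (n : ℕ) (j : ℤ) :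
    Submodule k (T k g) :=
  Submodule.span k {y | ∃ (f : Fin n → Hat k g) (d : Fin n → ℕ), (∀ i, f i ∈ filHat k g (d i)) ∧
    ((∑ i, d i : ℕ) : ℤ) ≤ j ∧ y = word f}

theorem word_mem_filLength {n : ℕ} {j : ℤ} (f : Fin n → Hat k g) (d : Fin n → ℕ)
    (hf : ∀ i, f i ∈ filHat k g (d i)) (hd : ((∑ i, d i : ℕ) : ℤ) ≤ j) :
    word f ∈ filLength k g n j := Submodule.subset_span ⟨f, d, hf, hd, rfl⟩

theorem filLength_le_fil (n : ℕ) (j : ℤ) : filLength k g n j ≤ fil k g j := by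
  refine Submodule.span_le.2 ?_
  rintro _ ⟨f, d, hf, hd, rfl⟩
  refine Submodule.subset_span ⟨List.ofFn fun i => (d i, f i), ?_, ?_, ?_⟩
  · intro p hp
    rw [List.mem_ofFn] at hp
    obtain ⟨i, rfl⟩ := hp
    exact hf i
  · rw [List.map_ofFn, List.sum_ofFn]
    exact hd
  · rw [List.map_ofFn]
    rfl

/-- Sorting the generators of the filtration by their length makes induction on the length
available. -/
theorem fil_induction {j : ℤ} {N : Submodule k (T k g)} (h : ∀ n, filLength k g n j ≤ N) :
    fil k g j ≤ N := by
  refine Submodule.span_le.2 ?_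
  rintro _ ⟨l, hl, hd, rfl⟩
  have h1 : (l.map fun p => TensorAlgebra.ι k p.2).prod = word fun i : Fin l.length => l[i].2 := by
    rw [word, ← List.ofFn_getElem_eq_map]
    rfl
  rw [h1]
  refine h l.length (word_mem_filLength _ (fun i => l[i].1) (fun i => hl _ (List.getElem_mem _)) ?_)
  have h2 : (List.ofFn fun i : Fin l.length => l[i].1) = l.map Prod.fst :=
    List.ofFn_getElem_eq_map l Prod.fst
  rwa [← List.sum_ofFn, h2]

theorem fil_mono {i j : ℤ} (h : i ≤ j) : fil k g i ≤ fil k g j := by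
  refine Submodule.span_mono ?_
  rintro _ ⟨l, hl, hd, rfl⟩
  exact ⟨l, hl, hd.trans h, rfl⟩

theorem mul_mem_fil {i j : ℤ} {a b : T k g} (ha : a ∈ fil k g i) (hb : b ∈ fil k g j) :
    a * b ∈ fil k g (i + j) := by
  have h : fil k g i * fil k g j ≤ fil k g (i + j) := by
    rw [fil, fil, Submodule.span_mul_span, Submodule.span_le]
    rintro _ ⟨_, ⟨l, hl, hd, rfl⟩, _, ⟨l', hl', hd', rfl⟩, rfl⟩
    refine Submodule.subset_span ⟨l ++ l', ?_, ?_, ?_⟩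
    · intro p hp
      rcases List.mem_append.1 hp with hp | hp
      exacts [hl p hp, hl' p hp]
    · rw [List.map_append, List.sum_append, Nat.cast_add]
      exact add_le_add hd hd'
    · rw [List.map_append, List.prod_append]
  exact h (Submodule.mul_mem_mul ha hb)

theorem ι_mem_fil {v : Hat k g} {d : ℕ} (hv : v ∈ filHat k g d) :
    TensorAlgebra.ι k v ∈ fil k g d :=
  Submodule.subset_span ⟨[(d, v)], by simpa using hv, by simp, by simp⟩

theorem tT_mem_fil : tT k g ∈ fil k g 0 :=
  ι_mem_fil (d := 0) (Submodule.mem_span_singleton_self _)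

theorem D_eq_zero_of_mem {v : Hat k g} (hv : v ∈ filHat k g 0) : D circ v = 0 := by
  obtain ⟨c, rfl⟩ := Submodule.mem_span_singleton.1 hv
  rw [map_smul, D_t, smul_zero]

theorem circHat_mem_filHat (v : Hat k g) {u : Hat k g} {d : ℕ} (hu : u ∈ filHat k g d) :
    circHat circ v u ∈ filHat k g d := by
  cases d with
  | zero =>
    obtain ⟨c, rfl⟩ := Submodule.mem_span_singleton.1 hu
    have h : circHat circ v (c • tHat k g) = 0 := by
      rw [circHat_apply]
      simp [tHat]
    rw [h]
    exact Submodule.zero_mem _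
  | succ d => exact Submodule.mem_top

theorem D_mem_filLength (v : Hat k g) {n : ℕ} {j : ℤ} {a : T k g} (ha : a ∈ filLength k g n j) :
    D circ v a ∈ filLength k g n j := by
  have h : filLength k g n j ≤ (filLength k g n j).comap (D circ v) := by
    refine Submodule.span_le.2 ?_
    rintro _ ⟨f, d, hf, hd, rfl⟩
    change D circ v (word f) ∈ filLength k g n j
    rw [D_apply, der_word]
    refine Submodule.sum_mem _ fun i _ => word_mem_filLength _ d (fun i' => ?_) hd
    by_cases h : i' = i
    · subst h
      rw [Function.update_self]
      exact circHat_mem_filHat circ v (hf _)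
    · rw [Function.update_of_ne h]
      exact hf _
  exact h ha

theorem D_mem_fil (v : Hat k g) {j : ℤ} {a : T k g} (ha : a ∈ fil k g j) :
    D circ v a ∈ fil k g j :=
  fil_induction (N := (fil k g j).comap (D circ v))
    (fun n _ hb => filLength_le_fil n j (D_mem_filLength circ v hb)) ha

/-- A correction term has `t`, of filtration degree `0`, where `a b` has the letter `v`. Since `D_v`
does not raise the filtration, this loses at least one unless `v` is a multiple of `t`, and then
`D_v = 0`. -/
theorem starOf_sub_mul_mem_fil {i : ℤ} {a : T k g} (ha : a ∈ fil k g i) (n : ℕ) (j : ℤ) {b : T k g}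
    (hb : b ∈ filLength k g n j) : starOf circ a b - a * b ∈ fil k g (i + j - 1) := by
  induction n generalizing j b with
  | zero =>
    have h : filLength k g 0 j ≤
        LinearMap.ker (starOf circ a - LinearMap.mulLeft k a) := by
      refine Submodule.span_le.2 ?_
      rintro _ ⟨f, d, hf, hd, rfl⟩
      rw [SetLike.mem_coe, LinearMap.mem_ker, LinearMap.sub_apply, LinearMap.mulLeft_apply,
        word_zero,
        starOf_one, mul_one, sub_self]
    have h2 : starOf circ a b - a * b = 0 := LinearMap.mem_ker.1 (h hb)
    rw [h2]
    exact Submodule.zero_mem _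
  | succ n ih =>
    have h : filLength k g (n + 1) j ≤
        (fil k g (i + j - 1)).comap (starOf circ a - LinearMap.mulLeft k a) := by
      refine Submodule.span_le.2 ?_
      rintro _ ⟨f, d, hf, hd, rfl⟩
      change starOf circ a (word f) - a * word f ∈ fil k g (i + j - 1)
      rw [Fin.sum_univ_castSucc] at hd
      push_cast at hd
      have hb' := word_mem_filLength (Fin.init f : Fin n → Hat k g) (fun i => d i.castSucc)
        (fun i => hf _) le_rfl
      set j' : ℤ := ((∑ i : Fin n, d i.castSucc : ℕ) : ℤ) with hj'
      have h1 := ih j' hb'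
      have hlast := hf (Fin.last n)
      -- Splits the error into the error for the shorter word, multiplied by the last letter, and
      -- the new correction terms.
      have h4 : ∀ p q r s u v : T k g, p * u + q - r - s * (v * u) = (p - s * v) * u + (q - r) :=
        fun p q r s u v => by noncomm_ring
      rw [word_eq_init, starOf_mul_ι, h4]
      have h2 := mul_mem_fil h1 (ι_mem_fil hlast)
      have hsum : (∑ i : Fin n, (d i.castSucc : ℤ)) = j' := by
        rw [hj']; push_cast; rfl
      rw [hsum] at hd
      refine Submodule.add_mem _ (fil_mono (by omega) h2) ?_
      rcases Nat.eq_zero_or_pos (d (Fin.last n)) with h0 | h0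
      · rw [h0] at hlast
        rw [D_eq_zero_of_mem circ hlast]
        simp
      · have h3 : ∀ c ∈ filLength k g n j', starOf circ a c ∈ fil k g (i + j') := fun c hc => by
          rw [← sub_add_cancel (starOf circ a c) (a * c)]
          exact Submodule.add_mem _ (fil_mono (by omega) (ih j' hc))
            (mul_mem_fil ha (filLength_le_fil _ _ hc))
        refine Submodule.sub_mem _
          (fil_mono ?_ (mul_mem_fil (D_mem_fil circ _ (h3 _ hb')) tT_mem_fil))
          (fil_mono ?_ (mul_mem_fil (h3 _ (D_mem_filLength circ _ hb')) tT_mem_fil)) <;> omega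
    exact h hb

theorem starOf_isFilteredDeformation : IsFilteredDeformation (starOf circ) := by
  intro i j a ha b hb
  have h : starOf circ a b - a * b ∈ fil k g (i + j - 1) :=
    fil_induction (N := (fil k g (i + j - 1)).comap (starOf circ a - LinearMap.mulLeft k a))
      (fun n _ hb => starOf_sub_mul_mem_fil circ ha n j hb) hb
  refine ⟨?_, h⟩
  rw [← sub_add_cancel (starOf circ a b) (a * b)]
  exact Submodule.add_mem _ (fil_mono (by omega) h) (mul_mem_fil ha hb)

theorem starDeg_apply (star : T k g →ₗ[k] T k g →ₗ[k] T k g) (m n : ℕ) (x : ⨂[k]^m (Hat k g))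
    (y : ⨂[k]^n (Hat k g)) :
    starDeg star m n x y = toDeg (m + n) (star (ofDeg m x) (ofDeg n y)) := rfl

theorem ofDeg_starDeg_starOf (m n : ℕ) (x : ⨂[k]^m (Hat k g)) (y : ⨂[k]^n (Hat k g)) :
    ofDeg (m + n) (starDeg (starOf circ) m n x y) = starOf circ (ofDeg m x) (ofDeg n y) := by
  rw [starDeg_apply, ofDeg_toDeg (starOf_mem_deg circ (ofDeg_mem _ _) (ofDeg_mem _ _))]

theorem starOf_perm (hc : IsPreLie circ) {m m' n : ℕ} (e : Fin m ≃ Fin m') (τ : Equiv.Perm (Fin n))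
    {a b : T k g} (ha : a ∈ deg k g m) (hb : b ∈ deg k g n) :
    starOf circ (perm e a) (perm τ b) = perm (sumPerm e τ) (starOf circ a b) := by
  have h : sumPerm e τ = (sumPerm (Equiv.refl _) τ).trans (sumPerm e (Equiv.refl _)) := by
    refine Equiv.ext fun i => Fin.addCases (fun i => ?_) (fun i => ?_) i <;> simp [sumPerm]
  rw [starOf_perm_left circ e ha (perm_mem _ _), starOf_perm_right circ hc τ ha hb, perm_perm, h]

theorem starOf_isTwistedAlgebra (hc : IsPreLie circ) : IsTwistedAlgebra (starOf circ) where
  assoc := starOf_assoc circ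
  one_star := one_starOf circ
  star_one := starOf_one circ
  graded m n x y := (ofDeg_starDeg_starOf circ m n x y).symm
  equivariant m n σ τ x y := by
    apply ofDeg_injective
    rw [ofDeg_starDeg_starOf, ← perm_ofDeg, ← perm_ofDeg, ← perm_ofDeg, ofDeg_starDeg_starOf,
      blockPerm_eq_sumPerm, starOf_perm circ hc σ τ (ofDeg_mem _ _) (ofDeg_mem _ _)]

end Conditions

/-! ### Generators and relations of the balanced tensor square -/

section Generators

variable {k g : Type*} [CommRing k] [AddCommGroup g] [Module k g]

theorem preTensor_hom_ext {M : Type*} [AddCommMonoid M] [Module k M] {F G : PreTensor k g →ₗ[k] M}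
    (h : ∀ (m n : ℕ) (σ : Equiv.Perm (Fin (m + n))), F ∘ₗ gen σ = G ∘ₗ gen σ) : F = G := by
  refine DirectSum.linearMap_ext k fun p => ?_
  obtain ⟨m, n⟩ := p
  refine TensorProduct.ext (Finsupp.lhom_ext' fun σ => LinearMap.ext_ring ?_)
  exact h m n σ

/-- The linear map on representatives with given values on the generators. -/
def preTensorLift {M : Type*} [AddCommMonoid M] [Module k M]
    (F : ∀ m n, Equiv.Perm (Fin (m + n)) → (⨂[k]^m (Hat k g) ⊗[k] ⨂[k]^n (Hat k g)) →ₗ[k] M) :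
    PreTensor k g →ₗ[k] M :=
  DirectSum.toModule k (ℕ × ℕ) M fun p => PreInd.lift fun σ => F p.1 p.2 σ

theorem toModule_gen {M : Type*} [AddCommMonoid M] [Module k M]
    (F : ∀ p : ℕ × ℕ, PreInd k g p.1 p.2 →ₗ[k] M) {m n : ℕ} (σ : Equiv.Perm (Fin (m + n)))
    (w : ⨂[k]^m (Hat k g) ⊗[k] ⨂[k]^n (Hat k g)) :
    DirectSum.toModule k (ℕ × ℕ) M F (gen σ w) = F (m, n) (PreInd.mk σ w) :=
  DirectSum.toModule_lof (M := fun p : ℕ × ℕ => PreInd k g p.1 p.2) k (m, n) (PreInd.mk σ w)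

theorem preTensorLift_gen {M : Type*} [AddCommMonoid M] [Module k M]
    (F : ∀ m n, Equiv.Perm (Fin (m + n)) → (⨂[k]^m (Hat k g) ⊗[k] ⨂[k]^n (Hat k g)) →ₗ[k] M)
    {m n : ℕ} (σ : Equiv.Perm (Fin (m + n))) (w : ⨂[k]^m (Hat k g) ⊗[k] ⨂[k]^n (Hat k g)) :
    preTensorLift F (gen σ w) = F m n σ w := by
  rw [preTensorLift, toModule_gen]
  exact PreInd.lift_mk _ _ _

theorem mkQ_gen_mul {m n : ℕ} (σ : Equiv.Perm (Fin (m + n))) (α : Equiv.Perm (Fin m))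
    (β : Equiv.Perm (Fin n)) (u : ⨂[k]^m (Hat k g)) (v : ⨂[k]^n (Hat k g)) :
    (tensorRel k g).mkQ (gen (σ * blockPerm α β) (u ⊗ₜ[k] v)) =
      (tensorRel k g).mkQ (gen σ (act α u ⊗ₜ[k] act β v)) := by
  rw [← sub_eq_zero, ← map_sub, Submodule.mkQ_apply, Submodule.Quotient.mk_eq_zero]
  exact Submodule.subset_span (Or.inl ⟨m, n, σ, α, β, u, v, rfl⟩)

theorem mkQ_gen_t {m n : ℕ} (σ : Equiv.Perm (Fin ((m + 1) + n)))
    (u : ⨂[k]^m (Hat k g)) (v : ⨂[k]^n (Hat k g)) :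
    (tensorRel k g).mkQ (gen σ (concat u (tPow k g) ⊗ₜ[k] v)) =
      (tensorRel k g).mkQ
        (gen ((finCongr (Nat.add_assoc m 1 n)).permCongr σ) (u ⊗ₜ[k] concat (tPow k g) v)) := by
  rw [← sub_eq_zero, ← map_sub, Submodule.mkQ_apply, Submodule.Quotient.mk_eq_zero]
  exact Submodule.subset_span (Or.inr ⟨m, n, σ, u, v, rfl⟩)

end Generators

/-! ### Shuffles, subsets and cosets of the block subgroup -/

section Shuffles

/-- The set of values of a permutation on the first `m` positions. -/
def firstImage {m n : ℕ} (σ : Equiv.Perm (Fin (m + n))) : Finset (Fin (m + n)) :=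
  Finset.univ.image fun i : Fin m => σ (Fin.castAdd n i)

theorem card_firstImage {m n : ℕ} (σ : Equiv.Perm (Fin (m + n))) : (firstImage σ).card = m := by
  rw [firstImage, Finset.card_image_of_injective, Finset.card_univ, Fintype.card_fin]
  exact fun i j h => Fin.castAdd_injective _ _ (σ.injective h)

theorem castAdd_mem_firstImage {m n : ℕ} (σ : Equiv.Perm (Fin (m + n))) (i : Fin m) :
    σ (Fin.castAdd n i) ∈ firstImage σ :=
  Finset.mem_image_of_mem _ (Finset.mem_univ i)

theorem natAdd_notMem_firstImage {m n : ℕ} (σ : Equiv.Perm (Fin (m + n))) (j : Fin n) :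
    σ (Fin.natAdd m j) ∉ firstImage σ := by
  intro h
  obtain ⟨i, -, hi⟩ := Finset.mem_image.1 h
  have := congrArg Fin.val (σ.injective hi)
  simp at this
  omega

theorem mem_shuffles {m n : ℕ} {σ : Equiv.Perm (Fin (m + n))} :
    σ ∈ shuffles m n ↔ StrictMono (fun i : Fin m => σ (Fin.castAdd n i)) ∧
      StrictMono (fun j : Fin n => σ (Fin.natAdd m j)) := by
  rw [shuffles, Finset.mem_filter]
  exact and_iff_right (Finset.mem_univ _)

theorem card_compl_of_card {m n : ℕ} {s : Finset (Fin (m + n))} (hs : s.card = m) :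
    sᶜ.card = n := by
  rw [Finset.card_compl, hs, Fintype.card_fin, Nat.add_sub_cancel_left]

theorem shuffle_eq_of_firstImage_eq {m n : ℕ} {σ τ : Equiv.Perm (Fin (m + n))}
    (hσ : σ ∈ shuffles m n) (hτ : τ ∈ shuffles m n) (h : firstImage σ = firstImage τ) : σ = τ := by
  rw [mem_shuffles] at hσ hτ
  have h1 := Finset.orderEmbOfFin_unique (card_firstImage σ) (castAdd_mem_firstImage σ) hσ.1
  have h2 := Finset.orderEmbOfFin_unique (card_firstImage σ)
    (fun i => h ▸ castAdd_mem_firstImage τ i) hτ.1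
  have h3 := Finset.orderEmbOfFin_unique (card_compl_of_card (card_firstImage σ))
    (fun j => Finset.mem_compl.2 (natAdd_notMem_firstImage σ j)) hσ.2
  have h4 := Finset.orderEmbOfFin_unique (card_compl_of_card (card_firstImage σ))
    (fun j => Finset.mem_compl.2 (h ▸ natAdd_notMem_firstImage τ j)) hτ.2
  refine Equiv.ext fun i => Fin.addCases (fun i => ?_) (fun j => ?_) i
  · exact congrFun (h1.trans h2.symm) i
  · exact congrFun (h3.trans h4.symm) j

theorem exists_shuffle {m n : ℕ} {s : Finset (Fin (m + n))} (hs : s.card = m) :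
    ∃ σ ∈ shuffles m n, firstImage σ = s := by
  have hn := card_compl_of_card hs
  refine ⟨finSumFinEquiv.symm.trans (finSumEquivOfFinset hs hn), mem_shuffles.2 ⟨?_, ?_⟩, ?_⟩
  · simpa using (s.orderEmbOfFin hs).strictMono
  · simpa using (sᶜ.orderEmbOfFin hn).strictMono
  · ext j
    simp only [firstImage, Finset.mem_image, Finset.mem_univ, true_and, Equiv.trans_apply,
      finSumFinEquiv_symm_apply_castAdd, finSumEquivOfFinset_inl]
    have h := Finset.range_orderEmbOfFin s hs
    rw [← Finset.mem_coe, ← h]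
    rfl

theorem sum_shuffles {m n : ℕ} {M : Type*} [AddCommMonoid M] (F : Finset (Fin (m + n)) → M) :
    ∑ σ ∈ shuffles m n, F (firstImage σ) = ∑ s ∈ Finset.powersetCard m Finset.univ, F s := by
  refine Finset.sum_bij (fun σ _ => firstImage σ) (fun σ _ => ?_)
    (fun σ hσ τ hτ h => shuffle_eq_of_firstImage_eq hσ hτ h) (fun s hs => ?_) fun σ _ => rfl
  · exact Finset.mem_powersetCard.2 ⟨Finset.subset_univ _, card_firstImage σ⟩
  · obtain ⟨σ, hσ, h⟩ := exists_shuffle (Finset.mem_powersetCard.1 hs).2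
    exact ⟨σ, hσ, h⟩

/-- A decomposition of `{1,…,N}` is the same as a shuffle. -/
theorem sum_antidiagonal_shuffles {N : ℕ} {M : Type*} [AddCommMonoid M]
    (F : Finset (Fin N) → M) :
    ∑ p ∈ (Finset.HasAntidiagonal.antidiagonal N).attach,
      ∑ σ ∈ shuffles p.1.1 p.1.2, F ((firstImage σ).map
        (finCongr (Finset.HasAntidiagonal.mem_antidiagonal.1 p.2)).toEmbedding) = ∑ s, F s := by
  have h1 : ∀ p : {p // p ∈ Finset.HasAntidiagonal.antidiagonal N},
      ∑ σ ∈ shuffles p.1.1 p.1.2, F ((firstImage σ).map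
        (finCongr (Finset.HasAntidiagonal.mem_antidiagonal.1 p.2)).toEmbedding) =
      ∑ s ∈ Finset.powersetCard p.1.1 Finset.univ, F s := by
    rintro ⟨⟨m, n⟩, hp⟩
    obtain rfl := Finset.HasAntidiagonal.mem_antidiagonal.1 hp
    rw [← sum_shuffles]
    refine Finset.sum_congr rfl fun σ _ => ?_
    congr 1
    ext i
    simp
  rw [Finset.sum_congr rfl fun p _ => h1 p,
    Finset.sum_attach _ (fun p : ℕ × ℕ => ∑ s ∈ Finset.powersetCard p.1 Finset.univ, F s),
    Finset.Nat.sum_antidiagonal_eq_sum_range_succ_mk]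
  have h2 := Finset.sum_powerset (Finset.univ : Finset (Fin N)) F
  rw [Finset.powerset_univ, Finset.card_univ, Fintype.card_fin] at h2
  exact h2.symm

/-- Permutations with the same values on the first block differ by an element of `S_m × S_n`. -/
theorem exists_eq_mul_blockPerm {m n : ℕ} {σ τ : Equiv.Perm (Fin (m + n))}
    (h : firstImage σ = firstImage τ) :
    ∃ (α : Equiv.Perm (Fin m)) (β : Equiv.Perm (Fin n)), σ = τ * blockPerm α β := by
  have h1 : Set.MapsTo (finSumFinEquiv.symm.permCongr (τ⁻¹ * σ)) (Set.range Sum.inl)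
      (Set.range (Sum.inl : Fin m → Fin m ⊕ Fin n)) := by
    rintro _ ⟨i, rfl⟩
    have h2 : σ (Fin.castAdd n i) ∈ firstImage τ := h ▸ castAdd_mem_firstImage σ i
    obtain ⟨j, -, hj⟩ := Finset.mem_image.1 h2
    refine ⟨j, ?_⟩
    simp [Equiv.permCongr_apply, ← hj]
  obtain ⟨⟨α, β⟩, hαβ⟩ := Equiv.Perm.mem_sumCongrHom_range_of_perm_mapsTo_inl h1
  refine ⟨α, β, ?_⟩
  have h3 : blockPerm α β = τ⁻¹ * σ := by
    have h4 : Equiv.sumCongr α β = finSumFinEquiv.symm.permCongr (τ⁻¹ * σ) := hαβ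
    rw [blockPerm, h4]
    ext i
    simp [Equiv.permCongr_apply]
  rw [h3, mul_inv_cancel_left]

end Shuffles

/-! ### Sums over decompositions of a word into two subwords -/

section Split

variable {k g h : Type*} [CommRing k] [AddCommGroup g] [Module k g] [AddCommGroup h] [Module k h]

/-- The analogue of `comulPiece` for two linear maps `A`, `B` applied to the letters of the two
factors. -/
def splitPiece (A B : Hat k h →ₗ[k] Hat k g) (m n : ℕ) :
    ⨂[k]^(m + n) (Hat k h) →ₗ[k] PreTensor k g :=
  ∑ σ ∈ shuffles m n,
    gen σ ∘ₗ
      TensorProduct.map (PiTensorProduct.map fun _ : Fin m => A)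
        (PiTensorProduct.map fun _ : Fin n => B) ∘ₗ
        (TensorPower.mulEquiv (R := k) (M := Hat k h) (n := m) (m := n)).symm.toLinearMap ∘ₗ
          act σ⁻¹

/-- The sum over all the decompositions of a word into two subwords, to the letters of which `A`
and `B` are applied. -/
def split (A B : Hat k h →ₗ[k] Hat k g) : T k h →ₗ[k] PreTensor k g :=
  degMap fun N => ∑ p ∈ Finset.HasAntidiagonal.antidiagonal N,
    splitPiece A B p.1 p.2 ∘ₗ
      DirectSum.component k ℕ (fun n => ⨂[k]^n (Hat k h)) (p.1 + p.2) ∘ₗ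
        DirectSum.lof k ℕ (fun n => ⨂[k]^n (Hat k h)) N

theorem comulPiece_eq_splitPiece (m n : ℕ) :
    comulPiece m n = splitPiece (LinearMap.id : Hat k g →ₗ[k] Hat k g) (killT k g) m n := by
  rw [comulPiece, splitPiece, PiTensorProduct.map_id]

theorem preComul_eq_split :
    preComul k g = split (LinearMap.id : Hat k g →ₗ[k] Hat k g) (killT k g) := by
  simp only [split, ← comulPiece_eq_splitPiece]
  rfl

theorem mulEquiv_symm_tprod {m n : ℕ} (f : Fin (m + n) → Hat k g) :
    TensorPower.mulEquiv.symm (PiTensorProduct.tprod k f) =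
      (PiTensorProduct.tprod k fun i => f (Fin.castAdd n i)) ⊗ₜ[k]
        PiTensorProduct.tprod k fun j => f (Fin.natAdd m j) := by
  rw [LinearEquiv.symm_apply_eq]
  have h1 := TensorPower.tprod_mul_tprod k (fun i => f (Fin.castAdd n i))
    (fun j => f (Fin.natAdd m j))
  rw [Fin.append_castAdd_natAdd] at h1
  exact h1.symm

theorem act_tprod {n : ℕ} (σ : Equiv.Perm (Fin n)) (f : Fin n → Hat k g) :
    act σ (PiTensorProduct.tprod k f) = PiTensorProduct.tprod k (fun i => f (σ⁻¹ i)) :=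
  PiTensorProduct.reindex_tprod σ f

theorem splitPiece_tprod (A B : Hat k h →ₗ[k] Hat k g) {m n : ℕ} (f : Fin (m + n) → Hat k h) :
    splitPiece A B m n (PiTensorProduct.tprod k f) =
      ∑ σ ∈ shuffles m n,
        gen σ ((PiTensorProduct.tprod k fun i => A (f (σ (Fin.castAdd n i)))) ⊗ₜ[k]
          PiTensorProduct.tprod k fun j => B (f (σ (Fin.natAdd m j)))) := by
  rw [splitPiece, LinearMap.sum_apply]
  refine Finset.sum_congr rfl fun σ _ => ?_
  rw [LinearMap.comp_apply, LinearMap.comp_apply, LinearMap.comp_apply, act_tprod,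
    LinearEquiv.coe_coe, mulEquiv_symm_tprod, TensorProduct.map_tmul, PiTensorProduct.map_tprod,
    PiTensorProduct.map_tprod, inv_inv]

theorem component_lof_tprod {M N : ℕ} (hMN : M = N) (f : Fin N → Hat k g) :
    DirectSum.component k ℕ (fun n => ⨂[k]^n (Hat k g)) M
        (DirectSum.lof k ℕ (fun n => ⨂[k]^n (Hat k g)) N (PiTensorProduct.tprod k f)) =
      PiTensorProduct.tprod k fun i => f (finCongr hMN i) := by
  subst hMN
  rw [DirectSum.component.lof_self]
  rfl

theorem split_word (A B : Hat k h →ₗ[k] Hat k g) {N : ℕ} (f : Fin N → Hat k h) :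
    split A B (word f) = ∑ p ∈ (Finset.HasAntidiagonal.antidiagonal N).attach,
      ∑ σ ∈ shuffles p.1.1 p.1.2,
        gen σ ((PiTensorProduct.tprod k fun i =>
            A (f (finCongr (Finset.HasAntidiagonal.mem_antidiagonal.1 p.2)
              (σ (Fin.castAdd p.1.2 i))))) ⊗ₜ[k]
          PiTensorProduct.tprod k fun j =>
            B (f (finCongr (Finset.HasAntidiagonal.mem_antidiagonal.1 p.2)
              (σ (Fin.natAdd p.1.1 j))))) := by
  rw [split, degMap_word, LinearMap.sum_apply, ← Finset.sum_attach]
  refine Finset.sum_congr rfl fun p _ => ?_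
  rw [LinearMap.comp_apply, LinearMap.comp_apply,
    component_lof_tprod (Finset.HasAntidiagonal.mem_antidiagonal.1 p.2), splitPiece_tprod]

end Split

/-! ### Comparison with the tensor algebra on `g × g` -/

section Double

variable {k g : Type*} [CommRing k] [AddCommGroup g] [Module k g]

variable (k g)

/-- The map `ĝ → (g × g)^` given by the first inclusion. -/
def inc₁ : Hat k g →ₗ[k] Hat k (g × g) := LinearMap.prodMap (LinearMap.inl k g g) LinearMap.id

/-- The map `ĝ → (g × g)^` given by the second inclusion. -/
def inc₂ : Hat k g →ₗ[k] Hat k (g × g) := LinearMap.prodMap (LinearMap.inr k g g) LinearMap.id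

/-- The map `ĝ → (g × g)^` given by the diagonal. -/
def diag : Hat k g →ₗ[k] Hat k (g × g) :=
  LinearMap.prodMap (LinearMap.prod LinearMap.id LinearMap.id) LinearMap.id

/-- The retraction `(g × g)^ → ĝ` given by the first projection. -/
def prj₁ : Hat k (g × g) →ₗ[k] Hat k g := LinearMap.prodMap (LinearMap.fst k g g) LinearMap.id

/-- The map `(g × g)^ → Σg` given by the second projection. -/
def prj₂ : Hat k (g × g) →ₗ[k] Hat k g :=
  LinearMap.inl k g k ∘ₗ LinearMap.snd k g g ∘ₗ LinearMap.fst k (g × g) k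

/-- The comparison map from the representatives of `T_k ĝ ⊗_{𝕊,k[t]} T_k ĝ` to `T_k (g × g)^`. -/
def Phi : PreTensor k g →ₗ[k] T k (g × g) :=
  preTensorLift fun m n σ => perm σ ∘ₗ TensorProduct.lift
    ((LinearMap.mul k (T k (g × g))).compl₁₂ ((mapT (inc₁ k g)).toLinearMap ∘ₗ ofDeg m)
      ((mapT (inc₂ k g)).toLinearMap ∘ₗ ofDeg n))

variable {k g}

theorem Phi_gen {m n : ℕ} (σ : Equiv.Perm (Fin (m + n))) (u : ⨂[k]^m (Hat k g))
    (v : ⨂[k]^n (Hat k g)) :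
    Phi k g (gen σ (u ⊗ₜ[k] v)) =
      perm σ (mapT (inc₁ k g) (ofDeg m u) * mapT (inc₂ k g) (ofDeg n v)) := by
  rw [Phi, preTensorLift_gen]
  rfl

theorem mapT_ofDeg_mem {h : Type*} [AddCommGroup h] [Module k h] (φ : Hat k g →ₗ[k] Hat k h)
    {n : ℕ} (u : ⨂[k]^n (Hat k g)) : mapT φ (ofDeg n u) ∈ deg k h n :=
  mapT_mem_deg φ (ofDeg_mem n u)

theorem Phi_gen_mul {m n : ℕ} (σ : Equiv.Perm (Fin (m + n))) (α : Equiv.Perm (Fin m))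
    (β : Equiv.Perm (Fin n)) (u : ⨂[k]^m (Hat k g)) (v : ⨂[k]^n (Hat k g)) :
    Phi k g (gen (σ * blockPerm α β) (u ⊗ₜ[k] v)) =
      Phi k g (gen σ (act α u ⊗ₜ[k] act β v)) := by
  rw [Phi_gen, Phi_gen, ← perm_ofDeg, ← perm_ofDeg, mapT_perm, mapT_perm,
    perm_mul _ _ (mapT_ofDeg_mem _ u) (mapT_ofDeg_mem _ v), perm_perm]
  rfl

theorem perm_permCongr {M N : ℕ} (hMN : M = N) (σ : Equiv.Perm (Fin M)) :
    (perm ((finCongr hMN).permCongr σ) : T k g →ₗ[k] T k g) = perm σ := by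
  subst hMN
  congr 1

theorem ofDeg_tPow : ofDeg 1 (tPow k g) = tT k g := by
  rw [tPow, ofDeg_tprod, word_one, tT]

theorem inc₁_tHat : inc₁ k g (tHat k g) = tHat k (g × g) := rfl

theorem inc₂_tHat : inc₂ k g (tHat k g) = tHat k (g × g) := rfl

theorem Phi_gen_t {m n : ℕ} (σ : Equiv.Perm (Fin ((m + 1) + n)))
    (u : ⨂[k]^m (Hat k g)) (v : ⨂[k]^n (Hat k g)) :
    Phi k g (gen σ (concat u (tPow k g) ⊗ₜ[k] v)) =
      Phi k g
        (gen ((finCongr (Nat.add_assoc m 1 n)).permCongr σ) (u ⊗ₜ[k] concat (tPow k g) v)) := by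
  rw [Phi_gen, Phi_gen, perm_permCongr, ofDeg_concat, ofDeg_concat, map_mul (mapT _),
    map_mul (mapT _), ofDeg_tPow,
    mapT_tT _ inc₁_tHat, mapT_tT _ inc₂_tHat, mul_assoc]

/-- Both families of relations are respected: block permutations act separately on the two
concatenated words, and the two inclusions of letters agree on `t`. -/
theorem Phi_eq_of_mkQ_eq {A B : PreTensor k g}
    (h : (tensorRel k g).mkQ A = (tensorRel k g).mkQ B) : Phi k g A = Phi k g B := by
  have h1 : tensorRel k g ≤ LinearMap.ker (Phi k g) := by
    refine Submodule.span_le.2 ?_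
    rintro z (⟨m, n, σ, α, β, u, v, rfl⟩ | ⟨m, n, σ, u, v, rfl⟩)
    · rw [SetLike.mem_coe, LinearMap.mem_ker, map_sub, Phi_gen_mul, sub_self]
    · rw [SetLike.mem_coe, LinearMap.mem_ker, map_sub, Phi_gen_t, sub_self]
  rw [← sub_eq_zero, ← map_sub, Submodule.mkQ_apply, Submodule.Quotient.mk_eq_zero] at h
  have h2 := LinearMap.mem_ker.1 (h1 h)
  rwa [map_sub, sub_eq_zero] at h2

theorem Phi_gen_tprod {m n : ℕ} (σ : Equiv.Perm (Fin (m + n))) (a b : Fin (m + n) → Hat k g) :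
    Phi k g (gen σ ((PiTensorProduct.tprod k fun i => a (σ (Fin.castAdd n i))) ⊗ₜ[k]
      PiTensorProduct.tprod k fun j => b (σ (Fin.natAdd m j)))) =
    word ((firstImage σ).piecewise (fun j => inc₁ k g (a j)) fun j => inc₂ k g (b j)) := by
  rw [Phi_gen, ofDeg_tprod, ofDeg_tprod, mapT_word, mapT_word, ← word_append, perm_word]
  congr 1
  funext j
  obtain ⟨i, rfl⟩ := σ.surjective j
  rw [Function.comp_apply, Equiv.symm_apply_apply]
  refine Fin.addCases (fun i => ?_) (fun i => ?_) i
  · rw [Fin.append_left, Finset.piecewise_eq_of_mem _ _ _ (castAdd_mem_firstImage σ i)]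
  · rw [Fin.append_right, Finset.piecewise_eq_of_notMem _ _ _ (natAdd_notMem_firstImage σ i)]

/-- Expanding the word with letters `inc₁ (A v) + inc₂ (B v)` by multilinearity gives one term for
each subset of the positions, and subsets correspond to shuffles. -/
theorem Phi_split {h : Type*} [AddCommGroup h] [Module k h] (A B : Hat k h →ₗ[k] Hat k g)
    (a : T k h) : Phi k g (split A B a) = mapT (inc₁ k g ∘ₗ A + inc₂ k g ∘ₗ B) a := by
  refine LinearMap.congr_fun (f := Phi k g ∘ₗ split A B)
    (g := (mapT (inc₁ k g ∘ₗ A + inc₂ k g ∘ₗ B)).toLinearMap) (hom_ext_word fun N f => ?_) a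
  rw [LinearMap.comp_apply, split_word, map_sum, AlgHom.toLinearMap_apply, mapT_word]
  have h1 := (TensorAlgebra.tprod k (Hat k (g × g)) N).map_add_univ
    (fun j => inc₁ k g (A (f j))) (fun j => inc₂ k g (B (f j)))
  simp only [← word_eq_tprod] at h1
  refine Eq.trans ?_ h1.symm
  rw [← sum_antidiagonal_shuffles]
  refine Finset.sum_congr rfl fun p _ => ?_
  obtain ⟨⟨m, n⟩, hp⟩ := p
  obtain rfl := Finset.HasAntidiagonal.mem_antidiagonal.1 hp
  rw [map_sum]
  refine Finset.sum_congr rfl fun σ _ => ?_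
  refine (Phi_gen_tprod σ (fun j => A (f j)) (fun j => B (f j))).trans ?_
  congr 2
  ext i
  simp

/-- On letters `inc₁ + inc₂ ∘ killT` is the diagonal; killing `t` in the second summand prevents it
from being counted twice. -/
theorem Phi_preComul (a : T k g) : Phi k g (preComul k g a) = mapT (diag k g) a := by
  rw [preComul_eq_split, Phi_split]
  congr 2
  refine LinearMap.ext fun v => ?_
  simp [inc₁, inc₂, diag, killT, LinearMap.prodMap_apply]

end Double

/-! ### Injectivity of the comparison map -/

section Injectivity

variable {k g : Type*} [CommRing k] [AddCommGroup g] [Module k g]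

theorem span_letters :
    Submodule.span k (Set.range (Subtype.val : {v : Hat k g // v.2 = 0 ∨ v = tHat k g} → Hat k g)) =
      ⊤ := by
  rw [eq_top_iff]
  rintro ⟨x, c⟩ -
  have h : ((x, c) : Hat k g) = (x, 0) + c • tHat k g := by simp [tHat]
  rw [h]
  exact Submodule.add_mem _ (Submodule.subset_span ⟨⟨(x, 0), Or.inl rfl⟩, rfl⟩)
    (Submodule.smul_mem _ _ (Submodule.subset_span ⟨⟨tHat k g, Or.inr rfl⟩, rfl⟩))

/-- Linear maps on a tensor power may be compared on words in the letters in `Σg` and `t`. -/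
theorem hom_ext_letters {n : ℕ} {M : Type*} [AddCommMonoid M] [Module k M]
    {F G : ⨂[k]^n (Hat k g) →ₗ[k] M}
    (h : ∀ f : Fin n → Hat k g, (∀ i, (f i).2 = 0 ∨ f i = tHat k g) →
      F (PiTensorProduct.tprod k f) = G (PiTensorProduct.tprod k f)) : F = G :=
  PiTensorProduct.ext_of_span_eq_top
    (g := fun _ (v : {v : Hat k g // v.2 = 0 ∨ v = tHat k g}) => v.1) (fun _ => span_letters)
    fun j => h _ fun i => (j i).2

/-- In the induced module only the coset of the permutation matters, and the coset is the set of
positions given to the first factor. -/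
theorem mkQ_gen_eq_of_firstImage_eq {m n : ℕ} {σ τ : Equiv.Perm (Fin (m + n))}
    (h : firstImage σ = firstImage τ) (a b : Fin (m + n) → Hat k g) :
    (tensorRel k g).mkQ (gen σ ((PiTensorProduct.tprod k fun i => a (σ (Fin.castAdd n i))) ⊗ₜ[k]
      PiTensorProduct.tprod k fun j => b (σ (Fin.natAdd m j)))) =
    (tensorRel k g).mkQ (gen τ ((PiTensorProduct.tprod k fun i => a (τ (Fin.castAdd n i))) ⊗ₜ[k]
      PiTensorProduct.tprod k fun j => b (τ (Fin.natAdd m j)))) := by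
  obtain ⟨α, β, rfl⟩ := exists_eq_mul_blockPerm h
  rw [mkQ_gen_mul, act_tprod, act_tprod]
  congr 6
  · funext i
    rw [Equiv.Perm.mul_apply, blockPerm_eq_sumPerm, sumPerm_castAdd]
    exact congrArg (fun x => a (τ (Fin.castAdd n x))) (α.apply_symm_apply i)
  · funext i
    rw [Equiv.Perm.mul_apply, blockPerm_eq_sumPerm, sumPerm_natAdd]
    exact congrArg (fun x => b (τ (Fin.natAdd m x))) (β.apply_symm_apply i)

theorem gen_eq_zero_of_firstImage_ne {m n N : ℕ} (hN : m + n = N) (σ : Equiv.Perm (Fin (m + n)))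
    {S : Finset (Fin N)} {a b : Fin N → Hat k g} (ha : ∀ j ∉ S, a j = 0) (hb : ∀ j ∈ S, b j = 0)
    (hne : (firstImage σ).map (finCongr hN).toEmbedding ≠ S) :
    gen σ ((PiTensorProduct.tprod k fun i => a (finCongr hN (σ (Fin.castAdd n i)))) ⊗ₜ[k]
      PiTensorProduct.tprod k fun j => b (finCongr hN (σ (Fin.natAdd m j)))) = 0 := by
  subst hN
  by_cases h1 : ∃ i, σ (Fin.castAdd n i) ∉ S
  · obtain ⟨i, hi⟩ := h1
    rw [MultilinearMap.map_coord_zero _ i (ha _ hi), TensorProduct.zero_tmul, map_zero]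
  by_cases h2 : ∃ j, σ (Fin.natAdd m j) ∈ S
  · obtain ⟨j, hj⟩ := h2
    rw [MultilinearMap.map_coord_zero (PiTensorProduct.tprod k) j (hb _ hj),
      TensorProduct.tmul_zero, map_zero]
  push Not at h1 h2
  refine absurd ?_ hne
  ext j
  obtain ⟨i, rfl⟩ := σ.surjective j
  refine Fin.addCases (fun i => ?_) (fun i => ?_) i
  · simpa [h1 i] using castAdd_mem_firstImage σ i
  · simpa [h2 i] using natAdd_notMem_firstImage σ i

/-- Each letter is killed by `A` or by `B` according to its position, so among all decompositions
only the one prescribed by `σ` survives. -/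
theorem mkQ_split_word {h : Type*} [AddCommGroup h] [Module k h] (A B : Hat k h →ₗ[k] Hat k g)
    {m n : ℕ} (σ : Equiv.Perm (Fin (m + n))) (w : Fin (m + n) → Hat k h)
    (hA : ∀ j ∉ firstImage σ, A (w j) = 0) (hB : ∀ j ∈ firstImage σ, B (w j) = 0) :
    (tensorRel k g).mkQ (split A B (word w)) =
    (tensorRel k g).mkQ (gen σ
      ((PiTensorProduct.tprod k fun i => A (w (σ (Fin.castAdd n i)))) ⊗ₜ[k]
        PiTensorProduct.tprod k fun j => B (w (σ (Fin.natAdd m j))))) := by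
  obtain ⟨τ, hτ, hτσ⟩ := exists_shuffle (card_firstImage σ)
  have hmem : (m, n) ∈ Finset.HasAntidiagonal.antidiagonal (m + n) :=
    Finset.HasAntidiagonal.mem_antidiagonal.2 rfl
  rw [split_word, Finset.sum_eq_single_of_mem ⟨(m, n), hmem⟩ (Finset.mem_attach _ _),
    Finset.sum_eq_single_of_mem τ hτ]
  · exact mkQ_gen_eq_of_firstImage_eq hτσ (fun j => A (w j)) fun j => B (w j)
  · intro τ' hτ' hne
    refine gen_eq_zero_of_firstImage_ne (m := m) (n := n)
      (Finset.HasAntidiagonal.mem_antidiagonal.1 hmem) τ'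
      (a := fun j => A (w j)) (b := fun j => B (w j)) hA hB fun h => hne ?_
    refine shuffle_eq_of_firstImage_eq hτ' hτ (Eq.trans ?_ (h.trans hτσ.symm))
    ext i
    simp
  · rintro ⟨⟨m', n'⟩, hp⟩ - hne
    refine Finset.sum_eq_zero fun τ' _ => ?_
    refine gen_eq_zero_of_firstImage_ne (m := m') (n := n')
      (Finset.HasAntidiagonal.mem_antidiagonal.1 hp) τ'
      (a := fun j => A (w j)) (b := fun j => B (w j)) hA hB fun h => hne ?_
    have h1 := congrArg Finset.card h
    rw [Finset.card_map, card_firstImage, card_firstImage] at h1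
    subst h1
    have h2 := Finset.HasAntidiagonal.mem_antidiagonal.1 hp
    obtain rfl : n' = n := by simpa using h2
    rfl

theorem prj₁_inc₁ (v : Hat k g) : prj₁ k g (inc₁ k g v) = v := rfl

theorem prj₁_inc₂ {v : Hat k g} (hv : v.2 = 0) : prj₁ k g (inc₂ k g v) = 0 :=
  Prod.ext rfl hv

theorem prj₂_inc₁ (v : Hat k g) : prj₂ k g (inc₁ k g v) = 0 := rfl

theorem prj₂_inc₂ {v : Hat k g} (hv : v.2 = 0) : prj₂ k g (inc₂ k g v) = v :=
  Prod.ext rfl hv.symm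

theorem mkQ_split_Phi_gen {m n : ℕ} (σ : Equiv.Perm (Fin (m + n))) (a b : Fin (m + n) → Hat k g)
    (hb : ∀ i, (b i).2 = 0) :
    (tensorRel k g).mkQ (split (prj₁ k g) (prj₂ k g)
      (Phi k g (gen σ ((PiTensorProduct.tprod k fun i => a (σ (Fin.castAdd n i))) ⊗ₜ[k]
        PiTensorProduct.tprod k fun j => b (σ (Fin.natAdd m j)))))) =
    (tensorRel k g).mkQ (gen σ ((PiTensorProduct.tprod k fun i => a (σ (Fin.castAdd n i))) ⊗ₜ[k]
      PiTensorProduct.tprod k fun j => b (σ (Fin.natAdd m j)))) := by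
  rw [Phi_gen_tprod]
  obtain ⟨w, hw⟩ : ∃ w, w = (firstImage σ).piecewise (fun j => inc₁ k g (a j))
    fun j => inc₂ k g (b j) := ⟨_, rfl⟩
  have hw1 : ∀ j ∈ firstImage σ, w j = inc₁ k g (a j) := fun j hj => by
    rw [hw, Finset.piecewise_eq_of_mem _ _ _ hj]
  have hw2 : ∀ j ∉ firstImage σ, w j = inc₂ k g (b j) := fun j hj => by
    rw [hw, Finset.piecewise_eq_of_notMem _ _ _ hj]
  have h1 : (fun i => prj₁ k g (w (σ (Fin.castAdd n i)))) = fun i => a (σ (Fin.castAdd n i)) :=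
    funext fun i => by rw [hw1 _ (castAdd_mem_firstImage σ i), prj₁_inc₁]
  have h2 : (fun i => prj₂ k g (w (σ (Fin.natAdd m i)))) = fun i => b (σ (Fin.natAdd m i)) :=
    funext fun i => by rw [hw2 _ (natAdd_notMem_firstImage σ i), prj₂_inc₂ (hb _)]
  rw [← hw, mkQ_split_word _ _ σ w, h1, h2]
  · exact fun j hj => by rw [hw2 j hj, prj₁_inc₂ (hb _)]
  · exact fun j hj => by rw [hw1 j hj, prj₂_inc₁]

/-- The comparison map is injective on `T_k ĝ ⊗_{𝕊,k[t]} T_k ĝ`. -/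
theorem mkQ_split_Phi (A : PreTensor k g) :
    (tensorRel k g).mkQ (split (prj₁ k g) (prj₂ k g) (Phi k g A)) = (tensorRel k g).mkQ A := by
  refine LinearMap.congr_fun (f := (tensorRel k g).mkQ ∘ₗ split (prj₁ k g) (prj₂ k g) ∘ₗ Phi k g)
    (g := (tensorRel k g).mkQ) (preTensor_hom_ext fun m n σ => ?_) A
  refine TensorProduct.ext' fun u v => ?_
  induction n using Nat.strong_induction_on generalizing m with
  | _ n ih =>
  refine LinearMap.congr_fun
    (f := ((tensorRel k g).mkQ ∘ₗ split (prj₁ k g) (prj₂ k g) ∘ₗ Phi k g) ∘ₗ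
      gen σ ∘ₗ TensorProduct.mk k _ _ u)
    (g := (tensorRel k g).mkQ ∘ₗ gen σ ∘ₗ TensorProduct.mk k _ _ u)
    (hom_ext_letters fun f' hf' => ?_) v
  simp only [LinearMap.comp_apply, TensorProduct.mk_apply] at ih ⊢
  by_cases h : ∀ i, (f' i).2 = 0
  · refine LinearMap.congr_fun
      (f := ((tensorRel k g).mkQ ∘ₗ split (prj₁ k g) (prj₂ k g) ∘ₗ Phi k g) ∘ₗ
      gen σ ∘ₗ (TensorProduct.mk k _ _).flip (PiTensorProduct.tprod k f'))
      (g := (tensorRel k g).mkQ ∘ₗ gen σ ∘ₗ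
        (TensorProduct.mk k _ _).flip (PiTensorProduct.tprod k f'))
      (PiTensorProduct.ext (MultilinearMap.ext fun f => ?_)) u
    simp only [LinearMap.comp_apply, LinearMap.flip_apply, TensorProduct.mk_apply,
      LinearMap.compMultilinearMap_apply]
    -- The letters of the two factors are extended by zero to all positions, since
    -- `mkQ_split_Phi_gen` takes families indexed by all of `Fin (m + n)`.
    have key := mkQ_split_Phi_gen σ (fun j => Fin.append f (0 : Fin n → Hat k g) (σ⁻¹ j))
      (fun j => Fin.append (0 : Fin m → Hat k g) f' (σ⁻¹ j)) fun j => by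
        refine Fin.addCases (fun i => ?_) (fun i => ?_) (σ⁻¹ j)
        · simp
        · simpa using h i
    simpa using key
  · push Not at h
    obtain ⟨i, hi⟩ := h
    have hit := (hf' i).resolve_left hi
    -- The second factor contains a `t`. The transposition `τ` brings it to the front, and the
    -- balancing relation moves it into the first factor, which shortens the second one.
    obtain ⟨n', rfl⟩ : ∃ n', n = 1 + n' := ⟨n - 1, by have := i.pos; omega⟩
    set τ : Equiv.Perm (Fin (1 + n')) := Equiv.swap i (Fin.castAdd n' 0) with hτ
    have h1 : PiTensorProduct.tprod k f' = act τ (concat (tPow k g)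
        (PiTensorProduct.tprod k fun j => f' (τ (Fin.natAdd 1 j)))) := by
      have h2 : concat (tPow k g) (PiTensorProduct.tprod k fun j => f' (τ (Fin.natAdd 1 j))) =
          PiTensorProduct.tprod k (Fin.append (fun _ => tHat k g)
            fun j => f' (τ (Fin.natAdd 1 j))) := TensorPower.tprod_mul_tprod k _ _
      rw [h2, act_tprod]
      congr 1
      funext j
      obtain ⟨l, rfl⟩ := τ.surjective j
      rw [show τ⁻¹ (τ l) = l from τ.symm_apply_apply l]
      refine Fin.addCases (fun l => ?_) (fun l => ?_) l
      · rw [Subsingleton.elim l 0, hτ, Equiv.swap_apply_right, Fin.append_left, hit]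
      · rw [Fin.append_right]
    have h3 : ∀ u : ⨂[k]^m (Hat k g), act 1 u = u := by
      have h4 : act (1 : Equiv.Perm (Fin m)) = (LinearMap.id : ⨂[k]^m (Hat k g) →ₗ[k] _) := by
        refine PiTensorProduct.ext (MultilinearMap.ext fun f => ?_)
        exact act_tprod 1 f
      exact fun u => LinearMap.congr_fun h4 u
    obtain ⟨v', hv'⟩ : ∃ v', v' = PiTensorProduct.tprod k fun j => f' (τ (Fin.natAdd 1 j)) :=
      ⟨_, rfl⟩
    have h5 : ∀ ρ : Equiv.Perm (Fin (m + (1 + n'))), ∃ ρ' : Equiv.Perm (Fin ((m + 1) + n')),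
        (finCongr (Nat.add_assoc m 1 n')).permCongr ρ' = ρ := fun ρ =>
      ⟨(finCongr (Nat.add_assoc m 1 n')).permCongr.symm ρ, Equiv.apply_symm_apply _ _⟩
    obtain ⟨ρ, hρ⟩ := h5 (σ * blockPerm 1 τ)
    have h6 := Phi_gen_mul σ 1 τ u (concat (tPow k g) v')
    have h7 := mkQ_gen_mul σ 1 τ u (concat (tPow k g) v')
    rw [h3, ← hρ] at h6 h7
    rw [h1, ← hv', ← h6, ← h7, ← Phi_gen_t, ← mkQ_gen_t]
    exact ih n' (by omega) (m + 1) ρ _ _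

theorem mkQ_eq_iff {A B : PreTensor k g} :
    (tensorRel k g).mkQ A = (tensorRel k g).mkQ B ↔ Phi k g A = Phi k g B :=
  ⟨Phi_eq_of_mkQ_eq, fun h => by rw [← mkQ_split_Phi A, h, mkQ_split_Phi]⟩

end Injectivity

/-! ### The componentwise operation on `g × g` -/

section Square

variable {k g : Type*} [CommRing k] [AddCommGroup g] [Module k g]

/-- The componentwise operation on `g × g`. -/
def circSq (circ : g →ₗ[k] g →ₗ[k] g) : g × g →ₗ[k] g × g →ₗ[k] g × g :=
  (circ.compl₁₂ (LinearMap.fst k g g) (LinearMap.fst k g g)).compr₂ (LinearMap.inl k g g) +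
    (circ.compl₁₂ (LinearMap.snd k g g) (LinearMap.snd k g g)).compr₂ (LinearMap.inr k g g)

variable (circ : g →ₗ[k] g →ₗ[k] g)

theorem circSq_apply (x y : g × g) : circSq circ x y = (circ x.1 y.1, circ x.2 y.2) := by
  simp [circSq]

theorem circSq_isPreLie (hc : IsPreLie circ) : IsPreLie (circSq circ) := by
  intro x y z
  simp only [circSq_apply, Prod.mk_sub_mk]
  rw [hc x.1, hc x.2]

theorem inc₁_circHat (v u : Hat k g) :
    inc₁ k g (circHat circ v u) = circHat (circSq circ) (inc₁ k g v) (inc₁ k g u) := by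
  simp [inc₁, circHat_apply, circSq_apply, LinearMap.prodMap_apply]

theorem inc₂_circHat (v u : Hat k g) :
    inc₂ k g (circHat circ v u) = circHat (circSq circ) (inc₂ k g v) (inc₂ k g u) := by
  simp [inc₂, circHat_apply, circSq_apply, LinearMap.prodMap_apply]

theorem diag_circHat (v u : Hat k g) :
    diag k g (circHat circ v u) = circHat (circSq circ) (diag k g v) (diag k g u) := by
  simp [diag, circHat_apply, circSq_apply, LinearMap.prodMap_apply]

theorem diag_tHat : diag k g (tHat k g) = tHat k (g × g) := rfl

theorem mapT_inc₁_starOf (a b : T k g) : mapT (inc₁ k g) (starOf circ a b) =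
    starOf (circSq circ) (mapT (inc₁ k g) a) (mapT (inc₁ k g) b) :=
  mapT_starOf _ (inc₁_circHat circ) inc₁_tHat a b

theorem mapT_inc₂_starOf (a b : T k g) : mapT (inc₂ k g) (starOf circ a b) =
    starOf (circSq circ) (mapT (inc₂ k g) a) (mapT (inc₂ k g) b) :=
  mapT_starOf _ (inc₂_circHat circ) inc₂_tHat a b

theorem D_zero (v : Hat k g) (a : T k g) : D (0 : g →ₗ[k] g →ₗ[k] g) v a = 0 := by
  have h : circHat (0 : g →ₗ[k] g →ₗ[k] g) v = 0 := LinearMap.ext fun u => by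
    rw [circHat_apply]
    simp
  rw [D, LinearMap.comp_apply, h, map_zero, LinearMap.zero_apply]

theorem D_inc₂_mapT_inc₁ (v : Hat k g) (a : T k g) :
    D (circSq circ) (inc₂ k g v) (mapT (inc₁ k g) a) = 0 := by
  rw [← mapT_D (inc₁ k g) (circ := 0) (v := v), D_zero, map_zero]
  intro u
  simp [inc₁, inc₂, circHat_apply, circSq_apply, LinearMap.prodMap_apply]

theorem D_inc₁_mapT_inc₂ (v : Hat k g) (a : T k g) :
    D (circSq circ) (inc₁ k g v) (mapT (inc₂ k g) a) = 0 := by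
  rw [← mapT_D (inc₂ k g) (circ := 0) (v := v), D_zero, map_zero]
  intro u
  simp [inc₁, inc₂, circHat_apply, circSq_apply, LinearMap.prodMap_apply]

/-- Letters from different copies of `g` have product zero, so no correction term appears. -/
theorem starOf_inc₁_inc₂ (a b : T k g) :
    starOf (circSq circ) (mapT (inc₁ k g) a) (mapT (inc₂ k g) b) =
      mapT (inc₁ k g) a * mapT (inc₂ k g) b := by
  refine LinearMap.congr_fun (f := starOf (circSq circ) (mapT (inc₁ k g) a) ∘ₗ
    (mapT (inc₂ k g)).toLinearMap) (g := LinearMap.mulLeft k (mapT (inc₁ k g) a) ∘ₗ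
      (mapT (inc₂ k g)).toLinearMap) (hom_ext_word fun n f => ?_) b
  simp only [LinearMap.comp_apply, AlgHom.toLinearMap_apply, mapT_word, LinearMap.mulLeft_apply]
  refine starOf_eq_mul _ (LinearMap.range (inc₂ k g)) ?_ ?_ _ fun i => LinearMap.mem_range_self _ _
  · rintro _ ⟨v, rfl⟩ _ ⟨w, rfl⟩
    exact ⟨_, inc₂_circHat circ v w⟩
  · rintro _ ⟨v, rfl⟩
    exact D_inc₂_mapT_inc₁ circ v a

theorem starOf_inc₂_inc₁ (a b : T k g) :
    starOf (circSq circ) (mapT (inc₂ k g) a) (mapT (inc₁ k g) b) =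
      mapT (inc₂ k g) a * mapT (inc₁ k g) b := by
  refine LinearMap.congr_fun (f := starOf (circSq circ) (mapT (inc₂ k g) a) ∘ₗ
    (mapT (inc₁ k g)).toLinearMap) (g := LinearMap.mulLeft k (mapT (inc₂ k g) a) ∘ₗ
      (mapT (inc₁ k g)).toLinearMap) (hom_ext_word fun n f => ?_) b
  simp only [LinearMap.comp_apply, AlgHom.toLinearMap_apply, mapT_word, LinearMap.mulLeft_apply]
  refine starOf_eq_mul _ (LinearMap.range (inc₁ k g)) ?_ ?_ _ fun i => LinearMap.mem_range_self _ _
  · rintro _ ⟨v, rfl⟩ _ ⟨w, rfl⟩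
    exact ⟨_, inc₁_circHat circ v w⟩
  · rintro _ ⟨v, rfl⟩
    exact D_inc₁_mapT_inc₂ circ v a

end Square

/-! ### The block permutation as an exchange of the two middle blocks -/

section SwapMiddle

theorem swapMiddle_eq (a b c d : ℕ) :
    swapMiddle a b c d = (finCongr (by omega)).trans
      ((sumPerm (sumPerm (Equiv.refl (Fin a)) (finAddFlip : Fin (c + b) ≃ Fin (b + c)))
        (Equiv.refl (Fin d))).trans (finCongr (by omega))) := by
  refine Equiv.ext fun i => ?_
  refine Fin.addCases (fun i => Fin.addCases (fun i => ?_) (fun i => ?_) i)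
    (fun i => Fin.addCases (fun i => ?_) (fun i => ?_) i) i
  · have h : finCongr (show a + c + (b + d) = a + (c + b) + d by omega)
        (Fin.castAdd (b + d) (Fin.castAdd c i)) = Fin.castAdd d (Fin.castAdd (c + b) i) :=
      Fin.ext (by simp)
    rw [Equiv.trans_apply, h, Equiv.trans_apply, sumPerm_castAdd, sumPerm_castAdd]
    exact Fin.ext (by simp [swapMiddle])
  · have h : finCongr (show a + c + (b + d) = a + (c + b) + d by omega)
        (Fin.castAdd (b + d) (Fin.natAdd a i)) =
          Fin.castAdd d (Fin.natAdd a (Fin.castAdd b i)) :=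
      Fin.ext (by simp)
    rw [Equiv.trans_apply, h, Equiv.trans_apply, sumPerm_castAdd, sumPerm_natAdd]
    exact Fin.ext (by simp [swapMiddle, add_assoc])
  · have h : finCongr (show a + c + (b + d) = a + (c + b) + d by omega)
        (Fin.natAdd (a + c) (Fin.castAdd d i)) =
          Fin.castAdd d (Fin.natAdd a (Fin.natAdd c i)) :=
      Fin.ext (by simp [add_assoc])
    rw [Equiv.trans_apply, h, Equiv.trans_apply, sumPerm_castAdd, sumPerm_natAdd]
    exact Fin.ext (by simp [swapMiddle])
  · have h : finCongr (show a + c + (b + d) = a + (c + b) + d by omega)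
        (Fin.natAdd (a + c) (Fin.natAdd b i)) = Fin.natAdd (a + (c + b)) i :=
      Fin.ext (by simp [add_assoc])
    rw [Equiv.trans_apply, h, Equiv.trans_apply, sumPerm_natAdd]
    exact Fin.ext (by simp [swapMiddle, add_assoc, add_left_comm])

end SwapMiddle

/-! ### Multiplicativity of the coproduct -/

section Comul

variable {k g : Type*} [CommRing k] [AddCommGroup g] [Module k g]

theorem preMul_gen (star : T k g →ₗ[k] T k g →ₗ[k] T k g) {a b c d : ℕ}
    (σ : Equiv.Perm (Fin (a + b))) (τ : Equiv.Perm (Fin (c + d))) (u : ⨂[k]^a (Hat k g))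
    (v : ⨂[k]^b (Hat k g)) (x : ⨂[k]^c (Hat k g)) (y : ⨂[k]^d (Hat k g)) :
    preMul star (gen σ (u ⊗ₜ[k] v)) (gen τ (x ⊗ₜ[k] y)) =
      gen (mulPerm σ τ) (starDeg star a c u x ⊗ₜ[k] starDeg star b d v y) := by
  rw [preMul, toModule_gen, PreInd.lift_mk, LinearMap.flip_apply, toModule_gen, PreInd.lift_mk]
  rfl

theorem perm_mulPerm {a b c d : ℕ} (σ : Equiv.Perm (Fin (a + b))) (τ : Equiv.Perm (Fin (c + d)))
    {z : T k g} (hz : z ∈ deg k g (a + (c + b) + d)) :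
    perm (mulPerm σ τ) z = perm (blockPerm σ τ)
      (perm (sumPerm (sumPerm (Equiv.refl (Fin a)) (finAddFlip : Fin (c + b) ≃ Fin (b + c)))
        (Equiv.refl (Fin d))) z) := by
  have h1 : z ∈ deg k g (a + c + (b + d)) := by
    rwa [show a + c + (b + d) = a + (c + b) + d by omega]
  rw [mulPerm, ← perm_perm, ← perm_perm, perm_finCongr _ (perm_mem _ _), swapMiddle_eq,
    ← perm_perm, ← perm_perm, perm_finCongr _ h1, perm_finCongr _ (perm_mem _ _)]

variable (circ : g →ₗ[k] g →ₗ[k] g)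

theorem starOf_sumPerm (hc : IsPreLie circ) {m m' n n' : ℕ} (e : Fin m ≃ Fin m')
    (τ : Fin n ≃ Fin n') {a b : T k g} (ha : a ∈ deg k g m) (hb : b ∈ deg k g n) :
    starOf circ (perm e a) (perm τ b) = perm (sumPerm e τ) (starOf circ a b) := by
  obtain rfl : n = n' := by simpa using Fintype.card_congr τ
  exact starOf_perm circ hc e τ ha hb

/-- Rewrite the concatenations of `u, v` and of `x, y` as star products. By associativity the two
sides are then `u * (x v) * y` and `u * (v x) * y` up to permutations, and they differ by exchanging
the middle blocks. The required instances of equivariance are hypotheses, so that the computation is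
also available before `∘` is known to be pre-Lie. -/
theorem Phi_preMul_starOf_gen {a b c d : ℕ} (σ : Equiv.Perm (Fin (a + b)))
    (τ : Equiv.Perm (Fin (c + d))) (u : ⨂[k]^a (Hat k g)) (v : ⨂[k]^b (Hat k g))
    (x : ⨂[k]^c (Hat k g)) (y : ⨂[k]^d (Hat k g))
    (h1 : starOf (circSq circ)
        (perm σ (mapT (inc₁ k g) (ofDeg a u) * mapT (inc₂ k g) (ofDeg b v)))
        (perm τ (mapT (inc₁ k g) (ofDeg c x) * mapT (inc₂ k g) (ofDeg d y))) =
      perm (blockPerm σ τ) (starOf (circSq circ)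
        (mapT (inc₁ k g) (ofDeg a u) * mapT (inc₂ k g) (ofDeg b v))
        (mapT (inc₁ k g) (ofDeg c x) * mapT (inc₂ k g) (ofDeg d y))))
    (h2 : starOf (circSq circ) (mapT (inc₁ k g) (ofDeg a u))
        (perm (finAddFlip : Fin (c + b) ≃ Fin (b + c))
          (mapT (inc₁ k g) (ofDeg c x) * mapT (inc₂ k g) (ofDeg b v))) =
      perm (sumPerm (Equiv.refl (Fin a)) (finAddFlip : Fin (c + b) ≃ Fin (b + c)))
        (starOf (circSq circ) (mapT (inc₁ k g) (ofDeg a u))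
          (mapT (inc₁ k g) (ofDeg c x) * mapT (inc₂ k g) (ofDeg b v)))) :
    Phi k g (preMul (starOf circ) (gen σ (u ⊗ₜ[k] v)) (gen τ (x ⊗ₜ[k] y))) =
      starOf (circSq circ) (Phi k g (gen σ (u ⊗ₜ[k] v))) (Phi k g (gen τ (x ⊗ₜ[k] y))) := by
  rw [preMul_gen, Phi_gen, Phi_gen, Phi_gen, ofDeg_starDeg_starOf, ofDeg_starDeg_starOf, h1]
  have hu := mapT_ofDeg_mem (inc₁ k g) u
  have hv := mapT_ofDeg_mem (inc₂ k g) v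
  have hx := mapT_ofDeg_mem (inc₁ k g) x
  have hy := mapT_ofDeg_mem (inc₂ k g) y
  have h3 := starOf_inc₂_inc₁ circ (ofDeg b v) (ofDeg c x)
  have h4 := starOf_inc₁_inc₂ circ (ofDeg c x) (ofDeg b v)
  have h5 := starOf_inc₁_inc₂ circ (ofDeg a u) (ofDeg b v)
  have h6 := starOf_inc₁_inc₂ circ (ofDeg c x) (ofDeg d y)
  rw [← starOf_inc₁_inc₂ circ, mapT_inc₁_starOf, mapT_inc₂_starOf, ← h5, ← h6]
  generalize mapT (inc₁ k g) (ofDeg a u) = u' at *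
  generalize mapT (inc₂ k g) (ofDeg b v) = v' at *
  generalize mapT (inc₁ k g) (ofDeg c x) = x' at *
  generalize mapT (inc₂ k g) (ofDeg d y) = y' at *
  have h7 : starOf (circSq circ) (starOf (circSq circ) u' x') (starOf (circSq circ) v' y') =
      starOf (circSq circ) (starOf (circSq circ) u' (x' * v')) y' := by
    rw [← h4]
    simp only [starOf_assoc]
  have h8 : starOf (circSq circ) (starOf (circSq circ) u' v') (starOf (circSq circ) x' y') =
      starOf (circSq circ) (starOf (circSq circ) u' (v' * x')) y' := by
    rw [← h3]
    simp only [starOf_assoc]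
  have huxv := starOf_mem_deg (circSq circ) hu (mul_mem_deg hx hv)
  rw [h7, h8, ← perm_finAddFlip hx hv, perm_mulPerm σ τ (starOf_mem_deg _ huxv hy),
    ← starOf_perm_left _ _ huxv hy, ← h2]

theorem Phi_preMul_starOf (hc : IsPreLie circ) (A B : PreTensor k g) :
    Phi k g (preMul (starOf circ) A B) = starOf (circSq circ) (Phi k g A) (Phi k g B) := by
  have hc' := circSq_isPreLie circ hc
  refine LinearMap.congr_fun₂ (f := (preMul (starOf circ)).compr₂ (Phi k g))
    (g := (starOf (circSq circ)).compl₁₂ (Phi k g) (Phi k g)) ?_ A B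
  refine preTensor_hom_ext fun a b σ => TensorProduct.ext' fun u v => ?_
  refine preTensor_hom_ext fun c d τ => TensorProduct.ext' fun x y => ?_
  have hu := mapT_ofDeg_mem (inc₁ k g) u
  have hv := mapT_ofDeg_mem (inc₂ k g) v
  have hx := mapT_ofDeg_mem (inc₁ k g) x
  have hy := mapT_ofDeg_mem (inc₂ k g) y
  refine Phi_preMul_starOf_gen circ σ τ u v x y
    (starOf_perm _ hc' σ τ (mul_mem_deg hu hv) (mul_mem_deg hx hy)) ?_
  rw [← starOf_sumPerm _ hc' _ _ hu (mul_mem_deg hx hv), perm_of_refl hu]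

theorem starOf_comul_star (hc : IsPreLie circ) (x y : T k g) :
    comul k g (starOf circ x y) =
      (tensorRel k g).mkQ (preMul (starOf circ) (preComul k g x) (preComul k g y)) := by
  rw [comul, LinearMap.comp_apply, mkQ_eq_iff, Phi_preMul_starOf circ hc, Phi_preComul,
    Phi_preComul, Phi_preComul]
  exact mapT_starOf _ (diag_circHat circ) diag_tHat x y

theorem starOf_isStarProduct (hc : IsPreLie circ) : IsStarProduct (starOf circ) where
  bialgebra :=
    { toIsTwistedAlgebra := starOf_isTwistedAlgebra circ hc
      comul_star := starOf_comul_star circ hc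
      counit_star := counit_starOf circ }
  filtered := starOf_isFilteredDeformation circ
  degree := starOf_degreeCondition circ
  star_t := starOf_tT circ
  t_star := tT_starOf circ

end Comul

/-! ### Linear maps applied position by position -/

section LetterMap

variable {k g h : Type*} [CommRing k] [AddCommGroup g] [Module k g] [AddCommGroup h] [Module k h]

/-- Apply linear maps to the letters of the words of length `n`, and kill the other words. -/
def letterMap {n : ℕ} (φ : Fin n → Hat k g →ₗ[k] Hat k h) : T k g →ₗ[k] T k h :=
  ofDeg n ∘ₗ PiTensorProduct.map φ ∘ₗ toDeg n

theorem letterMap_word {n : ℕ} (φ : Fin n → Hat k g →ₗ[k] Hat k h) (f : Fin n → Hat k g) :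
    letterMap φ (word f) = word fun i => φ i (f i) := by
  rw [letterMap, LinearMap.comp_apply, LinearMap.comp_apply, ← ofDeg_tprod, toDeg_ofDeg,
    PiTensorProduct.map_tprod, ofDeg_tprod]

theorem letterMap_of_ne {n l : ℕ} (φ : Fin n → Hat k g →ₗ[k] Hat k h) (hl : n ≠ l) {a : T k g}
    (ha : a ∈ deg k g l) : letterMap φ a = 0 := by
  rw [letterMap, LinearMap.comp_apply, LinearMap.comp_apply, toDeg_of_ne hl ha, map_zero, map_zero]

theorem letterMap_id {n : ℕ} {a : T k g} (ha : a ∈ deg k g n) :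
    letterMap (fun _ : Fin n => LinearMap.id) a = a :=
  eqOn_deg (G := LinearMap.id) (fun f => letterMap_word _ f) ha

theorem letterMap_mapT {h' : Type*} [AddCommGroup h'] [Module k h'] {n : ℕ}
    (φ : Fin n → Hat k h →ₗ[k] Hat k h') (ψ : Hat k g →ₗ[k] Hat k h) {a : T k g}
    (ha : a ∈ deg k g n) : letterMap φ (mapT ψ a) = letterMap (fun i => φ i ∘ₗ ψ) a := by
  refine eqOn_deg (F := letterMap φ ∘ₗ (mapT ψ).toLinearMap) (fun f => ?_) ha
  rw [LinearMap.comp_apply, AlgHom.toLinearMap_apply, mapT_word, letterMap_word, letterMap_word]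
  rfl

theorem word_eq_zero {n : ℕ} {f : Fin n → Hat k g} (i : Fin n) (hi : f i = 0) : word f = 0 := by
  rw [word_eq_tprod]
  exact MultilinearMap.map_coord_zero _ i hi

theorem incl_pow_le_span (N : ℕ) : LinearMap.range (incl k g) ^ N ≤
    Submodule.span k {a | ∃ f : Fin N → Hat k g, (∀ i, (f i).2 = 0) ∧ a = word f} := by
  induction N with
  | zero =>
    rw [pow_zero, Submodule.one_eq_span, Submodule.span_le, Set.singleton_subset_iff]
    exact Submodule.subset_span ⟨Fin.elim0, fun i => i.elim0, (word_zero _).symm⟩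
  | succ N ih =>
    rw [pow_succ, Submodule.mul_le]
    rintro a ha _ ⟨x, rfl⟩
    have h1 : Submodule.span k {a | ∃ f : Fin N → Hat k g, (∀ i, (f i).2 = 0) ∧ a = word f} ≤
        (Submodule.span k {a | ∃ f : Fin (N + 1) → Hat k g, (∀ i, (f i).2 = 0) ∧
          a = word f}).comap (LinearMap.mulRight k (incl k g x)) := by
      refine Submodule.span_le.2 ?_
      rintro _ ⟨f, hf, rfl⟩
      refine Submodule.subset_span ⟨Fin.snoc f ((x, 0) : Hat k g), ?_, ?_⟩
      · intro i
        refine Fin.lastCases ?_ (fun i => ?_) i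
        · rw [Fin.snoc_last]
        · rw [Fin.snoc_castSucc, hf]
      · rw [word_snoc, LinearMap.mulRight_apply, incl_apply]
    exact h1 (ih ha)

/-- Maps of letters preserving `Σg` in the first `N` positions, and all the letters in the other
ones, are the identity on `T^N(Σg) T ĝ`. -/
theorem letterMap_eq_self {N n : ℕ} {φ : Fin n → Hat k g →ₗ[k] Hat k g}
    (h1 : ∀ i : Fin n, (i : ℕ) < N → ∀ x : g, φ i (x, 0) = (x, 0))
    (h2 : ∀ i : Fin n, N ≤ (i : ℕ) → φ i = LinearMap.id) {a : T k g} (ha : a ∈ deg k g n)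
    (haN : a ∈ LinearMap.range (incl k g) ^ N * (⊤ : Submodule k (T k g))) :
    letterMap φ a = a := by
  have h3 : LinearMap.range (incl k g) ^ N * (⊤ : Submodule k (T k g)) ≤
      LinearMap.ker (letterMap φ - letterMap fun _ : Fin n => LinearMap.id) := by
    rw [Submodule.mul_le]
    intro b hb c _
    rw [LinearMap.mem_ker]
    refine LinearMap.congr_fun (f := (letterMap φ - letterMap fun _ : Fin n => LinearMap.id) ∘ₗ
      LinearMap.mulLeft k b) (g := 0) (hom_ext_word fun l f' => ?_) c
    have h4 : Submodule.span k {a | ∃ f : Fin N → Hat k g, (∀ i, (f i).2 = 0) ∧ a = word f} ≤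
        LinearMap.ker ((letterMap φ - letterMap fun _ : Fin n => LinearMap.id) ∘ₗ
          LinearMap.mulRight k (word f')) := by
      refine Submodule.span_le.2 ?_
      rintro _ ⟨f, hf, rfl⟩
      rw [SetLike.mem_coe, LinearMap.mem_ker, LinearMap.comp_apply, LinearMap.mulRight_apply,
        ← word_append, LinearMap.sub_apply]
      by_cases hn : n = N + l
      · subst hn
        rw [letterMap_word, letterMap_word, sub_eq_zero]
        congr 1
        funext i
        refine Fin.addCases (fun i => ?_) (fun i => ?_) i
        · rw [Fin.append_left, LinearMap.id_apply]
          have h5 : f i = ((f i).1, 0) := Prod.ext rfl (hf i)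
          rw [h5, h1 _ (by simp)]
        · rw [h2 _ (by simp)]
      · rw [letterMap_of_ne _ hn (word_mem _), letterMap_of_ne _ hn (word_mem _), sub_zero]
    exact LinearMap.mem_ker.1 (h4 (incl_pow_le_span N hb))
  have h6 := LinearMap.mem_ker.1 (h3 haN)
  rwa [LinearMap.sub_apply, letterMap_id ha, sub_eq_zero] at h6

end LetterMap

/-! ### Reading off the coefficient of a power of `t` -/

section FirstCoefficient

variable (k g : Type*) [CommRing k] [AddCommGroup g] [Module k g]

/-- The representation of `T_k ĝ` on `k × g` in which `v = x + c t` sends `(r, y)` to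
`(c r, r x)`. -/
def coeffRep : T k g →ₐ[k] Module.End k (k × g) :=
  TensorAlgebra.lift k
    (LinearMap.mk₂ k (fun (v : Hat k g) (p : k × g) => ((v.2 * p.1, p.1 • v.1) : k × g))
      (fun _ _ _ => Prod.ext (add_mul _ _ _) (smul_add _ _ _))
      (fun _ _ _ => Prod.ext (mul_assoc _ _ _) (smul_comm _ _ _))
      (fun _ _ _ => Prod.ext (mul_add _ _ _) (add_smul _ _ _))
      (fun _ _ _ => Prod.ext (mul_left_comm _ _ _) (mul_smul _ _ _)))

/-- The sum over `r` of the elements `x` for which `x t^r` occurs in an element of `T_k ĝ`. -/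
def firstCoeff : T k g →ₗ[k] g :=
  LinearMap.snd k k g ∘ₗ LinearMap.applyₗ ((1, 0) : k × g) ∘ₗ (coeffRep k g).toLinearMap

variable {k g}

theorem coeffRep_ι (v : Hat k g) (p : k × g) :
    coeffRep k g (TensorAlgebra.ι k v) p = (v.2 * p.1, p.1 • v.1) := by
  rw [coeffRep, TensorAlgebra.lift_ι_apply]
  rfl

theorem firstCoeff_mul_ι (v w : Hat k g) :
    firstCoeff k g (TensorAlgebra.ι k v * TensorAlgebra.ι k w) = w.2 • v.1 := by
  change (coeffRep k g _ (1, 0)).2 = _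
  rw [map_mul, Module.End.mul_apply, coeffRep_ι, coeffRep_ι]
  simp

theorem firstCoeff_incl_mul_t_mul_t (x : g) :
    firstCoeff k g (incl k g x * (tT k g * tT k g)) = x := by
  change (coeffRep k g _ (1, 0)).2 = _
  rw [map_mul, map_mul, Module.End.mul_apply, Module.End.mul_apply, incl_apply, tT, coeffRep_ι,
    coeffRep_ι, coeffRep_ι]
  simp [tHat]

/-- A word of two letters of filtration degree at most one has a multiple of `t` among them, and the
first letter may be taken in `Σg`, so `t` stands second. -/
theorem eq_incl_firstCoeff_mul_t {a : T k g} (h1 : a ∈ deg k g 2) (h2 : a ∈ fil k g 1)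
    (h3 : a ∈ LinearMap.range (incl k g) ^ 1 * (⊤ : Submodule k (T k g))) :
    a = incl k g (firstCoeff k g a) * tT k g := by
  have h4 : letterMap ![killT k g, LinearMap.id] a = a := by
    refine letterMap_eq_self (N := 1) ?_ ?_ h1 h3
    · intro i hi x
      obtain rfl : i = 0 := Fin.ext (by simpa using hi)
      rfl
    · intro i hi
      obtain rfl : i = 1 := Fin.ext (by have := i.2; simp; omega)
      rfl
  -- On degree two elements of filtration at most one, killing `t` in the first position has the
  -- same effect as extracting the coefficient of `x t`; by `h4` the first operation fixes `a`.
  have h5 : fil k g 1 ≤ LinearMap.ker (letterMap ![killT k g, LinearMap.id] -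
      (LinearMap.mulRight k (tT k g) ∘ₗ incl k g ∘ₗ firstCoeff k g) ∘ₗ
        letterMap fun _ : Fin 2 => LinearMap.id) := by
    refine fil_induction fun n => Submodule.span_le.2 ?_
    rintro _ ⟨f, d, hf, hd, rfl⟩
    rw [SetLike.mem_coe, LinearMap.mem_ker, LinearMap.sub_apply, LinearMap.comp_apply]
    by_cases hn : 2 = n
    · subst hn
      have hw : ∀ f : Fin 2 → Hat k g,
          word f = TensorAlgebra.ι k (f 0) * TensorAlgebra.ι k (f 1) := fun f => by
        simp [word]
      rw [letterMap_id (word_mem f), letterMap_word, hw, hw]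
      simp only [LinearMap.comp_apply, LinearMap.mulRight_apply, firstCoeff_mul_ι]
      rw [Fin.sum_univ_two] at hd
      have hd' : d 0 + d 1 ≤ 1 := by exact_mod_cast hd
      change TensorAlgebra.ι k (killT k g (f 0)) * TensorAlgebra.ι k (f 1) - _ = 0
      -- If the first letter is a multiple of `t`, both sides vanish; otherwise the second letter is
      -- one, and both sides give the same multiple of `x t`.
      rcases Nat.eq_zero_or_pos (d 0) with h0 | h0
      · have h6 := hf 0
        rw [h0] at h6
        obtain ⟨c, hc⟩ := Submodule.mem_span_singleton.1 h6
        have h7 : (f 0).1 = 0 := by simp [← hc, tHat]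
        have h8 : killT k g (f 0) = 0 := Prod.ext h7 rfl
        rw [h7, h8, map_zero, smul_zero, map_zero, zero_mul, zero_mul, sub_zero]
      · have h6 := hf 1
        rw [show d 1 = 0 by omega] at h6
        obtain ⟨c, hc⟩ := Submodule.mem_span_singleton.1 h6
        rw [← hc, map_smul, map_smul, incl_apply, tT, mul_smul_comm, smul_mul_assoc]
        simp [tHat, killT]
    · rw [letterMap_of_ne _ hn (word_mem _), letterMap_of_ne _ hn (word_mem _), map_zero, sub_zero]
  have h6 := LinearMap.mem_ker.1 (h5 h2)
  rw [LinearMap.sub_apply, LinearMap.comp_apply, letterMap_id h1, h4, sub_eq_zero] at h6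
  exact h6

end FirstCoefficient

/-! ### The comparison map when the right factor has degree one -/

section PreDegree

variable (k g : Type*) [CommRing k] [AddCommGroup g] [Module k g]

/-- The degree `m` part of the module of representatives. -/
def preDeg (m : ℕ) : Submodule k (PreTensor k g) :=
  Submodule.span k {A | ∃ (p q : ℕ) (σ : Equiv.Perm (Fin (p + q))) (u : ⨂[k]^p (Hat k g))
    (v : ⨂[k]^q (Hat k g)), p + q = m ∧ A = gen σ (u ⊗ₜ[k] v)}

variable {k g}

theorem preComul_mem_preDeg {m : ℕ} {a : T k g} (ha : a ∈ deg k g m) :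
    preComul k g a ∈ preDeg k g m := by
  refine deg_induction (P := fun a => preComul k g a ∈ preDeg k g m) (fun f => ?_)
    (fun a b ha hb => by rw [map_add]; exact Submodule.add_mem _ ha hb)
    (fun r a ha => by rw [map_smul]; exact Submodule.smul_mem _ _ ha) ha
  rw [preComul_eq_split, split_word]
  exact Submodule.sum_mem _ fun p _ => Submodule.sum_mem _ fun σ _ => Submodule.subset_span
    ⟨_, _, σ, _, _, Finset.HasAntidiagonal.mem_antidiagonal.1 p.2, rfl⟩

/-- A right factor of degree one makes the pre-Lie identity superfluous: the two instances of right
equivariance can be checked from the formula for multiplication by a letter. This matters for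
uniqueness, where `circOf star` is not yet known to be pre-Lie. -/
theorem Phi_preMul_starOf_of_mem_preDeg_one (circ : g →ₗ[k] g →ₗ[k] g) (A : PreTensor k g)
    {B : PreTensor k g} (hB : B ∈ preDeg k g 1) :
    Phi k g (preMul (starOf circ) A B) = starOf (circSq circ) (Phi k g A) (Phi k g B) := by
  refine LinearMap.eqOn_span (f := Phi k g ∘ₗ preMul (starOf circ) A)
    (g := starOf (circSq circ) (Phi k g A) ∘ₗ Phi k g) ?_ hB
  rintro _ ⟨c, d, τ, x, y, hcd, rfl⟩
  refine LinearMap.congr_fun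
    (f := Phi k g ∘ₗ (preMul (starOf circ)).flip (gen τ (x ⊗ₜ[k] y)))
    (g := (starOf (circSq circ)).flip (Phi k g (gen τ (x ⊗ₜ[k] y))) ∘ₗ Phi k g)
    (preTensor_hom_ext fun a b σ => TensorProduct.ext' fun u v => ?_) A
  have hu := mapT_ofDeg_mem (inc₁ k g) u
  have hv := mapT_ofDeg_mem (inc₂ k g) v
  have hx := mapT_ofDeg_mem (inc₁ k g) x
  have hy := mapT_ofDeg_mem (inc₂ k g) y
  have h1 := starOf_inc₂_inc₁ circ (ofDeg b v) (ofDeg c x)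
  have h2 := starOf_inc₁_inc₂ circ (ofDeg c x) (ofDeg b v)
  have h3 := starOf_inc₁_inc₂ circ (ofDeg a u) (ofDeg b v)
  refine Phi_preMul_starOf_gen circ σ τ u v x y ?_ ?_
  · have hτ : τ = Equiv.refl _ := Equiv.ext fun i => Fin.ext (by
      have h4 := i.2
      have h5 := (τ i).2
      rw [Equiv.refl_apply]
      omega)
    have hxy := mul_mem_deg hx hy
    rw [hτ, perm_of_refl hxy, starOf_perm_left _ σ (mul_mem_deg hu hv) hxy, blockPerm_eq_sumPerm]
  · rw [perm_finAddFlip hx hv, ← h1, ← starOf_assoc, h3]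
    -- For `c = 0` the element `x` is a scalar. For `c = 1` it is a letter `w`, and both sides are
    -- computed explicitly; `D_w` for the first copy of `g` annihilates the second copy.
    have hc : c = 0 ∨ c = 1 := by omega
    rcases hc with rfl | rfl
    · obtain ⟨r, hr⟩ := deg_zero_induction (ofDeg_mem 0 x)
      rw [hr, map_smul, map_one, map_smul, starOf_one, smul_mul_assoc, one_mul, map_smul, map_smul,
        h3]
      have h4 := perm_mul (Equiv.refl (Fin a)) (finAddFlip : Fin (0 + b) ≃ Fin (b + 0)) hu
        (mul_mem_deg (one_mem_deg (k := k) (g := g × g)) hv)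
      rw [one_mul] at h4
      have h5 := perm_finAddFlip (one_mem_deg (k := k) (g := g × g)) hv
      rw [one_mul, mul_one] at h5
      rw [← h4, h5, perm_of_refl hu]
    · obtain ⟨w, hw⟩ := deg_one_induction (ofDeg_mem 1 x)
      rw [hw, mapT_ι] at h2 hx ⊢
      have h6 : starOf (circSq circ) (mapT (inc₁ k g) (ofDeg a u))
          (TensorAlgebra.ι k (inc₁ k g w) * mapT (inc₂ k g) (ofDeg b v)) =
          mapT (inc₁ k g) (ofDeg a u) *
              (TensorAlgebra.ι k (inc₁ k g w) * mapT (inc₂ k g) (ofDeg b v)) +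
            D (circSq circ) (inc₁ k g w) (mapT (inc₁ k g) (ofDeg a u)) *
              (tT k (g × g) * mapT (inc₂ k g) (ofDeg b v)) := by
        have h7 := starOf_inc₁_inc₂ circ (starOf circ (ofDeg a u) (TensorAlgebra.ι k w)) (ofDeg b v)
        rw [mapT_inc₁_starOf, mapT_ι] at h7
        rw [← h2, ← starOf_assoc, h7, starOf_ι, add_mul, mul_assoc, mul_assoc, h2]
      have ht : tT k (g × g) ∈ deg k (g × g) 1 := ι_mem_deg _
      rw [h6, map_add, ← perm_mul _ _ hu (mul_mem_deg hx hv),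
        ← perm_mul _ _ (D_mem_deg _ _ hu) (mul_mem_deg ht hv), perm_of_refl hu,
        perm_of_refl (D_mem_deg _ _ hu), perm_finAddFlip hx hv, perm_finAddFlip ht hv, starOf_ι,
        D_mul, D_inc₁_mapT_inc₂, mul_zero, add_zero, mul_assoc, mul_assoc]

end PreDegree

/-! ### Recovering an element from the mixed components of its coproduct -/

section Separate

variable (k g : Type*) [CommRing k] [AddCommGroup g] [Module k g]

/-- Apply to words of length `n` the first projection `(g × g)^ → ĝ`, with `t` killed in the
first position, except in the second position, where the second projection is applied. -/
def separate (n : ℕ) : T k (g × g) →ₗ[k] T k g :=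
  letterMap fun i : Fin n => if (i : ℕ) = 0 then killT k g ∘ₗ prj₁ k g else
    if (i : ℕ) = 1 then prj₂ k g else prj₁ k g

variable {k g}

/-- After the diagonal, the first two positions only lose their `t`-component and the others are
unchanged. An element whose first two letters lie in `Σg` is therefore recovered. -/
theorem separate_mapT_diag {N n : ℕ} (hN : 2 ≤ N) {a : T k g} (ha : a ∈ deg k g n)
    (haN : a ∈ LinearMap.range (incl k g) ^ N * (⊤ : Submodule k (T k g))) :
    separate k g n (mapT (diag k g) a) = a := by
  rw [separate, letterMap_mapT _ _ ha]
  refine letterMap_eq_self (N := N) (fun i _ x => ?_) (fun i hi => ?_) ha haN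
  · split_ifs <;> rfl
  · rw [if_neg (by omega), if_neg (by omega)]
    rfl

theorem separate_perm_inc₁ {l n : ℕ} (hn : 2 ≤ n) (e : Fin l ≃ Fin n) {a : T k g}
    (ha : a ∈ deg k g l) : separate k g n (perm e (mapT (inc₁ k g) a)) = 0 := by
  refine eqOn_deg (F := separate k g n ∘ₗ perm e ∘ₗ (mapT (inc₁ k g)).toLinearMap) (G := 0)
    (fun f => ?_) ha
  rw [LinearMap.comp_apply, LinearMap.comp_apply, AlgHom.toLinearMap_apply, mapT_word, perm_word,
    separate, letterMap_word]
  refine word_eq_zero ⟨1, by omega⟩ ?_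
  rw [if_neg (by simp), if_pos rfl]
  exact prj₂_inc₁ _

theorem separate_perm_inc₂ {l n : ℕ} (hn : 2 ≤ n) (e : Fin l ≃ Fin n) {a : T k g}
    (ha : a ∈ deg k g l) : separate k g n (perm e (mapT (inc₂ k g) a)) = 0 := by
  refine eqOn_deg (F := separate k g n ∘ₗ perm e ∘ₗ (mapT (inc₂ k g)).toLinearMap) (G := 0)
    (fun f => ?_) ha
  rw [LinearMap.comp_apply, LinearMap.comp_apply, AlgHom.toLinearMap_apply, mapT_word, perm_word,
    separate, letterMap_word]
  refine word_eq_zero ⟨0, by omega⟩ ?_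
  rw [if_pos rfl]
  rfl

/-- A component with an empty factor has all its letters in one copy of `g`. It dies at the second
position if this is the first copy, and at the first position if it is the second copy; the latter
needs `t` to be killed there. -/
theorem separate_perm_mul {p q n : ℕ} (hn : 2 ≤ n) (e : Equiv.Perm (Fin (p + q)))
    (hpq : p + q = n) {a b : T k g} (ha : a ∈ deg k g p) (hb : b ∈ deg k g q)
    (h : p = 0 ∨ q = 0) :
    separate k g n (perm e (mapT (inc₁ k g) a * mapT (inc₂ k g) b)) = 0 := by
  subst hpq
  rcases h with rfl | rfl
  · obtain ⟨r, rfl⟩ := deg_zero_induction ha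
    rw [map_smul, map_one, smul_mul_assoc, one_mul, ← map_smul]
    exact separate_perm_inc₂ hn e (by rw [zero_add]; exact Submodule.smul_mem _ _ hb)
  · obtain ⟨r, rfl⟩ := deg_zero_induction hb
    rw [map_smul, map_one, mul_smul_comm, mul_one, ← map_smul]
    exact separate_perm_inc₁ hn e (Submodule.smul_mem _ _ ha)

end Separate

/-! ### Every star product comes from its underlying operation -/

section Uniqueness

variable {k g : Type*} [CommRing k] [AddCommGroup g] [Module k g]

theorem IsTwistedAlgebra.star_mem_deg {star : T k g →ₗ[k] T k g →ₗ[k] T k g}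
    (hs : IsTwistedAlgebra star) {m n : ℕ} {a b : T k g} (ha : a ∈ deg k g m)
    (hb : b ∈ deg k g n) : star a b ∈ deg k g (m + n) := by
  obtain ⟨x, rfl⟩ := ha
  obtain ⟨y, rfl⟩ := hb
  rw [hs.graded]
  exact ofDeg_mem _ _

theorem IsTwistedAlgebra.star_perm {star : T k g →ₗ[k] T k g →ₗ[k] T k g}
    (hs : IsTwistedAlgebra star) {m n : ℕ} (σ : Equiv.Perm (Fin m)) (τ : Equiv.Perm (Fin n))
    {a b : T k g} (ha : a ∈ deg k g m) (hb : b ∈ deg k g n) :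
    star (perm σ a) (perm τ b) = perm (blockPerm σ τ) (star a b) := by
  obtain ⟨x, rfl⟩ := ha
  obtain ⟨y, rfl⟩ := hb
  rw [perm_ofDeg, perm_ofDeg, hs.graded m n x y, perm_ofDeg]
  refine (hs.graded m n (act σ x) (act τ y)).trans ?_
  rw [hs.equivariant]

theorem word_mem_incl_pow {n : ℕ} (f : Fin n → Hat k g) (hf : ∀ i, (f i).2 = 0) :
    word f ∈ LinearMap.range (incl k g) ^ n := by
  induction n with
  | zero =>
    rw [word_zero, pow_zero]
    exact Submodule.one_le.1 le_rfl
  | succ n ih =>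
    rw [word_eq_init, pow_succ]
    refine Submodule.mul_mem_mul (ih _ fun i => hf _) ⟨(f (Fin.last n)).1, ?_⟩
    rw [incl_apply]
    exact congrArg _ (Prod.ext rfl (hf _).symm)

theorem exists_perm_tT_mul {n : ℕ} (f : Fin (n + 1) → Hat k g) {i : Fin (n + 1)}
    (hi : f i = tHat k g) :
    ∃ (τ : Equiv.Perm (Fin (n + 1))) (f' : Fin n → Hat k g), word f = perm τ (tT k g * word f') := by
  refine ⟨Equiv.swap i 0, Fin.tail (f ∘ Equiv.swap i 0), ?_⟩
  have h : tT k g * word (Fin.tail (f ∘ Equiv.swap i 0)) = word (f ∘ Equiv.swap i 0) := by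
    rw [← Fin.cons_self_tail (f ∘ Equiv.swap i 0), word_cons, Fin.tail_cons, Function.comp_apply,
      Equiv.swap_apply_right, hi, tT]
  rw [h, perm_word]
  congr 1
  funext j
  simp

variable {circ : g →ₗ[k] g →ₗ[k] g} {star : T k g →ₗ[k] T k g →ₗ[k] T k g}

theorem star_eq_starOf_of_add_le (hs : IsTwistedAlgebra star) {m : ℕ}
    (ih : ∀ l < m, ∀ a ∈ deg k g l, ∀ v : Hat k g,
      star a (TensorAlgebra.ι k v) = starOf circ a (TensorAlgebra.ι k v))
    {p c : ℕ} (hpc : p + c ≤ m) (hc : c ≤ 1) {a b : T k g} (ha : a ∈ deg k g p)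
    (hb : b ∈ deg k g c) : star a b = starOf circ a b := by
  have hc' : c = 0 ∨ c = 1 := by omega
  rcases hc' with rfl | rfl
  · obtain ⟨r, rfl⟩ := deg_zero_induction hb
    rw [map_smul, map_smul, hs.star_one, starOf_one]
  · obtain ⟨v, rfl⟩ := deg_one_induction hb
    exact ih p (by omega) a ha v

/-- The product has total degree `m + 1`. A component whose two factors both have degree at most `m`
only involves products covered by the induction hypothesis, and the others have a factor of degree
`0` and are killed by `separate`. -/
theorem separate_Phi_preMul (hs : IsTwistedAlgebra star) {m : ℕ} (hm : 2 ≤ m)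
    (ih : ∀ l < m, ∀ a ∈ deg k g l, ∀ v : Hat k g,
      star a (TensorAlgebra.ι k v) = starOf circ a (TensorAlgebra.ι k v))
    {A B : PreTensor k g} (hA : A ∈ preDeg k g m) (hB : B ∈ preDeg k g 1) :
    separate k g (m + 1) (Phi k g (preMul star A B)) =
      separate k g (m + 1) (Phi k g (preMul (starOf circ) A B)) := by
  refine LinearMap.eqOn_span (f := (separate k g (m + 1) ∘ₗ Phi k g) ∘ₗ preMul star A)
    (g := (separate k g (m + 1) ∘ₗ Phi k g) ∘ₗ preMul (starOf circ) A) ?_ hB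
  rintro _ ⟨c, d, τ, x, y, hcd, rfl⟩
  refine LinearMap.eqOn_span
    (f := (separate k g (m + 1) ∘ₗ Phi k g) ∘ₗ (preMul star).flip (gen τ (x ⊗ₜ[k] y)))
    (g := (separate k g (m + 1) ∘ₗ Phi k g) ∘ₗ (preMul (starOf circ)).flip (gen τ (x ⊗ₜ[k] y)))
    ?_ hA
  rintro _ ⟨p, q, σ, u, v, hpq, rfl⟩
  simp only [LinearMap.comp_apply, LinearMap.flip_apply]
  rw [preMul_gen, preMul_gen, Phi_gen, Phi_gen, ofDeg_starDeg_starOf, ofDeg_starDeg_starOf,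
    ← hs.graded, ← hs.graded]
  by_cases h : p + c ≤ m ∧ q + d ≤ m
  · rw [star_eq_starOf_of_add_le hs ih h.1 (by omega) (ofDeg_mem p u) (ofDeg_mem c x),
      star_eq_starOf_of_add_le hs ih h.2 (by omega) (ofDeg_mem q v) (ofDeg_mem d y)]
  · have h' : p + c = 0 ∨ q + d = 0 := by omega
    rw [separate_perm_mul (by omega) _ (by omega) (hs.star_mem_deg (ofDeg_mem p u) (ofDeg_mem c x))
        (hs.star_mem_deg (ofDeg_mem q v) (ofDeg_mem d y)) h',
      separate_perm_mul (by omega) _ (by omega)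
        (starOf_mem_deg circ (ofDeg_mem p u) (ofDeg_mem c x))
        (starOf_mem_deg circ (ofDeg_mem q v) (ofDeg_mem d y)) h']

/-- The operation on `g` underlying a star product. -/
def circOf (star : T k g →ₗ[k] T k g →ₗ[k] T k g) : g →ₗ[k] g →ₗ[k] g :=
  (star.compl₁₂ (incl k g) (incl k g)).compr₂ (firstCoeff k g)

theorem circOf_apply (x y : g) :
    circOf star x y = firstCoeff k g (star (incl k g x) (incl k g y)) := rfl

theorem incl_mem_range_pow_one (x : g) : incl k g x ∈ LinearMap.range (incl k g) ^ 1 := by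
  rw [pow_one]
  exact LinearMap.mem_range_self _ _

theorem firstCoeff_incl_mul_incl (x y : g) :
    firstCoeff k g (incl k g x * incl k g y) = 0 := by
  rw [incl_apply, incl_apply, firstCoeff_mul_ι, zero_smul]

/-- The difference `x * y - x y` has degree two, lies in filtration `1 + 1 - 1` and starts with a
letter of `Σg`, which leaves only terms of the form `z t`. -/
theorem IsStarProduct.star_incl_incl (hs : IsStarProduct star) (x y : g) :
    star (incl k g x) (incl k g y) =
      incl k g x * incl k g y + incl k g (circOf star x y) * tT k g := by
  have hx : incl k g x ∈ deg k g 1 := ι_mem_deg _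
  have hy : incl k g y ∈ deg k g 1 := ι_mem_deg _
  have h := eq_incl_firstCoeff_mul_t
    (Submodule.sub_mem _ (hs.bialgebra.star_mem_deg hx hy) (mul_mem_deg hx hy))
    (hs.filtered 1 1 _ (ι_mem_fil (d := 1) trivial) _ (ι_mem_fil (d := 1) trivial)).2
    (Submodule.sub_mem _ (hs.degree 1 _ (incl_mem_range_pow_one x) _)
      (Submodule.mul_mem_mul (incl_mem_range_pow_one x) trivial))
  rw [map_sub, firstCoeff_incl_mul_incl, sub_zero, ← circOf_apply] at h
  rw [← h, add_sub_cancel]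

theorem starOf_incl_incl (circ : g →ₗ[k] g →ₗ[k] g) (x y : g) :
    starOf circ (incl k g x) (incl k g y) =
      incl k g x * incl k g y + incl k g (circ x y) * tT k g := by
  rw [incl_apply y, starOf_ι, incl_apply, D_ι, circHat_apply]
  rfl

theorem IsStarProduct.star_ι (hs : IsStarProduct star) {m : ℕ} {a : T k g}
    (ha : a ∈ deg k g m) (v : Hat k g) :
    star a (TensorAlgebra.ι k v) = starOf (circOf star) a (TensorAlgebra.ι k v) := by
  induction m using Nat.strong_induction_on generalizing a v with
  | _ m ih =>
  have hv : TensorAlgebra.ι k v = incl k g v.1 + v.2 • tT k g := by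
    rw [incl_apply, tT, ← map_smul, ← map_add]
    exact congrArg _ (by simp [tHat])
  rw [hv, map_add, map_add, map_smul, map_smul, hs.star_t, starOf_tT, add_left_inj]
  generalize v.1 = x
  obtain ⟨a, rfl⟩ := ha
  refine LinearMap.congr_fun (f := star.flip (incl k g x) ∘ₗ ofDeg m)
    (g := (starOf (circOf star)).flip (incl k g x) ∘ₗ ofDeg m) (hom_ext_letters fun f hf => ?_) a
  simp only [LinearMap.comp_apply, LinearMap.flip_apply, ofDeg_tprod]
  have hx : incl k g x ∈ deg k g 1 := ι_mem_deg _
  have hA := hs.bialgebra.toIsTwistedAlgebra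
  by_cases h : ∀ i, (f i).2 = 0
  · obtain hm | hm : m ≤ 1 ∨ 2 ≤ m := by omega
    · obtain rfl | rfl : m = 0 ∨ m = 1 := by omega
      · rw [word_zero, hA.one_star, one_starOf]
      · have h1 : word f = incl k g (f 0).1 := by
          rw [word_one, incl_apply]
          exact congrArg _ (Prod.ext rfl (h 0))
        rw [h1, hs.star_incl_incl, starOf_incl_incl]
    · have hw := word_mem_incl_pow f h
      -- Both products lie in `T^m(Σg)` times the tensor algebra with `m ≥ 2`, so they are recovered
      -- from their coproducts. These are products of the same two coproducts, and `separate`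
      -- retains only components known by induction.
      rw [← separate_mapT_diag hm (hA.star_mem_deg (word_mem f) hx) (hs.degree m _ hw _),
        ← separate_mapT_diag hm (starOf_mem_deg _ (word_mem f) hx)
          (starOf_degreeCondition _ m _ hw _),
        mapT_starOf _ (diag_circHat _) diag_tHat, ← Phi_preComul, ← Phi_preComul, ← Phi_preComul,
        ← Phi_preMul_starOf_of_mem_preDeg_one _ _ (preComul_mem_preDeg hx),
        ← separate_Phi_preMul hA hm (fun l hl a ha v => ih l hl ha v)
          (preComul_mem_preDeg (word_mem f)) (preComul_mem_preDeg hx),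
        mkQ_eq_iff.1 (hs.bialgebra.comul_star (word f) (incl k g x))]
  · push Not at h
    obtain ⟨i, hi⟩ := h
    obtain ⟨n, rfl⟩ : ∃ n, m = n + 1 := ⟨m - 1, by have := i.pos; omega⟩
    obtain ⟨τ, f', hf'⟩ := exists_perm_tT_mul f ((hf i).resolve_left hi)
    have ht : tT k g * word f' ∈ deg k g (n + 1) := by
      have h1 := mul_mem_deg (ι_mem_deg (tHat k g)) (word_mem f')
      rwa [add_comm] at h1
    -- With `t` in front, `(t w) * x = t (w * x)` by associativity and the condition on `t`, and `w`
    -- has smaller degree.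
    have h1 : star (tT k g * word f') (incl k g x) =
        starOf (circOf star) (tT k g * word f') (incl k g x) := by
      have h2 := ih n (by omega) (word_mem f') ((x, 0) : Hat k g)
      rw [← incl_apply] at h2
      conv_lhs => rw [← hs.t_star, hA.assoc, hs.t_star, h2]
      rw [← tT_starOf (circOf star), ← tT_starOf (circOf star), starOf_assoc]
    have h3 := hA.star_perm τ (Equiv.refl (Fin 1)) ht hx
    rw [perm_of_refl hx] at h3
    rw [hf', h3, h1, starOf_perm_left _ τ ht hx, blockPerm_eq_sumPerm]

/-- Right multiplication by letters is known, so associativity for `a, b, v` is precisely the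
recursion characterizing `starOf`. -/
theorem IsStarProduct.eq_starOf_circOf (hs : IsStarProduct star) : star = starOf (circOf star) := by
  have hι : ∀ (a : T k g) (v : Hat k g), star a (TensorAlgebra.ι k v) =
      a * TensorAlgebra.ι k v + D (circOf star) v a * tT k g := fun a v => by
    rw [← starOf_ι]
    exact LinearMap.congr_fun (f := star.flip (TensorAlgebra.ι k v))
      (g := (starOf (circOf star)).flip (TensorAlgebra.ι k v))
      (hom_ext_deg fun l a ha => hs.star_ι ha v) a
  have hA := hs.bialgebra.toIsTwistedAlgebra
  have hstt : ∀ a b, star a (b * tT k g) = star a b * tT k g := fun a b => by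
    rw [← hs.star_t, ← hA.assoc, hs.star_t]
  refine eq_starOf _ hA.star_one fun a b v => ?_
  have h := hA.assoc a b (TensorAlgebra.ι k v)
  rw [hι, hι b, map_add, hstt] at h
  rw [h, add_sub_cancel_right]

theorem starOf_incl_mul (circ : g →ₗ[k] g →ₗ[k] g) (x y z : g) :
    starOf circ (incl k g x) (incl k g y * incl k g z) =
      incl k g x * (incl k g y * incl k g z) + incl k g (circ x y) * (tT k g * incl k g z) +
        incl k g (circ x z) * (incl k g y * tT k g) +
        incl k g (circ (circ x y) z - circ x (circ y z)) * (tT k g * tT k g) := by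
  have h := starOf_mul_ι_mul_ι circ (incl k g x) 1 ((y, 0) : Hat k g) ((z, 0) : Hat k g)
  simp only [one_mul, starOf_one, D_one, map_zero, sub_zero, add_zero, circHat_apply] at h
  simp only [incl_apply, D_ι, circHat_apply] at h ⊢
  rw [h, ← map_sub]
  simp

/-- Equivariance under the exchange of `y` and `z` matches the expansions of `x * (y z)` and `x * (z
y)`. All terms agree automatically except those in `t t`, whose coefficients are the two sides of
the pre-Lie identity up to sign. -/
theorem isPreLie_of_isTwistedAlgebra {circ : g →ₗ[k] g →ₗ[k] g}
    (hA : IsTwistedAlgebra (starOf circ)) : IsPreLie circ := by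
  intro x y z
  have hd : ∀ x : g, incl k g x ∈ deg k g 1 := fun x => ι_mem_deg _
  have ht : tT k g ∈ deg k g 1 := ι_mem_deg _
  have h := hA.star_perm (Equiv.refl (Fin 1)) (Equiv.swap (0 : Fin 2) 1) (hd x)
    (mul_mem_deg (hd y) (hd z))
  have hp : ∀ {a b c : T k g}, a ∈ deg k g 1 → b ∈ deg k g 1 → c ∈ deg k g 1 →
      perm (blockPerm (Equiv.refl (Fin 1)) (Equiv.swap (0 : Fin 2) 1)) (a * (b * c)) =
        a * (c * b) := fun {a b c} ha hb hc => by
    obtain ⟨v, rfl⟩ := deg_one_induction hb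
    obtain ⟨w, rfl⟩ := deg_one_induction hc
    rw [blockPerm_eq_sumPerm, perm_mul_two _ ha (mul_mem_deg hb hc), perm_swap_two]
  have hs : perm (Equiv.swap (0 : Fin 2) 1) (incl k g y * incl k g z) =
      incl k g z * incl k g y := perm_swap_two _ _
  rw [perm_of_refl (hd x), hs, starOf_incl_mul, starOf_incl_mul, map_add, map_add, map_add,
    hp (hd _) (hd _) (hd _), hp (hd _) ht (hd _), hp (hd _) (hd _) ht, hp (hd _) ht ht,
    add_right_comm (incl k g x * _)] at h
  have h1 := congrArg (firstCoeff k g) (add_left_cancel h)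
  rw [firstCoeff_incl_mul_t_mul_t, firstCoeff_incl_mul_t_mul_t] at h1
  rw [← neg_inj, neg_sub, neg_sub, h1]

theorem circOf_starOf (circ : g →ₗ[k] g →ₗ[k] g) : circOf (starOf circ) = circ := by
  refine LinearMap.ext₂ fun x y => ?_
  rw [circOf_apply, starOf_incl_incl, map_add, firstCoeff_incl_mul_incl, zero_add, incl_apply, tT,
    firstCoeff_mul_ι]
  exact one_smul _ _

theorem IsStarProduct.isPreLie_circOf (hs : IsStarProduct star) : IsPreLie (circOf star) :=
  isPreLie_of_isTwistedAlgebra (hs.eq_starOf_circOf ▸ hs.bialgebra.toIsTwistedAlgebra)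

end Uniqueness

end

end TwistedStar

/-! ### The bijection -/

theorem theorem4p3 {k g : Type*} [CommRing k] [AddCommGroup g] [Module k g] :
    ∃ e : {star : TwistedStar.T k g →ₗ[k] TwistedStar.T k g →ₗ[k] TwistedStar.T k g //
          TwistedStar.IsStarProduct star} ≃
        {circ : g →ₗ[k] g →ₗ[k] g // TwistedStar.IsPreLie circ},
      ∀ star, ∀ x y : g,
        star.1 (TwistedStar.incl k g x) (TwistedStar.incl k g y) =
          TwistedStar.incl k g x * TwistedStar.incl k g y +
            TwistedStar.incl k g ((e star).1 x y) * TwistedStar.tT k g :=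
  ⟨{ toFun := fun star => ⟨TwistedStar.circOf star.1, star.2.isPreLie_circOf⟩
     invFun := fun circ =>
      ⟨TwistedStar.starOf circ.1, TwistedStar.starOf_isStarProduct circ.1 circ.2⟩
     left_inv := fun star => Subtype.ext star.2.eq_starOf_circOf.symm
     right_inv := fun circ => Subtype.ext (TwistedStar.circOf_starOf circ.1) },
    fun star x y => star.2.star_incl_incl x y⟩
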